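/- **Setting.** Let $\mathcal L$ be the first-order language with $=$, $<$ and a function constant for every elementary recursive function. Let ${\sf EA}$ be the theory in $\mathcal L$ whose axioms are the axioms for equality, successor and $<$, the defining axioms of the function constants, and complete induction for bounded $\mathcal L$-formulas. Add a unary predicate constant $R_\varphi$ for each $X$-positive $\Pi^0_1$-formula $\varphi(X,x)$ of $\mathcal L\cup\{X\}$ in which only $x$ is free. In the resulting language let $\Pi^0_0(\Omega)=\Sigma^0_0(\Omega)$ be the class of formulas obtained from the atoms $t=s$, $t<s$, $R_\varphi(t)$ and their negations by $\land,\lor$ and bounded quantifiers. For $k\ge 0$, let $\Pi^0_{k+1}(\Omega)$ [resp. $\Sigma^0_{k+1}(\Omega)$] be the closure of $\Pi^0_k(\Omega)\cup\Sigma^0_k(\Omega)$ under $\land,\lor$, bounded quantifiers and $\forall x$ [resp. $\exists x$]. The theory $\Pi^0_k(\Omega)\text{-ID}(\Pi^0_1)$ is ${\sf EA}$ together with $$\theta(0)\land\forall x(\theta(x)\to\theta(x+1))\to\forall y\,\theta(y)\qquad(\theta\in\Pi^0_k(\Omega)),$$ $$\forall x[\varphi(R_\varphi,x)\to R_\varphi(x)],\qquad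 \forall u[R_\varphi(u)\to\forall x(\varphi(\sigma,x)\to\sigma(x))\to\sigma(u)]\qquad(\sigma\in\Pi^0_k(\Omega)),$$ where $\theta$ and $\sigma$ may contain parameters. **Ordinal notations.** $OT'(\vartheta)$ is the following system of ordinal terms. It contains $0$, and $\vartheta(\beta)<\Omega$ for each of its terms $\beta$. Its terms below $\Omega$ are the finite sums $\vartheta(\beta_1)+\cdots+\vartheta(\beta_m)$ with $\vartheta(\beta_1)\ge\cdots\ge\vartheta(\beta_m)$ (the empty sum is $0$), and its terms in general are the base-$\Omega$ normal forms $\Omega^{\alpha_{n-1}}\beta_{n-1}+\cdots+\Omega^{\alpha_0}\beta_0$ with $\alpha_{n-1}>\cdots>\alpha_0$ and $0\neq\beta_i<\Omega$. Sums are compared lexicographically by their leading summands, each $\vartheta(\alpha)$ is closed under addition, and $$\vartheta(\alpha)<\vartheta(\beta)\iff[\alpha<\beta\land\forall\gamma\in K(\alpha)\,(\gamma<\vartheta(\beta))]\lor\exists\delta\in K(\beta)\,(\vartheta(\alpha)\le\delta),$$ where $K(\alpha)$ is the set of all summands $\vartheta(\gamma)$ of the coefficients occurring in the base-$\Omega$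 normal form of $\alpha$ and, hereditarily, in those of its exponents. Thus $\vartheta(0)=1$, and $\ell<\omega$ stands for $\vartheta(0)+\cdots+\vartheta(0)$ ($\ell$ summands). Terms are coded by natural numbers in a standard way, and their order $<$ by a bounded formula of $\mathcal L$. Let $W$ be the predicate constant $R_\varphi$ for $\varphi(X,x)\equiv\forall y(y<x\to y\in X)$, i.e. for the accessible part of $<$. Put $\Omega_0(\alpha)=\alpha$ and $\Omega_{n+1}(\alpha)=\Omega^{\Omega_n(\alpha)}$. **Proposition.** Let $k\ge 1$. Then for each $\ell<\omega$, $$\Pi^0_k(\Omega)\text{-ID}(\Pi^0_1)\vdash\vartheta(\Omega_k(\ell))\in W .$$ -/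

import Mathlib

namespace WeakID

/-! ### The language of arithmetic with a symbol for every elementary recursive function -/

/-- Names of the elementary recursive functions (Kalmár): the closure of zero, successor,
projections, addition, multiplication and truncated subtraction under composition, bounded sums
and bounded products.  `EF n` holds the names of the `n`-ary ones; these are the function
constants of the language. -/
inductive EF : ℕ → Type
  | zero : EF 0
  | succ : EF 1
  | proj {n : ℕ} (i : Fin n) : EF n
  | add : EF 2
  | mul : EF 2
  | monus : EF 2
  | comp {m n : ℕ} (f : EF m) (g : Fin m → EF n) : EF n
  | bsum {n : ℕ} (f : EF (n + 1)) : EF (n + 1)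
  | bprod {n : ℕ} (f : EF (n + 1)) : EF (n + 1)

/-- The function that a name denotes; `bsum f` is `(y, x) ↦ ∑ i < y, f (i, x)`, and `bprod f` is
`(y, x) ↦ ∏ i < y, f (i, x)`. -/
def EF.eval : {n : ℕ} → EF n → (Fin n → ℕ) → ℕ
  | _, .zero, _ => 0
  | _, .succ, v => v 0 + 1
  | _, .proj i, v => v i
  | _, .add, v => v 0 + v 1
  | _, .mul, v => v 0 * v 1
  | _, .monus, v => v 0 - v 1
  | _, .comp f g, v => f.eval (fun j => (g j).eval v)
  | _, .bsum f, v => ∑ i ∈ Finset.range (v 0), f.eval (Fin.cons i (Fin.tail v))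
  | _, .bprod f, v => ∏ i ∈ Finset.range (v 0), f.eval (Fin.cons i (Fin.tail v))

/-- The sequence `x, v 0, v 1, …`. -/
def vcons {X : Type} (x : X) (v : ℕ → X) : ℕ → X
  | 0 => x
  | i + 1 => v i

/-- Terms; variables are de Bruijn indices. -/
inductive Term : Type
  | var (i : ℕ) : Term
  | func {n : ℕ} (f : EF n) (ts : Fin n → Term) : Term

namespace Term

def subst (s : ℕ → Term) : Term → Term
  | var i => s i
  | func f ts => func f (fun j => (ts j).subst s)

/-- Weakening by `k` variables: what a term becomes below `k` further quantifiers. -/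
def lift (k : ℕ) (t : Term) : Term := t.subst (fun i => var (i + k))

/-- All variables are among the first `n`. -/
def ClosedAt (n : ℕ) : Term → Prop
  | var i => i < n
  | func _ ts => ∀ j, (ts j).ClosedAt n

def eval (v : ℕ → ℕ) : Term → ℕ
  | var i => v i
  | func f ts => f.eval (fun j => (ts j).eval v)

def zero : Term := func .zero ![]
def succ (t : Term) : Term := func .succ ![t]
def add (s t : Term) : Term := func .add ![s, t]
def mul (s t : Term) : Term := func .mul ![s, t]
def monus (s t : Term) : Term := func .monus ![s, t]

/-- `2 ^ t`, as the bounded product `∏ i < t, 2`. -/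
def pow2 (t : Term) : Term :=
  func (.bprod (.comp .succ ![.comp .succ ![.comp .zero ![]]])) ![t]

def numeral : ℕ → Term
  | 0 => zero
  | n + 1 => succ (numeral n)

end Term

open Term (var func)

/-- First-order formulas in negation normal form, in the language with `=`, `<`, the function
constants `EF`, and a unary predicate constant for each element of `P`. -/
inductive Fml (P : Type) : Type
  | eq (s t : Term) : Fml P
  | ne (s t : Term) : Fml P
  | lt (s t : Term) : Fml P
  | nlt (s t : Term) : Fml P
  | pr (p : P) (t : Term) : Fml P
  | npr (p : P) (t : Term) : Fml P
  | and (A B : Fml P) : Fml P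
  | or (A B : Fml P) : Fml P
  | all (A : Fml P) : Fml P
  | ex (A : Fml P) : Fml P

/-- The substitution `s` below one more quantifier. -/
def up (s : ℕ → Term) : ℕ → Term
  | 0 => var 0
  | i + 1 => (s i).lift 1

/-- Replace variable `0` by `t` and lower the other variables by one. -/
def inst (t : Term) : ℕ → Term := vcons t var

namespace Fml

variable {P Q : Type}

/-- Negation, by de Morgan's laws. -/
def neg : Fml P → Fml P
  | eq s t => ne s t
  | ne s t => eq s t
  | lt s t => nlt s t
  | nlt s t => lt s t
  | pr p t => npr p t
  | npr p t => pr p t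
  | and A B => or A.neg B.neg
  | or A B => and A.neg B.neg
  | all A => ex A.neg
  | ex A => all A.neg

def imp (A B : Fml P) : Fml P := or A.neg B

def iff (A B : Fml P) : Fml P := and (imp A B) (imp B A)

def subst (s : ℕ → Term) : Fml P → Fml P
  | eq t u => eq (t.subst s) (u.subst s)
  | ne t u => ne (t.subst s) (u.subst s)
  | lt t u => lt (t.subst s) (u.subst s)
  | nlt t u => nlt (t.subst s) (u.subst s)
  | pr p t => pr p (t.subst s)
  | npr p t => npr p (t.subst s)
  | and A B => and (A.subst s) (B.subst s)
  | or A B => or (A.subst s) (B.subst s)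
  | all A => all (A.subst (up s))
  | ex A => ex (A.subst (up s))

/-- Weakening by one variable. -/
def shift (A : Fml P) : Fml P := A.subst (fun i => var (i + 1))

/-- Bounded quantifiers `∀ x < t` and `∃ x < t`; the bound `t` does not contain `x`. -/
def ball (t : Term) (A : Fml P) : Fml P := all (or (nlt (var 0) (t.lift 1)) A)

def bex (t : Term) (A : Fml P) : Fml P := ex (and (lt (var 0) (t.lift 1)) A)

/-- `A.substPred F` puts the formula `F p` for each predicate `p` in `A`.  In `F p`, variable `0`
is the argument of the predicate and variable `i + 1` is variable `i` of `A`. -/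
def substPred : Fml P → (P → Fml Q) → Fml Q
  | eq s t, _ => eq s t
  | ne s t, _ => ne s t
  | lt s t, _ => lt s t
  | nlt s t, _ => nlt s t
  | pr p t, F => (F p).subst (inst t)
  | npr p t, F => ((F p).subst (inst t)).neg
  | and A B, F => and (A.substPred F) (B.substPred F)
  | or A B, F => or (A.substPred F) (B.substPred F)
  | all A, F => all (A.substPred (fun p => (F p).subst (up (fun i => var (i + 1)))))
  | ex A, F => ex (A.substPred (fun p => (F p).subst (up (fun i => var (i + 1)))))

/-- All free variables are among the first `n`. -/
def ClosedAt : ℕ → Fml P → Prop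
  | n, eq s t => s.ClosedAt n ∧ t.ClosedAt n
  | n, ne s t => s.ClosedAt n ∧ t.ClosedAt n
  | n, lt s t => s.ClosedAt n ∧ t.ClosedAt n
  | n, nlt s t => s.ClosedAt n ∧ t.ClosedAt n
  | n, pr _ t => t.ClosedAt n
  | n, npr _ t => t.ClosedAt n
  | n, and A B => A.ClosedAt n ∧ B.ClosedAt n
  | n, or A B => A.ClosedAt n ∧ B.ClosedAt n
  | n, all A => A.ClosedAt (n + 1)
  | n, ex A => A.ClosedAt (n + 1)

/-- No predicate constant occurs negatively. -/
def Positive : Fml P → Prop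
  | npr _ _ => False
  | and A B => A.Positive ∧ B.Positive
  | or A B => A.Positive ∧ B.Positive
  | all A => A.Positive
  | ex A => A.Positive
  | _ => True

/-- No predicate constant occurs at all. -/
def PredFree : Fml P → Prop
  | pr _ _ => False
  | npr _ _ => False
  | and A B => A.PredFree ∧ B.PredFree
  | or A B => A.PredFree ∧ B.PredFree
  | all A => A.PredFree
  | ex A => A.PredFree
  | _ => True

def IsLiteral : Fml P → Prop
  | and _ _ => False
  | or _ _ => False
  | all _ => False
  | ex _ => False
  | _ => True

/-- Truth in the standard model, with the predicate constants interpreted by `I`. -/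
def Holds (I : P → Set ℕ) : (ℕ → ℕ) → Fml P → Prop
  | v, eq s t => s.eval v = t.eval v
  | v, ne s t => s.eval v ≠ t.eval v
  | v, lt s t => s.eval v < t.eval v
  | v, nlt s t => ¬ s.eval v < t.eval v
  | v, pr p t => t.eval v ∈ I p
  | v, npr p t => t.eval v ∉ I p
  | v, and A B => A.Holds I v ∧ B.Holds I v
  | v, or A B => A.Holds I v ∨ B.Holds I v
  | v, all A => ∀ n : ℕ, A.Holds I (vcons n v)
  | v, ex A => ∃ n : ℕ, A.Holds I (vcons n v)

/-- Bounded formulas: built from literals by `∧`, `∨` and bounded quantifiers. -/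
inductive IsBounded : Fml P → Prop
  | literal {A : Fml P} : A.IsLiteral → IsBounded A
  | and {A B : Fml P} : IsBounded A → IsBounded B → IsBounded (and A B)
  | or {A B : Fml P} : IsBounded A → IsBounded B → IsBounded (or A B)
  | ball {A : Fml P} (t : Term) : IsBounded A → IsBounded (ball t A)
  | bex {A : Fml P} (t : Term) : IsBounded A → IsBounded (bex t A)

inductive Side : Type
  | pi
  | sigma

/-- `InClass .pi k` and `InClass .sigma k` are the classes `Π⁰ₖ` and `Σ⁰ₖ` of formulas with the
predicate constants of `P` as further atoms, of either sign.  Negation interchanges the two. -/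
inductive InClass : Side → ℕ → Fml P → Prop
  | bounded {c : Side} {A : Fml P} : IsBounded A → InClass c 0 A
  | up {c d : Side} {k : ℕ} {A : Fml P} : InClass c k A → InClass d (k + 1) A
  | and {c : Side} {k : ℕ} {A B : Fml P} : InClass c k A → InClass c k B → InClass c k (and A B)
  | or {c : Side} {k : ℕ} {A B : Fml P} : InClass c k A → InClass c k B → InClass c k (or A B)
  | ball {c : Side} {k : ℕ} {A : Fml P} (t : Term) : InClass c k A → InClass c k (ball t A)
  | bex {c : Side} {k : ℕ} {A : Fml P} (t : Term) : InClass c k A → InClass c k (bex t A)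
  | all {k : ℕ} {A : Fml P} : InClass .pi (k + 1) A → InClass .pi (k + 1) (all A)
  | ex {k : ℕ} {A : Fml P} : InClass .sigma (k + 1) A → InClass .sigma (k + 1) (ex A)

/-- The class `Π⁰ₖ`. -/
def IsPi (k : ℕ) (A : Fml P) : Prop := InClass .pi k A

end Fml

open Fml

/-! ### Provability: a one-sided sequent calculus for first-order logic with equality -/

/-- `Derivable T Γ`: the disjunction of `Γ` is derivable from the axioms `T`.  Free variables in
axioms are understood as universally quantified. -/
inductive Derivable {P : Type} (T : Set (Fml P)) : List (Fml P) → Prop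
  | axm {Γ : List (Fml P)} {A : Fml P} : A ∈ T → A ∈ Γ → Derivable T Γ
  | lit {Γ : List (Fml P)} {L : Fml P} : L.IsLiteral → L ∈ Γ → L.neg ∈ Γ → Derivable T Γ
  | eqRefl {Γ : List (Fml P)} {t : Term} : eq t t ∈ Γ → Derivable T Γ
  | eqSubst {Γ : List (Fml P)} {L : Fml P} {s t : Term} : L.IsLiteral → ne t s ∈ Γ →
      (L.subst (inst t)).neg ∈ Γ → L.subst (inst s) ∈ Γ → Derivable T Γ
  | and {Γ : List (Fml P)} {A B : Fml P} : and A B ∈ Γ →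
      Derivable T (A :: Γ) → Derivable T (B :: Γ) → Derivable T Γ
  | or {Γ : List (Fml P)} {A B : Fml P} : or A B ∈ Γ → Derivable T (A :: B :: Γ) → Derivable T Γ
  | all {Γ : List (Fml P)} {A : Fml P} : all A ∈ Γ →
      Derivable T (A :: Γ.map Fml.shift) → Derivable T Γ
  | ex {Γ : List (Fml P)} {A : Fml P} (t : Term) : ex A ∈ Γ →
      Derivable T (A.subst (inst t) :: Γ) → Derivable T Γ
  | cut {Γ : List (Fml P)} (C : Fml P) :
      Derivable T (C :: Γ) → Derivable T (C.neg :: Γ) → Derivable T Γ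

/-- `T ⊢ A`. -/
def Provable {P : Type} (T : Set (Fml P)) (A : Fml P) : Prop := Derivable T [A]

/-! ### The theories -/

/-- Axioms for successor and `<`, and the defining axioms of the function constants. -/
inductive BasicAx (P : Type) : Fml P → Prop
  | succ_ne_zero : BasicAx P (ne (var 0).succ .zero)
  | succ_inj : BasicAx P (imp (eq (var 0).succ (var 1).succ) (eq (var 0) (var 1)))
  | not_lt_zero : BasicAx P (nlt (var 0) .zero)
  | lt_succ : BasicAx P
      (iff (lt (var 0) (var 1).succ) (or (lt (var 0) (var 1)) (eq (var 0) (var 1))))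
  | add_zero : BasicAx P (eq ((var 0).add .zero) (var 0))
  | add_succ : BasicAx P (eq ((var 0).add (var 1).succ) ((var 0).add (var 1)).succ)
  | mul_zero : BasicAx P (eq ((var 0).mul .zero) .zero)
  | mul_succ : BasicAx P (eq ((var 0).mul (var 1).succ) (((var 0).mul (var 1)).add (var 0)))
  | monus_zero : BasicAx P (eq ((var 0).monus .zero) (var 0))
  | zero_monus : BasicAx P (eq (Term.zero.monus (var 0)) .zero)
  | succ_monus_succ :
      BasicAx P (eq ((var 0).succ.monus (var 1).succ) ((var 0).monus (var 1)))
  | proj {n : ℕ} (i : Fin n) : BasicAx P (eq (func (.proj i) (fun j => var j)) (var i))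
  | comp {m n : ℕ} (f : EF m) (g : Fin m → EF n) : BasicAx P
      (eq (func (.comp f g) (fun j => var j)) (func f (fun j => func (g j) (fun l => var l))))
  | bsum_zero {n : ℕ} (f : EF (n + 1)) : BasicAx P
      (eq (func (.bsum f) (Fin.cons .zero (fun j => var (j + 1)))) .zero)
  | bsum_succ {n : ℕ} (f : EF (n + 1)) : BasicAx P
      (eq (func (.bsum f) (Fin.cons (var 0).succ (fun j => var (j + 1))))
        ((func (.bsum f) (Fin.cons (var 0) (fun j => var (j + 1)))).add
          (func f (Fin.cons (var 0) (fun j => var (j + 1))))))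
  | bprod_zero {n : ℕ} (f : EF (n + 1)) : BasicAx P
      (eq (func (.bprod f) (Fin.cons .zero (fun j => var (j + 1)))) Term.zero.succ)
  | bprod_succ {n : ℕ} (f : EF (n + 1)) : BasicAx P
      (eq (func (.bprod f) (Fin.cons (var 0).succ (fun j => var (j + 1))))
        ((func (.bprod f) (Fin.cons (var 0) (fun j => var (j + 1)))).mul
          (func f (Fin.cons (var 0) (fun j => var (j + 1))))))

/-- Complete induction `θ(0) ∧ ∀x (θ(x) → θ(x+1)) → ∀y θ(y)`; in `θ` variable `0` is the
induction variable and the others are parameters. -/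
def indAx {P : Type} (θ : Fml P) : Fml P :=
  imp
    (and (θ.subst (inst .zero))
      (all (imp θ (θ.subst (vcons (var 0).succ (fun j => var (j + 1)))))))
    (all θ)

/-- Elementary recursive arithmetic, in a language that may have predicate constants: induction is
for bounded formulas without predicate constants. -/
def EA (P : Type) : Set (Fml P) :=
  {A | BasicAx P A} ∪ {A | ∃ θ : Fml P, θ.IsBounded ∧ θ.PredFree ∧ A = indAx θ}

/-- `∀x (φ(σ, x) → σ(x))`, for an operator form `φ(X, x)` with `X` the only predicate and `x` the
variable `0`, and a formula `σ` with argument variable `0` and parameters `1, 2, …`, which become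
the free variables `0, 1, …`. -/
def closedUnder {P : Type} (φ : Fml Unit) (σ : Fml P) : Fml P :=
  all (imp (φ.substPred (fun _ => σ.subst (up (fun i => var (i + 1))))) σ)

/-- `∀x (φ(R_φ, x) → R_φ(x))`. -/
def fixAx {Φ : Set (Fml Unit)} (φ : Φ) : Fml Φ := closedUnder φ.1 (pr φ (var 0))

/-- `∀u (R_φ(u) → ∀x (φ(σ, x) → σ(x)) → σ(u))`. -/
def leastAx {Φ : Set (Fml Unit)} (φ : Φ) (σ : Fml Φ) : Fml Φ :=
  all (imp (pr φ (var 0)) (imp (closedUnder φ.1 σ).shift σ))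

/-- The theory `(Θ, Γ)-ID(Φ)`; its predicate constants are the `R_φ` with `φ ∈ Φ`. -/
def ID (Φ : Set (Fml Unit)) (Θ Γ : Set (Fml Φ)) : Set (Fml Φ) :=
  EA Φ ∪ {A | ∃ θ ∈ Θ, A = indAx θ} ∪ {A | ∃ φ : Φ, A = fixAx φ} ∪
    {A | ∃ φ : Φ, ∃ σ ∈ Γ, A = leastAx φ σ}

/-- The `X`-positive `Π⁰₁` operator forms `φ(X, x)`; no variable but `x` is free. -/
def PosPi1 : Set (Fml Unit) := {φ | φ.IsPi 1 ∧ φ.Positive ∧ φ.ClosedAt 1}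

/-- The theory `Π⁰ₖ(Ω)-ID(Π⁰₁)`. -/
def PiID (k : ℕ) : Set (Fml PosPi1) := ID PosPi1 {θ | θ.IsPi k} {σ | σ.IsPi k}

/-! ### The notation system `OT'(ϑ)` -/

/-- Ordinal terms: `add a b r` is `Ω^a · ϑ(b) + r`.  A term `Ω^{α₁} β₁ + ⋯ + Ω^{αₙ} βₙ` in base
`Ω` normal form, with each coefficient `0 < β < Ω` a sum `ϑ(b₁) + ⋯ + ϑ(bₘ)`, is written with the
coefficients multiplied out, as `Ω^α (β + β') = Ω^α β + Ω^α β'`. -/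
inductive OT : Type
  | zero : OT
  | add (a b r : OT) : OT

namespace OT

/-- `ϑ(b) = Ω^0 · ϑ(b) + 0`. -/
def theta (b : OT) : OT := add zero b zero

/-- `Ω^a = Ω^a · ϑ(0)`, as `ϑ(0) = 1`. -/
def omegaPow (a : OT) : OT := add a zero zero

/-- The finite ordinal `ℓ = ϑ(0) + ⋯ + ϑ(0)`. -/
def nat : ℕ → OT
  | 0 => zero
  | n + 1 => add zero zero (nat n)

/-- `Ω_0(α) = α` and `Ω_{n+1}(α) = Ω^{Ω_n(α)}`. -/
def tower : ℕ → OT → OT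
  | 0, a => a
  | n + 1, a => omegaPow (tower n a)

/-- The coefficient set `K`, with each coefficient split into its summands `ϑ(b)`; this does not
affect the order, because the values of `ϑ` are closed under addition. -/
def K : OT → Set OT
  | zero => ∅
  | add a b r => K a ∪ {theta b} ∪ K r

/-- The order of ordinal terms. -/
inductive Lt : OT → OT → Prop
  | zero_add (a b r : OT) : Lt zero (add a b r)
  | exponent {a a' : OT} (b b' r r' : OT) : Lt a a' → Lt (add a b r) (add a' b' r')
  | coeff {b b' : OT} (a r r' : OT) : Lt (theta b) (theta b') → Lt (add a b r) (add a b' r')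
  | rest {r r' : OT} (a b : OT) : Lt r r' → Lt (add a b r) (add a b r')
  | theta_arg {a b : OT} : Lt a b → (∀ c ∈ K a, Lt c (theta b)) → Lt (theta a) (theta b)
  | theta_mem {a b : OT} : theta a ∈ K b → Lt (theta a) (theta b)
  | theta_lt {a b d : OT} : d ∈ K b → Lt (theta a) d → Lt (theta a) (theta b)

/-- Normal forms, the elements of `OT'(ϑ)`: in every sum the summands `Ω^a · ϑ(b)` weakly
decrease. -/
def NF : OT → Prop
  | zero => True
  | add a b r => NF a ∧ NF b ∧ NF r ∧ ∀ a' b' r', r = add a' b' r' →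
      Lt a' a ∨ (a' = a ∧ (b' = b ∨ Lt (theta b') (theta b)))

/-- The pairing `(x + y)² + x`. -/
def npair (x y : ℕ) : ℕ := (x + y) * (x + y) + x

/-- The code of a term. -/
def code : OT → ℕ
  | zero => 0
  | add a b r => npair (code a) (npair (code b) (code r)) + 1

end OT

/-! ### The order of `OT'(ϑ)` as a bounded arithmetical formula on codes -/

section order

variable {P : Type}

def pairT (s t : Term) : Term := ((s.add t).mul (s.add t)).add s

def addT (a b r : Term) : Term := (pairT a (pairT b r)).succ

/-- `p ∈ T`: the binary digit of `T` at `2 ^ p` is `1`. -/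
def memF (p T : Term) : Fml P :=
  bex T.succ (bex (p.lift 1).pow2
    (eq (T.lift 2) ((((var 1).add (var 1)).succ.mul (p.lift 2).pow2).add (var 0))))

/-- `(u, v) ∈ T`. -/
def relF (T u v : Term) : Fml P := memF (pairT u v) T

/-- `∃ a, b, r < u (u = Ω^a · ϑ(b) + r ∧ A)`; in `A`, the variables `2, 1, 0` are `a, b, r`. -/
def exAdd (u : Term) (A : Fml P) : Fml P :=
  bex u (bex (u.lift 1) (bex (u.lift 2)
    (and (eq (u.lift 3) (addT (var 2) (var 1) (var 0))) A)))

/-- `ϑ(u) < ϑ(v)`, from tables: `(u, v) ∈ L` for `u < v`, `(u, v) ∈ M` for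
`∀ γ ∈ K(u), γ < ϑ(v)`, and `(u, v) ∈ N` for `∃ δ ∈ K(v), ϑ(u) ≤ δ`. -/
def thetaF (L M N u v : Term) : Fml P := or (and (relF L u v) (relF M u v)) (relF N u v)

/-- The recursive clause for `u < v`. -/
def stepL (L M N u v : Term) : Fml P :=
  or (and (eq u .zero) (exAdd v (eq .zero .zero)))
    (exAdd u (exAdd (v.lift 3)
      (or (relF (L.lift 6) (var 5) (var 2))
        (and (eq (var 5) (var 2))
          (or (thetaF (L.lift 6) (M.lift 6) (N.lift 6) (var 4) (var 1))
            (and (eq (var 4) (var 1)) (relF (L.lift 6) (var 3) (var 0))))))))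

/-- The recursive clause for `∀ γ ∈ K(u), γ < ϑ(v)`. -/
def stepM (L M N u v : Term) : Fml P :=
  or (eq u .zero)
    (exAdd u (and (relF (M.lift 3) (var 2) (v.lift 3))
      (and (thetaF (L.lift 3) (M.lift 3) (N.lift 3) (var 1) (v.lift 3))
        (relF (M.lift 3) (var 0) (v.lift 3)))))

/-- The recursive clause for `∃ δ ∈ K(v), ϑ(u) ≤ δ`. -/
def stepN (L M N u v : Term) : Fml P :=
  exAdd v (or (relF (N.lift 3) (u.lift 3) (var 2))
    (or (or (eq (u.lift 3) (var 1))
        (thetaF (L.lift 3) (M.lift 3) (N.lift 3) (u.lift 3) (var 1)))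
      (relF (N.lift 3) (u.lift 3) (var 0))))

/-- `L, M, N` satisfy the recursive clauses for all arguments up to `n`. -/
def tableF (n L M N : Term) : Fml P :=
  ball n.succ (ball (n.lift 1).succ
    (and (iff (relF (L.lift 2) (var 1) (var 0))
        (stepL (L.lift 2) (M.lift 2) (N.lift 2) (var 1) (var 0)))
      (and (iff (relF (M.lift 2) (var 1) (var 0))
          (stepM (L.lift 2) (M.lift 2) (N.lift 2) (var 1) (var 0)))
        (iff (relF (N.lift 2) (var 1) (var 0))
          (stepN (L.lift 2) (M.lift 2) (N.lift 2) (var 1) (var 0))))))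

/-- `x` codes a normal form: it lies in a finite set of codes that is closed under immediate
subterms and whose elements are sums with weakly decreasing first two summands. -/
def nfF (L M N x : Term) : Fml P :=
  bex x.succ.pow2 (and (memF (x.lift 1) (var 0))
    (ball (x.lift 1).succ (imp (memF (var 0) (var 1))
      (or (eq (var 0) .zero)
        (exAdd (var 0)
          (and (and (memF (var 2) (var 4)) (and (memF (var 1) (var 4)) (memF (var 0) (var 4))))
            (or (eq (var 0) .zero)
              (exAdd (var 0)
                (or (relF (L.lift 8) (var 2) (var 5))
                  (and (eq (var 2) (var 5))
                    (or (eq (var 1) (var 4))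
                      (thetaF (L.lift 8) (M.lift 8) (N.lift 8) (var 1) (var 4)))))))))))))

/-- `2 ^ (2n + 1)²`, a bound for the tables up to `n`. -/
def tableBound (n : Term) : Term := ((n.add n).succ.mul (n.add n).succ).pow2

/-- `s < t` in `OT'(ϑ)`: `s` and `t` code normal forms and the first is less than the second. -/
def ltF (s t : Term) : Fml P :=
  bex (tableBound (s.add t))
    (bex (tableBound ((s.add t).lift 1))
      (bex (tableBound ((s.add t).lift 2))
        (and (tableF ((s.add t).lift 3) (var 2) (var 1) (var 0))
          (and (and (nfF (var 2) (var 1) (var 0) (s.lift 3))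
              (nfF (var 2) (var 1) (var 0) (t.lift 3)))
            (relF (var 2) (s.lift 3) (t.lift 3))))))

end order

/-- The operator form `∀y (y < x → y ∈ X)`, with `<` the order of `OT'(ϑ)`. -/
def accForm : Fml Unit := all (imp (ltF (var 0) (var 1)) (pr () (var 0)))

theorem Fml.IsBounded.neg {P : Type} {A : Fml P} (h : A.IsBounded) : A.neg.IsBounded := by
  induction h with
  | @literal A h => cases A <;> first | exact .literal trivial | exact h.elim
  | and _ _ h₁ h₂ => exact .or h₁ h₂
  | or _ _ h₁ h₂ => exact .and h₁ h₂
  | ball t _ h => exact .bex t h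
  | bex t _ h => exact .ball t h

theorem Fml.IsBounded.exAdd {P : Type} {A : Fml P} (u : Term) (h : A.IsBounded) :
    (exAdd u A).IsBounded :=
  .bex _ (.bex _ (.bex _ (.and (.literal trivial) h)))

theorem ltF_isBounded {P : Type} (s t : Term) : (ltF s t : Fml P).IsBounded := by
  have hmem : ∀ p T : Term, (memF p T : Fml P).IsBounded :=
    fun _ _ => .bex _ (.bex _ (.literal trivial))
  have hrel : ∀ T u v : Term, (relF T u v : Fml P).IsBounded := fun _ _ _ => hmem _ _
  have hth : ∀ L M N u v : Term, (thetaF L M N u v : Fml P).IsBounded :=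
    fun _ _ _ _ _ => .or (.and (hrel _ _ _) (hrel _ _ _)) (hrel _ _ _)
  have heq : ∀ u v : Term, (eq u v : Fml P).IsBounded := fun _ _ => .literal trivial
  have hiff : ∀ A B : Fml P, A.IsBounded → B.IsBounded → (iff A B).IsBounded :=
    fun _ _ hA hB => .and (.or hA.neg hB) (.or hB.neg hA)
  have hL : ∀ L M N u v : Term, (stepL L M N u v : Fml P).IsBounded := fun _ _ _ _ _ =>
    .or (.and (heq _ _) (.exAdd _ (heq _ _))) (.exAdd _ (.exAdd _ (.or (hrel _ _ _)
      (.and (heq _ _) (.or (hth _ _ _ _ _) (.and (heq _ _) (hrel _ _ _)))))))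
  have hM : ∀ L M N u v : Term, (stepM L M N u v : Fml P).IsBounded := fun _ _ _ _ _ =>
    .or (heq _ _) (.exAdd _ (.and (hrel _ _ _) (.and (hth _ _ _ _ _) (hrel _ _ _))))
  have hN : ∀ L M N u v : Term, (stepN L M N u v : Fml P).IsBounded := fun _ _ _ _ _ =>
    .exAdd _ (.or (hrel _ _ _) (.or (.or (heq _ _) (hth _ _ _ _ _)) (hrel _ _ _)))
  have hnf : ∀ L M N x : Term, (nfF L M N x : Fml P).IsBounded := fun _ _ _ _ =>
    .bex _ (.and (hmem _ _) (.ball _ (.or (hmem _ _).neg (.or (heq _ _) (.exAdd _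
      (.and (.and (hmem _ _) (.and (hmem _ _) (hmem _ _))) (.or (heq _ _) (.exAdd _
        (.or (hrel _ _ _) (.and (heq _ _) (.or (heq _ _) (hth _ _ _ _ _))))))))))))
  exact .bex _ (.bex _ (.bex _ (.and (.ball _ (.ball _ (.and (hiff _ _ (hrel _ _ _) (hL _ _ _ _ _))
    (.and (hiff _ _ (hrel _ _ _) (hM _ _ _ _ _)) (hiff _ _ (hrel _ _ _) (hN _ _ _ _ _))))))
    (.and (.and (hnf _ _ _ _) (hnf _ _ _ _)) (hrel _ _ _)))))

theorem accForm_mem : accForm ∈ PosPi1 := by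
  refine ⟨.all (.or (.up (c := .pi) (.bounded (ltF_isBounded _ _).neg))
    (.up (c := .pi) (.bounded (.literal trivial)))), ?_, ?_⟩
  · simp [accForm, ltF, imp, iff, neg, Positive, tableF, nfF, stepL, stepM, stepN, thetaF, relF,
      memF, exAdd, bex, ball]
  · simp [accForm, ltF, imp, iff, neg, Fml.ClosedAt, Term.ClosedAt, tableF, nfF, stepL, stepM,
      stepN, thetaF, relF, memF, exAdd, bex, ball, tableBound, pairT, addT, Term.lift, Term.subst,
      Term.add, Term.mul, Term.succ, Term.zero, Term.pow2, Fin.forall_fin_two]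

/-- The predicate constant `W` for the accessible part of the order of `OT'(ϑ)`. -/
def W : PosPi1 := ⟨accForm, accForm_mem⟩

/-- The sentence `α ∈ W`. -/
def inW (α : OT) : Fml PosPi1 := pr W (Term.numeral α.code)

/-! ### The formula `ltF` defines the order of `OT'(ϑ)` on codes -/

namespace OrderCheck

section

theorem eval_lift (v : ℕ → ℕ) (k : ℕ) (t : Term) :
    (t.lift k).eval v = t.eval (fun i => v (i + k)) := by
  unfold Term.lift
  induction t with
  | var i => rfl
  | func f ts ih => simp only [Term.subst, Term.eval]; congr 1; funext j; exact ih j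

variable {P : Type} (I : P → Set ℕ)

theorem ev_add (v s t) : (Term.add s t).eval v = s.eval v + t.eval v := by
  simp [Term.add, Term.eval, EF.eval]
theorem ev_mul (v s t) : (Term.mul s t).eval v = s.eval v * t.eval v := by
  simp [Term.mul, Term.eval, EF.eval]
theorem ev_succ (v s) : (Term.succ s).eval v = s.eval v + 1 := by
  simp [Term.succ, Term.eval, EF.eval]
theorem ev_zero (v) : (Term.zero).eval v = 0 := by
  simp [Term.zero, Term.eval, EF.eval]
theorem ev_pow (v s) : (Term.pow2 s).eval v = 2 ^ s.eval v := by
  simp [Term.pow2, Term.eval, EF.eval]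
theorem ev_num (v n) : (Term.numeral n).eval v = n := by
  induction n with
  | zero => simp [Term.numeral, ev_zero]
  | succ n ih => simp [Term.numeral, ev_succ, ih]
theorem ev_pair (v s t) : (pairT s t).eval v = OT.npair (s.eval v) (t.eval v) := by
  simp [pairT, ev_add, ev_mul, OT.npair]
theorem ev_addT (v a b r) : (addT a b r).eval v =
    OT.npair (a.eval v) (OT.npair (b.eval v) (r.eval v)) + 1 := by
  simp [addT, ev_succ, ev_pair]

theorem h_neg (v : ℕ → ℕ) (A : Fml P) : A.neg.Holds I v ↔ ¬ A.Holds I v := by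
  induction A generalizing v <;> simp_all [Fml.neg, Fml.Holds]; tauto

theorem h_imp (v : ℕ → ℕ) (A B : Fml P) : (imp A B).Holds I v ↔ (A.Holds I v → B.Holds I v) := by
  simp only [imp, Fml.Holds, h_neg]; tauto
theorem h_iff (v : ℕ → ℕ) (A B : Fml P) : (Fml.iff A B).Holds I v ↔ (A.Holds I v ↔ B.Holds I v) := by
  simp only [Fml.iff, Fml.Holds, h_imp]; tauto

theorem h_bex (v : ℕ → ℕ) (t : Term) (A : Fml P) : (bex t A).Holds I v ↔
    ∃ n < t.eval v, A.Holds I (vcons n v) := by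
  simp only [bex, Fml.Holds, eval_lift, Term.eval, vcons]

theorem h_ball (v : ℕ → ℕ) (t : Term) (A : Fml P) : (ball t A).Holds I v ↔
    ∀ n < t.eval v, A.Holds I (vcons n v) := by
  simp only [ball, Fml.Holds, eval_lift, Term.eval, vcons]
  exact forall_congr' fun n => by tauto

theorem h_mem (v : ℕ → ℕ) (p T : Term) : (memF p T : Fml P).Holds I v ↔
    (T.eval v).testBit (p.eval v) = true := by
  simp only [memF, h_bex, Fml.Holds, eval_lift, ev_succ, ev_pow, ev_add, ev_mul, Term.eval, vcons]
  generalize T.eval v = T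
  generalize p.eval v = p
  constructor
  · rintro ⟨q, -, r, hr, h⟩
    rw [Nat.testBit_eq_decide_div_mod_eq]
    have : T / 2 ^ p = 2 * q + 1 := by
      rw [h]
      rw [show (q + q + 1) * 2 ^ p + r = r + 2 ^ p * (2 * q + 1) by ring]
      rw [Nat.add_mul_div_left _ _ (by positivity), Nat.div_eq_of_lt hr, zero_add]
    simp [this]
  · intro h
    rw [Nat.testBit_eq_decide_div_mod_eq] at h
    simp at h
    refine ⟨T / 2 ^ p / 2, ?_, T % 2 ^ p, Nat.mod_lt _ (by positivity), ?_⟩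
    · exact Nat.lt_succ_of_le ((Nat.div_le_self _ _).trans (Nat.div_le_self _ _))
    · have h1 := Nat.div_add_mod T (2 ^ p)
      have h2 : T / 2 ^ p = T / 2 ^ p / 2 + T / 2 ^ p / 2 + 1 := by omega
      rw [← h2, mul_comm]; exact h1.symm

theorem le_np_left (x y) : x ≤ OT.npair x y := by unfold OT.npair; nlinarith
theorem le_np_right (x y) : y ≤ OT.npair x y := by unfold OT.npair; nlinarith [Nat.zero_le x, Nat.zero_le y, Nat.le_mul_self (x+y)]
theorem np_inj {x y x' y'} (h : OT.npair x y = OT.npair x' y') : x = x' ∧ y = y' := by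
  unfold OT.npair at h
  have : x + y = x' + y' := by
    rcases lt_trichotomy (x+y) (x'+y') with h1 | h1 | h1
    · nlinarith
    · exact h1
    · nlinarith
  rw [this] at h
  omega
abbrev ncons (a b r : ℕ) := OT.npair a (OT.npair b r) + 1
theorem nc_inj {a b r a' b' r'} (h : ncons a b r = ncons a' b' r') : a = a' ∧ b = b' ∧ r = r' := by
  obtain ⟨h1, h2⟩ := np_inj (Nat.succ.inj h)
  exact ⟨h1, np_inj h2⟩
theorem nc_a (a b r) : a < ncons a b r := Nat.lt_succ_of_le (le_np_left _ _)
theorem nc_b (a b r) : b < ncons a b r := Nat.lt_succ_of_le ((le_np_left _ _).trans (le_np_right _ _))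
theorem nc_r (a b r) : r < ncons a b r := Nat.lt_succ_of_le ((le_np_right _ _).trans (le_np_right _ _))

theorem h_exAdd (v : ℕ → ℕ) (u : Term) (A : Fml P) : (exAdd u A).Holds I v ↔
    ∃ a b r, u.eval v = ncons a b r ∧
     A.Holds I (vcons r (vcons b (vcons a v))) := by
  simp only [exAdd, h_bex, Fml.Holds, eval_lift, ev_addT, Term.eval, vcons]
  constructor
  · rintro ⟨a, _, b, _, r, _, h, h'⟩; exact ⟨a, b, r, h, h'⟩
  · rintro ⟨a, b, r, h, h'⟩
    refine ⟨a, ?_, b, ?_, r, ?_, h, h'⟩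
    · rw [h]; exact nc_a _ _ _
    · rw [h]; exact nc_b _ _ _
    · rw [h]; exact nc_r _ _ _

/-- The truth values of the three tables, `i = 0, 1, 2`. -/
def S (i u v : ℕ) : Prop :=
  match i with
  | 0 => (u = 0 ∧ ∃ a b r, v = ncons a b r) ∨
      ∃ a b r, ∃ _ : u = ncons a b r, ∃ a' b' r', ∃ _ : v = ncons a' b' r',
        S 0 a a' ∨ (a = a' ∧ (((S 0 b b' ∧ S 1 b b') ∨ S 2 b b') ∨ (b = b' ∧ S 0 r r')))
  | 1 => u = 0 ∨ ∃ a b r, ∃ _ : u = ncons a b r,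
      S 1 a v ∧ ((S 0 b v ∧ S 1 b v) ∨ S 2 b v) ∧ S 1 r v
  | _ => ∃ a b r, ∃ _ : v = ncons a b r,
      S 2 u a ∨ ((u = b ∨ ((S 0 u b ∧ S 1 u b) ∨ S 2 u b)) ∨ S 2 u r)
termination_by u + v
decreasing_by
  all_goals subst_vars
  all_goals have := nc_a a b r
  all_goals have := nc_b a b r
  all_goals have := nc_r a b r
  all_goals try have := nc_a a' b' r'
  all_goals try have := nc_b a' b' r'
  all_goals try have := nc_r a' b' r'
  all_goals omega

def SL (u v : ℕ) : Prop := S 0 u v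
def SM (u v : ℕ) : Prop := S 1 u v
def SN (u v : ℕ) : Prop := S 2 u v

theorem SL_eq (u v : ℕ) : SL u v = ((u = 0 ∧ ∃ a b r, v = ncons a b r) ∨
    ∃ a b r, ∃ _ : u = ncons a b r, ∃ a' b' r', ∃ _ : v = ncons a' b' r',
      SL a a' ∨ (a = a' ∧ (((SL b b' ∧ SM b b') ∨ SN b b') ∨ (b = b' ∧ SL r r')))) := by
  unfold SL SM SN; rw [S]
theorem SM_eq (u v : ℕ) : SM u v = (u = 0 ∨ ∃ a b r, ∃ _ : u = ncons a b r,
    SM a v ∧ ((SL b v ∧ SM b v) ∨ SN b v) ∧ SM r v) := by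
  unfold SL SM SN; rw [S]
theorem SN_eq (u v : ℕ) : SN u v = (∃ a b r, ∃ _ : v = ncons a b r,
    SN u a ∨ ((u = b ∨ ((SL u b ∧ SM u b) ∨ SN u b)) ∨ SN u r)) := by
  unfold SL SM SN; rw [S] <;> simp

theorem code_inj {s t : OT} (h : s.code = t.code) : s = t := by
  induction s generalizing t with
  | zero => cases t with
    | zero => rfl
    | add => simp [OT.code] at h
  | add a b r ha hb hr => cases t with
    | zero => simp [OT.code] at h
    | add => obtain ⟨h1, h2, h3⟩ := nc_inj h; rw [ha h1, hb h2, hr h3]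

def TC (b b' : OT) : Prop := (OT.Lt b b' ∧ ∀ c ∈ OT.K b, OT.Lt c b'.theta) ∨
   ∃ d ∈ OT.K b', b.theta = d ∨ OT.Lt b.theta d
theorem lt_zero (x) : ¬ OT.Lt x .zero := by
  intro h; cases h
theorem lt_inv' {x y} (h : OT.Lt x y) : ∀ a b r a' b' r', x = .add a b r → y = .add a' b' r' →
    OT.Lt a a' ∨ (a = a' ∧ (TC b b' ∨ (b = b' ∧ OT.Lt r r'))) := by
  induction h with
  | zero_add => simp
  | exponent _ _ _ _ h => rintro _ _ _ _ _ _ ⟨⟩ ⟨⟩; exact .inl h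
  | coeff _ _ _ h ih =>
    rintro _ _ _ _ _ _ ⟨⟩ ⟨⟩
    rcases ih _ _ _ _ _ _ rfl rfl with h | ⟨_, h | ⟨_, h⟩⟩
    · exact (lt_zero _ h).elim
    · exact .inr ⟨rfl, .inl h⟩
    · exact (lt_zero _ h).elim
  | rest _ _ h => rintro _ _ _ _ _ _ ⟨⟩ ⟨⟩; exact .inr ⟨rfl, .inr ⟨rfl, h⟩⟩
  | theta_arg h h' => rintro _ _ _ _ _ _ ⟨⟩ ⟨⟩; exact .inr ⟨rfl, .inl (.inl ⟨h, h'⟩)⟩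
  | theta_mem h => rintro _ _ _ _ _ _ ⟨⟩ ⟨⟩; exact .inr ⟨rfl, .inl (.inr ⟨_, h, .inl rfl⟩)⟩
  | theta_lt h h' => rintro _ _ _ _ _ _ ⟨⟩ ⟨⟩; exact .inr ⟨rfl, .inl (.inr ⟨_, h, .inr h'⟩)⟩

theorem tc_iff (b b') : TC b b' ↔ OT.Lt b.theta b'.theta := by
  constructor
  · rintro (⟨h, h'⟩ | ⟨d, h, rfl | h'⟩)
    · exact .theta_arg h h'
    · exact .theta_mem h
    · exact .theta_lt h h'
  · intro h
    rcases lt_inv' h _ _ _ _ _ _ rfl rfl with h | ⟨_, h | ⟨_, h⟩⟩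
    · exact (lt_zero _ h).elim
    · exact h
    · exact (lt_zero _ h).elim

theorem lt_add_iff (a b r a' b' r') : OT.Lt (.add a b r) (.add a' b' r') ↔
    OT.Lt a a' ∨ (a = a' ∧ (OT.Lt b.theta b'.theta ∨ (b = b' ∧ OT.Lt r r'))) := by
  constructor
  · intro h; simpa [tc_iff] using lt_inv' h _ _ _ _ _ _ rfl rfl
  · rintro (h | ⟨rfl, h | ⟨rfl, h⟩⟩)
    · exact .exponent _ _ _ _ h
    · exact .coeff _ _ _ h
    · exact .rest _ _ h

def CM (s t : OT) := ∀ c ∈ OT.K s, OT.Lt c t.theta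
def CN (s t : OT) := ∃ d ∈ OT.K t, s.theta = d ∨ OT.Lt s.theta d

theorem theta_inj {a b : OT} : a.theta = b.theta ↔ a = b := by simp [OT.theta]

theorem S_iff (n : ℕ) : ∀ s t : OT, s.code + t.code = n →
   (SL s.code t.code ↔ OT.Lt s t) ∧ (SM s.code t.code ↔ CM s t) ∧ (SN s.code t.code ↔ CN s t) := by
  induction n using Nat.strong_induction_on with
  | _ n ih =>
  intro s t hn
  have key : ∀ s' t' : OT, s'.code + t'.code < n → (SL s'.code t'.code ↔ OT.Lt s' t') ∧
     (SM s'.code t'.code ↔ CM s' t') ∧ (SN s'.code t'.code ↔ CN s' t') :=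
    fun s' t' h => ih _ h s' t' rfl
  have keyT : ∀ s' t' : OT, s'.code + t'.code < n → ((SL s'.code t'.code ∧ SM s'.code t'.code ∨ SN s'.code t'.code) ↔ OT.Lt s'.theta t'.theta) := by
    intro s' t' h
    obtain ⟨h1, h2, h3⟩ := key s' t' h
    rw [h1, h2, h3, ← tc_iff]; rfl
  have hdec : ∀ a b r : OT, (OT.add a b r).code = ncons a.code b.code r.code := fun _ _ _ => rfl
  refine ⟨?_, ?_, ?_⟩
  · rw [SL_eq]
    cases s with
    | zero =>
      cases t with
      | zero => simp [OT.code, lt_zero]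
      | add a b r =>
        refine iff_of_true (.inl ⟨rfl, _, _, _, hdec _ _ _⟩) (.zero_add _ _ _)
    | add a b r =>
      cases t with
      | zero => simp [OT.code, lt_zero]
      | add a' b' r' =>
        rw [lt_add_iff]
        have := nc_a a.code b.code r.code
        have := nc_b a.code b.code r.code
        have := nc_r a.code b.code r.code
        have := nc_a a'.code b'.code r'.code
        have := nc_b a'.code b'.code r'.code
        have := nc_r a'.code b'.code r'.code
        rw [hdec, hdec] at hn
        rw [← (key a a' (by omega)).1, ← keyT b b' (by omega), ← (key r r' (by omega)).1]
        constructor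
        · rintro (⟨h, _⟩ | ⟨x, y, z, h, x', y', z', h', H⟩)
          · simp [OT.code] at h
          · obtain ⟨rfl, rfl, rfl⟩ := nc_inj h
            obtain ⟨rfl, rfl, rfl⟩ := nc_inj h'
            rcases H with H | ⟨h1, H | ⟨h2, H⟩⟩
            · exact .inl H
            · exact .inr ⟨code_inj h1, .inl H⟩
            · exact .inr ⟨code_inj h1, .inr ⟨code_inj h2, H⟩⟩
        · intro H
          refine .inr ⟨_, _, _, hdec _ _ _, _, _, _, hdec _ _ _, ?_⟩
          rcases H with H | ⟨rfl, H | ⟨rfl, H⟩⟩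
          · exact .inl H
          · exact .inr ⟨rfl, .inl H⟩
          · exact .inr ⟨rfl, .inr ⟨rfl, H⟩⟩
  · rw [SM_eq]
    cases s with
    | zero => simp [OT.code, CM, OT.K]
    | add a b r =>
      have := nc_a a.code b.code r.code
      have := nc_b a.code b.code r.code
      have := nc_r a.code b.code r.code
      rw [hdec] at hn
      have : CM (.add a b r) t ↔ CM a t ∧ OT.Lt b.theta t.theta ∧ CM r t := by
        simp only [CM, OT.K, Set.mem_union, Set.mem_singleton_iff]
        constructor
        · intro h; exact ⟨fun c hc => h _ (.inl (.inl hc)), h _ (.inl (.inr rfl)), fun c hc => h _ (.inr hc)⟩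
        · rintro ⟨h1, h2, h3⟩ c ((h | rfl) | h)
          exacts [h1 _ h, h2, h3 _ h]
      rw [this, ← (key a t (by omega)).2.1, ← keyT b t (by omega), ← (key r t (by omega)).2.1]
      constructor
      · rintro (h | ⟨x, y, z, h, H⟩)
        · simp [OT.code] at h
        · obtain ⟨rfl, rfl, rfl⟩ := nc_inj h
          exact H
      · intro H
        exact .inr ⟨_, _, _, hdec _ _ _, H⟩
  · rw [SN_eq]
    cases t with
    | zero => simp [OT.code, CN, OT.K]
    | add a b r =>
      have := nc_a a.code b.code r.code
      have := nc_b a.code b.code r.code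
      have := nc_r a.code b.code r.code
      rw [hdec] at hn
      have : CN s (.add a b r) ↔ CN s a ∨ ((s = b ∨ OT.Lt s.theta b.theta) ∨ CN s r) := by
        simp only [CN, OT.K, Set.mem_union, Set.mem_singleton_iff]
        constructor
        · rintro ⟨d, ((h | rfl) | h), H⟩
          · exact .inl ⟨d, h, H⟩
          · rw [theta_inj] at H; exact .inr (.inl H)
          · exact .inr (.inr ⟨d, h, H⟩)
        · rintro (⟨d, h, H⟩ | H | ⟨d, h, H⟩)
          · exact ⟨d, .inl (.inl h), H⟩
          · exact ⟨_, .inl (.inr rfl), by rwa [theta_inj]⟩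
          · exact ⟨d, .inr h, H⟩
      rw [this, ← (key s a (by omega)).2.2, ← keyT s b (by omega), ← (key s r (by omega)).2.2]
      constructor
      · rintro (⟨x, y, z, h, H⟩)
        · obtain ⟨rfl, rfl, rfl⟩ := nc_inj h
          rcases H with H | (H | H) | H
          · exact .inl H
          · exact .inr (.inl (.inl (code_inj H)))
          · exact .inr (.inl (.inr H))
          · exact .inr (.inr H)
      · intro H
        refine ⟨_, _, _, hdec _ _ _, ?_⟩
        rcases H with H | (rfl | H) | H
        · exact .inl H
        · exact .inr (.inl (.inl rfl))
        · exact .inr (.inl (.inr H))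
        · exact .inr (.inr H)

def RB (T u v : ℕ) : Prop := T.testBit (OT.npair u v) = true

theorem h_rel (v : ℕ → ℕ) (T x y : Term) : (relF T x y : Fml P).Holds I v ↔
    RB (T.eval v) (x.eval v) (y.eval v) := by
  simp only [relF, h_mem, ev_pair, RB]

def TB (n L M N : ℕ) : Prop := ∀ u ≤ n, ∀ v ≤ n,
  (RB L u v ↔ ((u = 0 ∧ ∃ a b r, v = ncons a b r) ∨
  ∃ a b r, u = ncons a b r ∧ ∃ a' b' r', v = ncons a' b' r' ∧
    (RB L a a' ∨ (a = a' ∧ (((RB L b b' ∧ RB M b b') ∨ RB N b b') ∨ (b = b' ∧ RB L r r')))))) ∧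
  (RB M u v ↔ (u = 0 ∨ ∃ a b r, u = ncons a b r ∧ (RB M a v ∧ ((RB L b v ∧ RB M b v) ∨ RB N b v) ∧ RB M r v))) ∧
  (RB N u v ↔ (∃ a b r, v = ncons a b r ∧ (RB N u a ∨ ((u = b ∨ ((RB L u b ∧ RB M u b) ∨ RB N u b)) ∨ RB N u r))))

theorem h_table (v : ℕ → ℕ) (n L M N : Term) : (tableF n L M N : Fml P).Holds I v ↔
    TB (n.eval v) (L.eval v) (M.eval v) (N.eval v) := by
  simp only [tableF, h_ball, ev_succ, Fml.Holds, h_iff, h_rel, stepL, stepM, stepN, thetaF, h_exAdd,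
    eval_lift, Term.eval, vcons, ev_zero, TB, Nat.lt_succ_iff, and_true]

theorem TB_iff {n L M N : ℕ} (h : TB n L M N) : ∀ m, ∀ u ≤ n, ∀ v ≤ n, u + v = m →
   (RB L u v ↔ SL u v) ∧ (RB M u v ↔ SM u v) ∧ (RB N u v ↔ SN u v) := by
  intro m
  induction m using Nat.strong_induction_on with
  | _ m ih =>
  intro u hu v hv hm
  obtain ⟨h1, h2, h3⟩ := h u hu v hv
  have key : ∀ u' v', u' ≤ u → v' ≤ v → u' + v' < m →
    (RB L u' v' ↔ SL u' v') ∧ (RB M u' v' ↔ SM u' v') ∧ (RB N u' v' ↔ SN u' v') :=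
    fun u' v' a b c => ih _ c u' (by omega) v' (by omega) rfl
  rw [h1, h2, h3, SL_eq, SM_eq, SN_eq]
  refine ⟨?_, ?_, ?_⟩
  · refine or_congr Iff.rfl ?_
    refine exists_congr fun a => exists_congr fun b => exists_congr fun r => ?_
    rw [exists_prop]
    refine and_congr_right fun e => ?_
    refine exists_congr fun a' => exists_congr fun b' => exists_congr fun r' => ?_
    rw [exists_prop]
    refine and_congr_right fun e' => ?_
    have := nc_a a b r
    have := nc_b a b r
    have := nc_r a b r
    have := nc_a a' b' r'
    have := nc_b a' b' r'
    have := nc_r a' b' r'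
    rw [(key a a' (by omega) (by omega) (by omega)).1, (key b b' (by omega) (by omega) (by omega)).1,
     (key b b' (by omega) (by omega) (by omega)).2.1, (key b b' (by omega) (by omega) (by omega)).2.2,
     (key r r' (by omega) (by omega) (by omega)).1]
  · refine or_congr Iff.rfl ?_
    refine exists_congr fun a => exists_congr fun b => exists_congr fun r => ?_
    rw [exists_prop]
    refine and_congr_right fun e => ?_
    have := nc_a a b r
    have := nc_b a b r
    have := nc_r a b r
    rw [(key a v (by omega) (by omega) (by omega)).2.1, (key b v (by omega) (by omega) (by omega)).1,
     (key b v (by omega) (by omega) (by omega)).2.1, (key b v (by omega) (by omega) (by omega)).2.2,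
     (key r v (by omega) (by omega) (by omega)).2.1]
  · refine exists_congr fun a => exists_congr fun b => exists_congr fun r => ?_
    rw [exists_prop]
    refine and_congr_right fun e => ?_
    have := nc_a a b r
    have := nc_b a b r
    have := nc_r a b r
    rw [(key u a (by omega) (by omega) (by omega)).2.2, (key u b (by omega) (by omega) (by omega)).1,
     (key u b (by omega) (by omega) (by omega)).2.1, (key u b (by omega) (by omega) (by omega)).2.2,
     (key u r (by omega) (by omega) (by omega)).2.2]

open Classical in
theorem mk (R : ℕ → ℕ → Prop) (n : ℕ) : ∃ T < 2 ^ ((n + n + 1) * (n + n + 1)), ∀ u ≤ n, ∀ v ≤ n, RB T u v ↔ R u v := by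
  let f : Fin ((n + n + 1) * (n + n + 1)) → Bool := fun i => decide (∃ u v, OT.npair u v = i ∧ R u v)
  refine ⟨Nat.ofBits f, Nat.ofBits_lt_two_pow f, fun u hu v hv => ?_⟩
  have : OT.npair u v < (n + n + 1) * (n + n + 1) := by
    unfold OT.npair; nlinarith [Nat.mul_le_mul (add_le_add hu hv) (add_le_add hu hv)]
  rw [RB, Nat.testBit_ofBits_lt f _ this]
  simp only [f, decide_eq_true_eq]
  constructor
  · rintro ⟨u', v', h, h'⟩; obtain ⟨rfl, rfl⟩ := np_inj h; exact h'
  · intro h; exact ⟨_, _, rfl, h⟩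

theorem TB_ex (n : ℕ) : ∃ L < 2 ^ ((n + n + 1) * (n + n + 1)), ∃ M < 2 ^ ((n + n + 1) * (n + n + 1)),
   ∃ N < 2 ^ ((n + n + 1) * (n + n + 1)), TB n L M N := by
  obtain ⟨L, hL, hL'⟩ := mk SL n
  obtain ⟨M, hM, hM'⟩ := mk SM n
  obtain ⟨N, hN, hN'⟩ := mk SN n
  refine ⟨L, hL, M, hM, N, hN, fun u hu v hv => ?_⟩
  rw [hL' u hu v hv, hM' u hu v hv, hN' u hu v hv, SL_eq, SM_eq, SN_eq]
  refine ⟨?_, ?_, ?_⟩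
  · refine or_congr Iff.rfl ?_
    refine exists_congr fun a => exists_congr fun b => exists_congr fun r => ?_
    rw [exists_prop]
    refine and_congr_right fun e => ?_
    refine exists_congr fun a' => exists_congr fun b' => exists_congr fun r' => ?_
    rw [exists_prop]
    refine and_congr_right fun e' => ?_
    have := nc_a a b r
    have := nc_b a b r
    have := nc_r a b r
    have := nc_a a' b' r'
    have := nc_b a' b' r'
    have := nc_r a' b' r'
    rw [hL' a (by omega) a' (by omega), hL' b (by omega) b' (by omega), hM' b (by omega) b' (by omega), hN' b (by omega) b' (by omega), hL' r (by omega) r' (by omega)]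
  · refine or_congr Iff.rfl ?_
    refine exists_congr fun a => exists_congr fun b => exists_congr fun r => ?_
    rw [exists_prop]
    refine and_congr_right fun e => ?_
    have := nc_a a b r
    have := nc_b a b r
    have := nc_r a b r
    rw [hM' a (by omega) v (by omega), hL' b (by omega) v (by omega), hM' b (by omega) v (by omega), hN' b (by omega) v (by omega), hM' r (by omega) v (by omega)]
  · refine exists_congr fun a => exists_congr fun b => exists_congr fun r => ?_
    rw [exists_prop]
    refine and_congr_right fun e => ?_
    have := nc_a a b r
    have := nc_b a b r
    have := nc_r a b r
    rw [hN' u (by omega) a (by omega), hL' u (by omega) b (by omega), hM' u (by omega) b (by omega), hN' u (by omega) b (by omega), hN' u (by omega) r (by omega)]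

def NB (L M N x : ℕ) : Prop := ∃ S < 2 ^ (x + 1), S.testBit x = true ∧ ∀ z ≤ x, S.testBit z = true →
   (z = 0 ∨ ∃ a b r, z = ncons a b r ∧ (S.testBit a = true ∧ S.testBit b = true ∧ S.testBit r = true) ∧
     (r = 0 ∨ ∃ a' b' r', r = ncons a' b' r' ∧ (RB L a' a ∨ (a' = a ∧ (b' = b ∨ ((RB L b' b ∧ RB M b' b) ∨ RB N b' b))))))

theorem h_nf (v : ℕ → ℕ) (L M N x : Term) : (nfF L M N x : Fml P).Holds I v ↔
    NB (L.eval v) (M.eval v) (N.eval v) (x.eval v) := by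
  simp only [nfF, h_bex, h_ball, ev_succ, ev_pow, Fml.Holds, h_imp, h_rel, h_mem, thetaF, h_exAdd,
    eval_lift, Term.eval, vcons, ev_zero, NB, Nat.lt_add_one_iff]

open Classical in
theorem NB_iff {n L M N : ℕ} (h : TB n L M N) (x : ℕ) (hx : x ≤ n) :
    NB L M N x ↔ ∃ s : OT, s.NF ∧ s.code = x := by
  have K1 : ∀ s t : OT, s.code ≤ n → t.code ≤ n → (RB L s.code t.code ↔ OT.Lt s t) := by
    intro s t hs ht
    rw [(TB_iff h _ _ hs _ ht rfl).1, (S_iff _ s t rfl).1]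
  have K2 : ∀ s t : OT, s.code ≤ n → t.code ≤ n → (((RB L s.code t.code ∧ RB M s.code t.code) ∨ RB N s.code t.code) ↔ OT.Lt s.theta t.theta) := by
    intro s t hs ht
    rw [(TB_iff h _ _ hs _ ht rfl).1, (S_iff _ s t rfl).1, (TB_iff h _ _ hs _ ht rfl).2.1, (S_iff _ s t rfl).2.1, (TB_iff h _ _ hs _ ht rfl).2.2, (S_iff _ s t rfl).2.2, ← tc_iff]
    rfl
  constructor
  · rintro ⟨S, -, hS, H⟩
    have : ∀ z, z ≤ x → S.testBit z = true → ∃ s : OT, s.NF ∧ s.code = z := by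
      intro z
      induction z using Nat.strong_induction_on with
      | _ z ih =>
      intro hz hzS
      rcases H z hz hzS with rfl | ⟨a, b, r, e, ⟨ha, hb, hr⟩, H'⟩
      · exact ⟨.zero, trivial, rfl⟩
      · have := nc_a a b r
        have := nc_b a b r
        have := nc_r a b r
        obtain ⟨sa, ha1, rfl⟩ := ih a (by omega) (by omega) ha
        obtain ⟨sb, hb1, rfl⟩ := ih b (by omega) (by omega) hb
        obtain ⟨sr, hr1, rfl⟩ := ih r (by omega) (by omega) hr
        refine ⟨.add sa sb sr, ⟨ha1, hb1, hr1, ?_⟩, e.symm⟩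
        rintro a' b' r' rfl
        rcases H' with H' | ⟨x', y', z', e', H'⟩
        · simp [OT.code] at H'
        · obtain ⟨rfl, rfl, rfl⟩ := nc_inj e'
          have := nc_a a'.code b'.code r'.code
          have := nc_b a'.code b'.code r'.code
          rw [K1 _ _ (by omega) (by omega), K2 _ _ (by omega) (by omega)] at H'
          rcases H' with H' | ⟨h1, h2 | H'⟩
          · exact .inl H'
          · exact .inr ⟨code_inj h1, .inl (code_inj h2)⟩
          · exact .inr ⟨code_inj h1, .inr H'⟩
    exact this x le_rfl hS
  · rintro ⟨s, hs, rfl⟩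
    let f : Fin (s.code + 1) → Bool := fun i => decide (∃ t : OT, t.NF ∧ t.code = i)
    have hf : ∀ z ≤ s.code, (Nat.ofBits f).testBit z = true ↔ ∃ t : OT, t.NF ∧ t.code = z := by
      intro z hz
      rw [Nat.testBit_ofBits_lt f _ (by omega)]; simp [f]
    refine ⟨Nat.ofBits f, Nat.ofBits_lt_two_pow f, (hf _ le_rfl).2 ⟨s, hs, rfl⟩, ?_⟩
    intro z hz hzS
    obtain ⟨t, ht, rfl⟩ := (hf z hz).1 hzS
    cases t with
    | zero => exact .inl rfl
    | add a b r =>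
      right
      have e : (OT.add a b r).code = ncons a.code b.code r.code := rfl
      have := nc_a a.code b.code r.code
      have := nc_b a.code b.code r.code
      have := nc_r a.code b.code r.code
      obtain ⟨ha, hb, hr, H⟩ := ht
      refine ⟨_, _, _, e, ⟨(hf _ (by omega)).2 ⟨a, ha, rfl⟩, (hf _ (by omega)).2 ⟨b, hb, rfl⟩, (hf _ (by omega)).2 ⟨r, hr, rfl⟩⟩, ?_⟩
      cases r with
      | zero => exact .inl rfl
      | add a' b' r' =>
        right
        have e' : (OT.add a' b' r').code = ncons a'.code b'.code r'.code := rfl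
        have := nc_a a'.code b'.code r'.code
        have := nc_b a'.code b'.code r'.code
        refine ⟨_, _, _, e', ?_⟩
        rw [K1 _ _ (by omega) (by omega), K2 _ _ (by omega) (by omega)]
        rcases H a' b' r' rfl with h | ⟨rfl, rfl | h⟩
        · exact .inl h
        · exact .inr ⟨rfl, .inl rfl⟩
        · exact .inr ⟨rfl, .inr h⟩

/-- In the standard model the formula defines the order of `OT'(ϑ)` on codes. -/
theorem ltF_holds (v : ℕ → ℕ) (x y : Term) : (ltF x y : Fml P).Holds I v ↔
    ∃ s t : OT, s.NF ∧ t.NF ∧ s.Lt t ∧ s.code = x.eval v ∧ t.code = y.eval v := by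
  simp only [ltF, h_bex, Fml.Holds, h_table, h_nf, h_rel, tableBound, eval_lift, Term.eval, vcons, ev_pow, ev_add, ev_mul, ev_succ]
  generalize x.eval v = x
  generalize y.eval v = y
  constructor
  · rintro ⟨L, _, M, _, N, _, hT, ⟨hx, hy⟩, hl⟩
    obtain ⟨s, hs, rfl⟩ := (NB_iff hT _ (by omega)).1 hx
    obtain ⟨t, ht, rfl⟩ := (NB_iff hT _ (by omega)).1 hy
    refine ⟨s, t, hs, ht, ?_, rfl, rfl⟩
    rwa [(TB_iff hT _ _ (by omega) _ (by omega) rfl).1, (S_iff _ s t rfl).1] at hl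
  · rintro ⟨s, t, hs, ht, hl, rfl, rfl⟩
    obtain ⟨L, hL, M, hM, N, hN, hT⟩ := TB_ex (s.code + t.code)
    refine ⟨L, hL, M, hM, N, hN, hT, ⟨(NB_iff hT _ (by omega)).2 ⟨s, hs, rfl⟩, (NB_iff hT _ (by omega)).2 ⟨t, ht, rfl⟩⟩, ?_⟩
    rwa [(TB_iff hT _ _ (by omega) _ (by omega) rfl).1, (S_iff _ s t rfl).1]
end

end OrderCheck

end WeakID

/-! ### Substitution and truth in structures. -/

namespace WeakID

open Term (var func)
open Fml

/-! The argument is semantic. By completeness of the calculus it suffices to show that `ϑ(Ω_k(ℓ)) ∈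
W` holds in every model of the theory, standard or not. Inside a model `M`, induction for bounded
formulas gives a discretely ordered semiring with binary digits, hence finite sets coded by numbers
and definitions by recursion along `<`. So the formula `ltF` obeys the expected recursive clauses on
all codes of `M`, nonstandard ones included (`order_clauses`, `NFm_clause`, `sat_ltF`). Neither
transitivity, nor irreflexivity, nor linearity of the order is ever needed.

The ordinal part is a Gentzen jump. Consider normal forms all of whose coefficients are built from
accessible `ϑ(b)`, and call `X` progressive if it contains each such term whose predecessors of the
same kind it contains. The set `X₀ = {x : ϑ(x) ∈ W}` is progressive (`prog_theta`): a predecessor of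
`ϑ(α)` is a sum of terms `ϑ(b)`, and each of them either has `b < α` with the elements of `K(b)`
below `ϑ(α)`, or is bounded by an element of `K(α)`.

The jump of `X` consists of those `a` for which `X`, whenever it contains everything below `β`,
contains everything in `[β, β + Ω^a)`. It is progressive if `X` is (`Prog.jump`). A remainder below
`Ω^a` begins with some `Ω^{a'} · η` where `a' < a` and `η` is accessible, and the jump at `a'` is
iterated `η` times by induction along `W` (`Jump.mul`). That induction is for a formula of the
complexity of `X`, and the jump is one quantifier alternation more complex. Starting from `X₀`, the
schema for `Π⁰ₖ(Ω)` therefore yields progressiveness of the jumps `X₁, …, X_k` and no further.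

Finally, `X_k` contains every standard `ℓ` by an induction outside the theory. If `a` lies in the
jump of a progressive `X`, then `Ω^a ∈ X`. Undoing the `k` jumps one after another turns `ℓ ∈ X_k`
into `Ω_k(ℓ) ∈ X₀`. -/

theorem vcons_zero {X : Type} (x : X) (v : ℕ → X) : vcons x v 0 = x := rfl

theorem vcons_succ {X : Type} (x : X) (v : ℕ → X) (i : ℕ) : vcons x v (i + 1) = v i := rfl

theorem vcons_eta {X : Type} (v : ℕ → X) : vcons (v 0) (fun i => v (i + 1)) = v := by
  funext i; cases i <;> rfl

/-! ### Substitution -/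

namespace Term

theorem subst_subst (t : Term) (s s' : ℕ → Term) :
    (t.subst s).subst s' = t.subst (fun i => (s i).subst s') := by
  induction t with
  | var i => rfl
  | func f ts ih => simp only [subst, ih]

theorem subst_var (t : Term) : t.subst var = t := by
  induction t with
  | var i => rfl
  | func f ts ih => simp only [subst, ih]

theorem lift_subst_vcons (t u : Term) (s : ℕ → Term) :
    (t.lift 1).subst (vcons u s) = t.subst s := by
  simp only [lift, subst_subst, subst, vcons]

theorem lift_subst_inst (t u : Term) : (t.lift 1).subst (inst u) = t := by
  rw [inst, lift_subst_vcons, subst_var]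

theorem lift_subst_up (t : Term) (s : ℕ → Term) :
    (t.lift 1).subst (up s) = (t.subst s).lift 1 := by
  simp only [lift, subst_subst, subst, up]

theorem ClosedAt.mono {t : Term} {m n : ℕ} (h : t.ClosedAt m) (hmn : m ≤ n) : t.ClosedAt n := by
  induction t with
  | var i => exact lt_of_lt_of_le h hmn
  | func f ts ih => exact fun j => ih j (h j)

theorem exists_closedAt (t : Term) : ∃ n, t.ClosedAt n := by
  induction t with
  | var i => exact ⟨i + 1, Nat.lt_succ_self i⟩
  | func f ts ih =>
    choose g hg using ih
    exact ⟨Finset.univ.sup g, fun j => (hg j).mono (Finset.le_sup (Finset.mem_univ j))⟩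

theorem ClosedAt.subst_congr {t : Term} {n : ℕ} (h : t.ClosedAt n) {s s' : ℕ → Term}
    (hs : ∀ i < n, s i = s' i) : t.subst s = t.subst s' := by
  induction t with
  | var i => exact hs i h
  | func f ts ih => simp only [subst, fun j => ih j (h j)]

end Term

theorem up_var : up var = var := by
  funext i; cases i <;> rfl

theorem up_subst (s s' : ℕ → Term) :
    (fun i => (up s i).subst (up s')) = up (fun i => (s i).subst s') := by
  funext i
  cases i with
  | zero => rfl
  | succ i => exact Term.lift_subst_up _ _

namespace Fml

variable {P Q : Type}

theorem subst_subst (A : Fml P) (s s' : ℕ → Term) :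
    (A.subst s).subst s' = A.subst (fun i => (s i).subst s') := by
  induction A generalizing s s' <;> simp_all [subst, Term.subst_subst, up_subst]

theorem subst_var (A : Fml P) : A.subst var = A := by
  induction A <;> simp_all [subst, Term.subst_var, up_var]

theorem neg_subst (A : Fml P) (s : ℕ → Term) : (A.subst s).neg = A.neg.subst s := by
  induction A generalizing s <;> simp_all [neg, subst]

theorem IsLiteral.subst {A : Fml P} (h : A.IsLiteral) (s : ℕ → Term) : (A.subst s).IsLiteral := by
  cases A <;> first | exact trivial | exact h.elim

theorem subst_up_inst (A : Fml P) (s : ℕ → Term) (t : Term) :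
    (A.subst (up s)).subst (inst t) = A.subst (vcons t s) := by
  rw [subst_subst]
  congr 1
  funext i
  cases i with
  | zero => rfl
  | succ i => exact Term.lift_subst_inst _ _

theorem subst_inst_subst (A : Fml P) (s : ℕ → Term) (t : Term) :
    (A.subst (inst t)).subst s = A.subst (vcons (t.subst s) s) := by
  rw [subst_subst]
  congr 1
  funext i
  cases i <;> rfl

theorem shift_subst_up (A : Fml P) (s : ℕ → Term) : A.shift.subst (up s) = (A.subst s).shift := by
  simp only [shift, subst_subst]
  rfl

theorem ClosedAt.mono {A : Fml P} {m n : ℕ} (h : A.ClosedAt m) (hmn : m ≤ n) : A.ClosedAt n := by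
  induction A generalizing m n with
  | eq s t => exact ⟨h.1.mono hmn, h.2.mono hmn⟩
  | ne s t => exact ⟨h.1.mono hmn, h.2.mono hmn⟩
  | lt s t => exact ⟨h.1.mono hmn, h.2.mono hmn⟩
  | nlt s t => exact ⟨h.1.mono hmn, h.2.mono hmn⟩
  | pr p t => exact Term.ClosedAt.mono (t := t) h hmn
  | npr p t => exact Term.ClosedAt.mono (t := t) h hmn
  | and A B ha hb => exact ⟨ha h.1 hmn, hb h.2 hmn⟩
  | or A B ha hb => exact ⟨ha h.1 hmn, hb h.2 hmn⟩
  | all A ih => exact ih (m := m + 1) (n := n + 1) h (Nat.succ_le_succ hmn)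
  | ex A ih => exact ih (m := m + 1) (n := n + 1) h (Nat.succ_le_succ hmn)

theorem exists_closedAt (A : Fml P) : ∃ n, A.ClosedAt n := by
  have two (s t : Term) : ∃ n, s.ClosedAt n ∧ t.ClosedAt n := by
    obtain ⟨m, hm⟩ := s.exists_closedAt
    obtain ⟨n, hn⟩ := t.exists_closedAt
    exact ⟨max m n, hm.mono (le_max_left _ _), hn.mono (le_max_right _ _)⟩
  induction A with
  | eq s t => exact two s t
  | ne s t => exact two s t
  | lt s t => exact two s t
  | nlt s t => exact two s t
  | pr p t => exact t.exists_closedAt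
  | npr p t => exact t.exists_closedAt
  | and A B ha hb =>
    obtain ⟨m, hm⟩ := ha
    obtain ⟨n, hn⟩ := hb
    exact ⟨max m n, hm.mono (le_max_left _ _), hn.mono (le_max_right _ _)⟩
  | or A B ha hb =>
    obtain ⟨m, hm⟩ := ha
    obtain ⟨n, hn⟩ := hb
    exact ⟨max m n, hm.mono (le_max_left _ _), hn.mono (le_max_right _ _)⟩
  | all A ih => obtain ⟨n, hn⟩ := ih; exact ⟨n, hn.mono (Nat.le_succ n)⟩
  | ex A ih => obtain ⟨n, hn⟩ := ih; exact ⟨n, hn.mono (Nat.le_succ n)⟩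

theorem ClosedAt.subst_congr {A : Fml P} {n : ℕ} (h : A.ClosedAt n) {s s' : ℕ → Term}
    (hs : ∀ i < n, s i = s' i) : A.subst s = A.subst s' := by
  have hup {m : ℕ} {s s' : ℕ → Term} (hs : ∀ i < m, s i = s' i) :
      ∀ i < m + 1, up s i = up s' i := by
    rintro (_ | i) hi
    · rfl
    · simp only [up, hs i (by omega)]
  induction A generalizing n s s' with
  | eq s t => simp only [subst, Term.ClosedAt.subst_congr h.1 hs, Term.ClosedAt.subst_congr h.2 hs]
  | ne s t => simp only [subst, Term.ClosedAt.subst_congr h.1 hs, Term.ClosedAt.subst_congr h.2 hs]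
  | lt s t => simp only [subst, Term.ClosedAt.subst_congr h.1 hs, Term.ClosedAt.subst_congr h.2 hs]
  | nlt s t => simp only [subst, Term.ClosedAt.subst_congr h.1 hs, Term.ClosedAt.subst_congr h.2 hs]
  | pr p t => simp only [subst, Term.ClosedAt.subst_congr (t := t) h hs]
  | npr p t => simp only [subst, Term.ClosedAt.subst_congr (t := t) h hs]
  | and A B ha hb => simp only [subst, ha h.1 hs, hb h.2 hs]
  | or A B ha hb => simp only [subst, ha h.1 hs, hb h.2 hs]
  | all A ih => simp only [subst, ih (n := n + 1) h (hup hs)]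
  | ex A ih => simp only [subst, ih (n := n + 1) h (hup hs)]

theorem ClosedAt.subst_eq {A : Fml P} (h : A.ClosedAt 0) (s : ℕ → Term) : A.subst s = A := by
  rw [h.subst_congr (s' := var) (fun _ hi => absurd hi (Nat.not_lt_zero _)), subst_var]

end Fml

/-! ### Structures for the language -/

/-- An interpretation of the function constants and of `<`. -/
class AStr (M : Type) where
  fn : {n : ℕ} → EF n → (Fin n → M) → M
  lt : M → M → Prop

section sat

variable {M P Q : Type} [AStr M]

def Term.val (v : ℕ → M) : Term → M
  | var i => v i
  | func f ts => AStr.fn f (fun j => (ts j).val v)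

/-- Truth in a structure, with the predicate constants interpreted by `R`. -/
def Fml.Sat (R : P → M → Prop) : (ℕ → M) → Fml P → Prop
  | v, eq s t => s.val v = t.val v
  | v, ne s t => s.val v ≠ t.val v
  | v, lt s t => AStr.lt (s.val v) (t.val v)
  | v, nlt s t => ¬ AStr.lt (s.val v) (t.val v)
  | v, pr p t => R p (t.val v)
  | v, npr p t => ¬ R p (t.val v)
  | v, and A B => A.Sat R v ∧ B.Sat R v
  | v, or A B => A.Sat R v ∨ B.Sat R v
  | v, all A => ∀ x : M, A.Sat R (vcons x v)
  | v, ex A => ∃ x : M, A.Sat R (vcons x v)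

theorem val_subst (t : Term) (s : ℕ → Term) (v : ℕ → M) :
    (t.subst s).val v = t.val (fun i => (s i).val v) := by
  induction t with
  | var i => rfl
  | func f ts ih => simp only [Term.subst, Term.val, ih]

theorem val_lift (t : Term) (k : ℕ) (v : ℕ → M) :
    (t.lift k).val v = t.val (fun i => v (i + k)) := by
  rw [Term.lift, val_subst]; rfl

theorem val_up (s : ℕ → Term) (x : M) (v : ℕ → M) :
    (fun i => (up s i).val (vcons x v)) = vcons x (fun i => (s i).val v) := by
  funext i
  cases i with
  | zero => rfl
  | succ i => exact val_lift _ _ _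

theorem val_inst (t : Term) (v : ℕ → M) :
    (fun i => (inst t i).val v) = vcons (t.val v) v := by
  funext i; cases i <;> rfl

variable {R : P → M → Prop}

theorem sat_subst (A : Fml P) (s : ℕ → Term) (v : ℕ → M) :
    (A.subst s).Sat R v ↔ A.Sat R (fun i => (s i).val v) := by
  induction A generalizing s v <;> simp_all [Fml.subst, Fml.Sat, val_subst, val_up]

theorem sat_shift (A : Fml P) (x : M) (v : ℕ → M) : A.shift.Sat R (vcons x v) ↔ A.Sat R v := by
  rw [Fml.shift, sat_subst]; rfl

theorem sat_neg (A : Fml P) (v : ℕ → M) : A.neg.Sat R v ↔ ¬ A.Sat R v := by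
  induction A generalizing v <;> simp_all [Fml.neg, Fml.Sat]; tauto

theorem sat_imp (A B : Fml P) (v : ℕ → M) : (imp A B).Sat R v ↔ (A.Sat R v → B.Sat R v) := by
  simp only [imp, Fml.Sat, sat_neg]; tauto

theorem sat_iff (A B : Fml P) (v : ℕ → M) : (Fml.iff A B).Sat R v ↔ (A.Sat R v ↔ B.Sat R v) := by
  simp only [Fml.iff, Fml.Sat, sat_imp]; tauto

/-- Putting formulas for the predicates amounts to interpreting each predicate by the set its
formula defines. This is how the two axiom schemata for `R_φ` become closure and minimality
statements in a model. -/
theorem sat_substPred (A : Fml Q) (F : Q → Fml P) (v : ℕ → M) :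
    (A.substPred F).Sat R v ↔ A.Sat (fun p x => (F p).Sat R (vcons x v)) v := by
  have hF (F : Q → Fml P) (v : ℕ → M) (x : M) (p : Q) (y : M) :
      ((F p).subst (up (fun i => var (i + 1)))).Sat R (vcons y (vcons x v)) ↔
        (F p).Sat R (vcons y v) := by
    rw [sat_subst, val_up]; rfl
  induction A generalizing F v with
  | pr p t => simp only [Fml.substPred, Fml.Sat, sat_subst, val_inst]
  | npr p t => simp only [Fml.substPred, Fml.Sat, sat_neg, sat_subst, val_inst]
  | all A ih => simp only [Fml.substPred, Fml.Sat, ih, hF]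
  | ex A ih => simp only [Fml.substPred, Fml.Sat, ih, hF]
  | _ => simp_all only [Fml.substPred, Fml.Sat]

theorem Term.ClosedAt.val_congr {t : Term} {n : ℕ} (h : t.ClosedAt n) {v w : ℕ → M}
    (hv : ∀ i < n, v i = w i) : t.val v = t.val w := by
  induction t with
  | var i => exact hv i h
  | func f ts ih => simp only [Term.val, fun j => ih j (h j)]

theorem Fml.ClosedAt.sat_congr {A : Fml P} {n : ℕ} (h : A.ClosedAt n) {v w : ℕ → M}
    (hv : ∀ i < n, v i = w i) : A.Sat R v ↔ A.Sat R w := by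
  have hup {m : ℕ} {v w : ℕ → M} (hv : ∀ i < m, v i = w i) (x : M) :
      ∀ i < m + 1, vcons x v i = vcons x w i := by
    rintro (_ | i) hi
    · rfl
    · exact hv i (by omega)
  induction A generalizing n v w with
  | eq s t => simp only [Fml.Sat, Term.ClosedAt.val_congr h.1 hv, Term.ClosedAt.val_congr h.2 hv]
  | ne s t => simp only [Fml.Sat, Term.ClosedAt.val_congr h.1 hv, Term.ClosedAt.val_congr h.2 hv]
  | lt s t => simp only [Fml.Sat, Term.ClosedAt.val_congr h.1 hv, Term.ClosedAt.val_congr h.2 hv]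
  | nlt s t => simp only [Fml.Sat, Term.ClosedAt.val_congr h.1 hv, Term.ClosedAt.val_congr h.2 hv]
  | pr p t => simp only [Fml.Sat, Term.ClosedAt.val_congr (t := t) h hv]
  | npr p t => simp only [Fml.Sat, Term.ClosedAt.val_congr (t := t) h hv]
  | and A B ha hb => exact and_congr (ha h.1 hv) (hb h.2 hv)
  | or A B ha hb => exact or_congr (ha h.1 hv) (hb h.2 hv)
  | all A ih => exact forall_congr' fun x => ih (n := n + 1) h (hup hv x)
  | ex A ih => exact exists_congr fun x => ih (n := n + 1) h (hup hv x)

end sat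

end WeakID

/-! ### Completeness of the sequent calculus. -/

namespace WeakID

open Term (var func)
open Fml

/-! ### Countability of the language -/

/-- The codes serve only to enumerate all formulas in the Henkin construction. The inner arity `m`
of a composition is recorded because it cannot be read off from the arity of the whole. -/
def EF.code : {n : ℕ} → EF n → ℕ
  | _, .zero => Nat.pair 0 0
  | _, .succ => Nat.pair 1 0
  | _, .proj i => Nat.pair 2 i
  | _, .add => Nat.pair 3 0
  | _, .mul => Nat.pair 4 0
  | _, .monus => Nat.pair 5 0
  | _, @EF.comp m _ f g =>
    Nat.pair 6 (Nat.pair m (Nat.pair f.code (Encodable.encode (List.ofFn fun j => (g j).code))))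
  | _, .bsum f => Nat.pair 7 f.code
  | _, .bprod f => Nat.pair 8 f.code

theorem EF.code_injective {n : ℕ} (f g : EF n) (h : f.code = g.code) : f = g := by
  induction f with
  | comp f fs ih ihs =>
    cases g with
    | comp g gs =>
      simp only [EF.code, Nat.pair_eq_pair, true_and] at h
      obtain ⟨rfl, h1, h2⟩ := h
      have h3 := List.ofFn_injective (Encodable.encode_injective h2)
      rw [ih g h1, funext fun j => ihs j (gs j) (congrFun h3 j)]
    | _ => simp [EF.code, Nat.pair_eq_pair] at h
  | bsum f ih =>
    cases g with
    | bsum g => rw [ih g (by simpa [EF.code, Nat.pair_eq_pair] using h)]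
    | _ => simp [EF.code, Nat.pair_eq_pair] at h
  | bprod f ih =>
    cases g with
    | bprod g => rw [ih g (by simpa [EF.code, Nat.pair_eq_pair] using h)]
    | _ => simp [EF.code, Nat.pair_eq_pair] at h
  | proj i =>
    cases g with
    | proj j => rw [Fin.ext (a := i) (b := j) (by simpa [EF.code, Nat.pair_eq_pair] using h)]
    | _ => simp [EF.code, Nat.pair_eq_pair] at h
  | _ => cases g <;> first | rfl | simp [EF.code, Nat.pair_eq_pair] at h

def Term.code : Term → ℕ
  | var i => Nat.pair 0 i
  | @func n f ts =>
    Nat.pair 1 (Nat.pair n (Nat.pair f.code (Encodable.encode (List.ofFn fun j => (ts j).code))))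

theorem Term.code_injective (t u : Term) (h : t.code = u.code) : t = u := by
  induction t generalizing u with
  | var i =>
    cases u with
    | var j => rw [show i = j by simpa [Term.code, Nat.pair_eq_pair] using h]
    | func => simp [Term.code, Nat.pair_eq_pair] at h
  | func f ts ih =>
    cases u with
    | var => simp [Term.code, Nat.pair_eq_pair] at h
    | func g us =>
      simp only [Term.code, Nat.pair_eq_pair, true_and] at h
      obtain ⟨rfl, h1, h2⟩ := h
      have h3 := List.ofFn_injective (Encodable.encode_injective h2)
      rw [EF.code_injective _ _ h1, funext fun j => ih j (us j) (congrFun h3 j)]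

def Fml.code {P : Type} (c : P → ℕ) : Fml P → ℕ
  | eq s t => Nat.pair 0 (Nat.pair s.code t.code)
  | ne s t => Nat.pair 1 (Nat.pair s.code t.code)
  | lt s t => Nat.pair 2 (Nat.pair s.code t.code)
  | nlt s t => Nat.pair 3 (Nat.pair s.code t.code)
  | pr p t => Nat.pair 4 (Nat.pair (c p) t.code)
  | npr p t => Nat.pair 5 (Nat.pair (c p) t.code)
  | and A B => Nat.pair 6 (Nat.pair (A.code c) (B.code c))
  | or A B => Nat.pair 7 (Nat.pair (A.code c) (B.code c))
  | all A => Nat.pair 8 (A.code c)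
  | ex A => Nat.pair 9 (A.code c)

theorem Fml.code_injective {P : Type} {c : P → ℕ} (hc : c.Injective) (A B : Fml P)
    (h : A.code c = B.code c) : A = B := by
  have ht (s t : Term) : s.code = t.code ↔ s = t := ⟨Term.code_injective s t, fun h => h ▸ rfl⟩
  induction A generalizing B with
  | and A A' ih ih' =>
    cases B with
    | and B B' =>
      simp only [Fml.code, Nat.pair_eq_pair, true_and] at h
      rw [ih _ h.1, ih' _ h.2]
    | _ => simp [Fml.code, Nat.pair_eq_pair] at h
  | or A A' ih ih' =>
    cases B with
    | or B B' =>
      simp only [Fml.code, Nat.pair_eq_pair, true_and] at h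
      rw [ih _ h.1, ih' _ h.2]
    | _ => simp [Fml.code, Nat.pair_eq_pair] at h
  | all A ih =>
    cases B with
    | all B =>
      simp only [Fml.code, Nat.pair_eq_pair, true_and] at h
      rw [ih _ h]
    | _ => simp [Fml.code, Nat.pair_eq_pair] at h
  | ex A ih =>
    cases B with
    | ex B =>
      simp only [Fml.code, Nat.pair_eq_pair, true_and] at h
      rw [ih _ h]
    | _ => simp [Fml.code, Nat.pair_eq_pair] at h
  | _ => cases B <;> simp_all [Fml.code, Nat.pair_eq_pair, hc.eq_iff]

instance {P : Type} [Countable P] : Countable (Fml P) := by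
  obtain ⟨c, hc⟩ := exists_injective_nat P
  exact ⟨⟨_, fun A B => Fml.code_injective hc A B⟩⟩

/-! ### Admissible rules -/

variable {P : Type} {T : Set (Fml P)}

namespace Derivable

theorem weaken {Γ Δ : List (Fml P)} (h : Derivable T Γ) (hs : Γ ⊆ Δ) : Derivable T Δ := by
  induction h generalizing Δ with
  | axm h1 h2 => exact .axm h1 (hs h2)
  | lit h1 h2 h3 => exact .lit h1 (hs h2) (hs h3)
  | eqRefl h1 => exact .eqRefl (hs h1)
  | eqSubst h1 h2 h3 h4 => exact .eqSubst h1 (hs h2) (hs h3) (hs h4)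
  | and h1 _ _ ih1 ih2 =>
    exact .and (hs h1) (ih1 (List.cons_subset_cons _ hs)) (ih2 (List.cons_subset_cons _ hs))
  | or h1 _ ih =>
    exact .or (hs h1) (ih (List.cons_subset_cons _ (List.cons_subset_cons _ hs)))
  | all h1 _ ih => exact .all (hs h1) (ih (List.cons_subset_cons _ (List.map_subset _ hs)))
  | ex t h1 _ ih => exact .ex t (hs h1) (ih (List.cons_subset_cons _ hs))
  | cut C _ _ ih1 ih2 =>
    exact .cut C (ih1 (List.cons_subset_cons _ hs)) (ih2 (List.cons_subset_cons _ hs))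

/-- Induction on `C`, since the rule `lit` gives this only for literals. Rules act on members of the
sequent and keep their principal formula, so no structural rule is needed. -/
theorem excludedMiddle (C : Fml P) {Γ : List (Fml P)} (h : C ∈ Γ) (h' : C.neg ∈ Γ) :
    Derivable T Γ := by
  have inst_self (A : Fml P) :
      (A.subst (up (fun i => var (i + 1)))).subst (inst (var 0)) = A := by
    rw [subst_up_inst]
    exact (congrArg A.subst (vcons_eta var)).trans A.subst_var
  induction C generalizing Γ with
  | and A B ha hb =>
    refine .and h ?_ ?_
    · exact .or (List.mem_cons_of_mem _ h') (ha (by simp) (by simp))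
    · exact .or (List.mem_cons_of_mem _ h') (hb (by simp) (by simp))
  | or A B ha hb =>
    refine .and h' ?_ ?_
    · exact .or (List.mem_cons_of_mem _ h) (ha (by simp) (by simp))
    · exact .or (List.mem_cons_of_mem _ h) (hb (by simp) (by simp))
  | all A ih =>
    refine .all h (.ex (var 0) (List.mem_cons_of_mem _ (List.mem_map_of_mem h')) ?_)
    rw [inst_self]
    exact ih (by simp) (by simp)
  | ex A ih =>
    refine .all h' (.ex (var 0) (List.mem_cons_of_mem _ (List.mem_map_of_mem h)) ?_)
    rw [inst_self]
    exact ih (by simp) (by simp)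
  | eq => exact .lit (L := eq _ _) trivial h h'
  | ne => exact .lit (L := ne _ _) trivial h h'
  | lt => exact .lit (L := lt _ _) trivial h h'
  | nlt => exact .lit (L := nlt _ _) trivial h h'
  | pr => exact .lit (L := pr _ _) trivial h h'
  | npr => exact .lit (L := npr _ _) trivial h h'

/-- The axioms have to be sentences: the rule `axm` supplies the members of `T` themselves and not
their substitution instances. -/
theorem subst (hT : ∀ A ∈ T, A.ClosedAt 0) {Γ : List (Fml P)} (h : Derivable T Γ)
    (s : ℕ → Term) : Derivable T (Γ.map (Fml.subst s)) := by
  have mem {Γ : List (Fml P)} {A : Fml P} (s : ℕ → Term) (h : A ∈ Γ) :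
      A.subst s ∈ Γ.map (Fml.subst s) := List.mem_map_of_mem h
  induction h generalizing s with
  | axm h1 h2 => exact .axm h1 ((hT _ h1).subst_eq s ▸ mem s h2)
  | lit h1 h2 h3 => exact .lit (h1.subst s) (mem s h2) (neg_subst _ s ▸ mem s h3)
  | eqRefl h1 => exact .eqRefl (mem s h1)
  | @eqSubst Γ L t u h1 h2 h3 h4 =>
    have e (t : Term) : (L.subst (inst t)).subst s = (L.subst (up s)).subst (inst (t.subst s)) := by
      rw [subst_inst_subst, subst_up_inst]
    refine .eqSubst (h1.subst (up s)) (mem s h2) ?_ ?_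
    · rw [← e, neg_subst]
      exact mem s h3
    · rw [← e]
      exact mem s h4
  | and h1 _ _ ih1 ih2 => exact .and (mem s h1) (ih1 s) (ih2 s)
  | or h1 _ ih => exact .or (mem s h1) (ih s)
  | @all Γ A h1 _ ih =>
    refine .all (mem s h1) ?_
    have := ih (up s)
    simpa only [List.map_cons, List.map_map, Function.comp_def, shift_subst_up] using this
  | @ex Γ A t h1 _ ih =>
    refine .ex (t.subst s) (mem s h1) ?_
    have := ih s
    rwa [List.map_cons, subst_inst_subst, ← subst_up_inst] at this
  | cut C _ _ ih1 ih2 => exact .cut (C.subst s) (ih1 s) (neg_subst C s ▸ ih2 s)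

theorem of_axioms {T' : Set (Fml P)} (hT : ∀ A ∈ T', Derivable T [A]) {Γ : List (Fml P)}
    (h : Derivable T' Γ) : Derivable T Γ := by
  induction h with
  | axm h1 h2 => exact (hT _ h1).weaken (by simpa using h2)
  | lit h1 h2 h3 => exact .lit h1 h2 h3
  | eqRefl h1 => exact .eqRefl h1
  | eqSubst h1 h2 h3 h4 => exact .eqSubst h1 h2 h3 h4
  | and h1 _ _ ih1 ih2 => exact .and h1 ih1 ih2
  | or h1 _ ih => exact .or h1 ih
  | all h1 _ ih => exact .all h1 ih
  | ex t h1 _ ih => exact .ex t h1 ih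
  | cut C _ _ ih1 ih2 => exact .cut C ih1 ih2

end Derivable

/-- Universal quantification over the first `n` variables. -/
def allN : ℕ → Fml P → Fml P
  | 0, A => A
  | n + 1, A => allN n (all A)

theorem allN_closedAt {n : ℕ} {A : Fml P} (h : A.ClosedAt n) : (allN n A).ClosedAt 0 := by
  induction n generalizing A with
  | zero => exact h
  | succ n ih => exact ih h

theorem Derivable.allN {n : ℕ} {A : Fml P} (h : Derivable T [A]) : Derivable T [allN n A] := by
  induction n generalizing A with
  | zero => exact h
  | succ n ih => exact ih (.all (List.mem_singleton_self _) (h.weaken (by simp)))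

theorem sat_of_allN {M : Type} [AStr M] {R : P → M → Prop} {n : ℕ} {A : Fml P}
    (h : ∀ v, (allN n A).Sat R v) (v : ℕ → M) : A.Sat R v := by
  induction n generalizing A v with
  | zero => exact h v
  | succ n ih => exact vcons_eta v ▸ ih h (fun i => v (i + 1)) (v 0)

/-- The universal closures of the axioms. -/
def univClosures (T : Set (Fml P)) : Set (Fml P) :=
  {B | ∃ A ∈ T, ∃ n, A.ClosedAt n ∧ B = allN n A}

theorem univClosures_closedAt : ∀ B ∈ univClosures T, B.ClosedAt 0 := by
  rintro _ ⟨A, -, n, h, rfl⟩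
  exact allN_closedAt h

/-- An axiom standing alone in a sequent may be generalized, which is the sense in which its free
variables are universally quantified. -/
theorem Derivable.of_univClosures {Γ : List (Fml P)} (h : Derivable (univClosures T) Γ) :
    Derivable T Γ := by
  refine h.of_axioms ?_
  rintro _ ⟨A, hA, n, -, rfl⟩
  exact Derivable.allN (.axm hA (List.mem_singleton_self _))

/-! ### The Henkin construction -/

/-- The false formulas of a Henkin model. -/
structure IsHenkin (T : Set (Fml P)) (S : Set (Fml P)) : Prop where
  consistent : ∀ Γ : List (Fml P), (∀ A ∈ Γ, A ∈ S) → ¬ Derivable T Γ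
  complete : ∀ A, A ∈ S ∨ A.neg ∈ S
  witness : ∀ A, all A ∈ S → ∃ t, A.subst (inst t) ∈ S

theorem exists_closedAt_list (Γ : List (Fml P)) : ∃ n, ∀ A ∈ Γ, A.ClosedAt n := by
  induction Γ with
  | nil => exact ⟨0, by simp⟩
  | cons A Γ ih =>
    obtain ⟨m, hm⟩ := A.exists_closedAt
    obtain ⟨n, hn⟩ := ih
    refine ⟨max m n, ?_⟩
    rintro B (_ | ⟨_, hB⟩)
    · exact hm.mono (le_max_left _ _)
    · exact (hn B hB).mono (le_max_right _ _)

/-- A variable beyond all those free in the sequent is a witness. -/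
theorem not_derivable_witness (hT : ∀ A ∈ T, A.ClosedAt 0) {Γ : List (Fml P)} {B : Fml P}
    (hB : all B ∈ Γ) (h : ¬ Derivable T Γ) : ∃ t, ¬ Derivable T (B.subst (inst t) :: Γ) := by
  obtain ⟨n, hn⟩ := exists_closedAt_list Γ
  refine ⟨var n, fun hd => h (.all hB ?_)⟩
  -- This renaming turns the fresh variable `n` into the eigenvariable `0` and shifts the variables
  -- of `Γ`, so that a derivation for the witness becomes the premise of the rule `all`.
  let s : ℕ → Term := fun i => if i < n then var (i + 1) else var 0
  have h1 := hd.subst hT s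
  rw [List.map_cons] at h1
  have e : (B.subst (inst (var n))).subst s = B := by
    rw [subst_inst_subst]
    refine (ClosedAt.subst_congr (A := B) (n := n + 1) (hn _ hB) (s' := var) ?_).trans B.subst_var
    rintro (_ | i) hi
    · simp [vcons, Term.subst, s]
    · simp [vcons, s, Nat.lt_of_succ_lt_succ hi]
  have e' : Γ.map (Fml.subst s) = Γ.map Fml.shift := by
    refine List.map_congr_left fun A hA => (hn A hA).subst_congr fun i hi => ?_
    simp [s, hi]
  rwa [e, e'] at h1

/-- Cut shows that `C` or its negation can be added without making the sequent derivable. If `C`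
itself is added and is universal, a false instance is added along with it. -/
theorem exists_henkin_step (hT : ∀ A ∈ T, A.ClosedAt 0) (Γ : List (Fml P))
    (h : ¬ Derivable T Γ) (C : Fml P) : ∃ Δ, ¬ Derivable T Δ ∧ Γ ⊆ Δ ∧ (C ∈ Δ ∨ C.neg ∈ Δ) ∧
      ∀ B, C = all B → C ∈ Δ → ∃ t, B.subst (inst t) ∈ Δ := by
  by_cases hC : Derivable T (C :: Γ)
  · have hn : ¬ Derivable T (C.neg :: Γ) := fun h' => h (.cut C hC h')
    refine ⟨C.neg :: Γ, hn, List.subset_cons_self _ _, .inr (by simp), fun B _ hm => ?_⟩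
    -- The witness condition is vacuous here: if `C` also occurred, the sequent would be derivable
    -- by excluded middle.
    exact (hn (.excludedMiddle C hm (by simp))).elim
  · by_cases hB : ∃ B, C = all B
    · obtain ⟨B, rfl⟩ := hB
      obtain ⟨t, ht⟩ := not_derivable_witness hT List.mem_cons_self hC
      refine ⟨_, ht, fun _ hm => List.mem_cons_of_mem _ (List.mem_cons_of_mem _ hm),
        .inl (by simp), ?_⟩
      rintro _ ⟨⟩ -
      exact ⟨t, by simp⟩
    · exact ⟨C :: Γ, hC, List.subset_cons_self _ _, .inl (by simp),
        fun B hB' => (hB ⟨B, hB'⟩).elim⟩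

theorem exists_isHenkin [Countable P] (hT : ∀ A ∈ T, A.ClosedAt 0) {Γ : List (Fml P)}
    (h : ¬ Derivable T Γ) : ∃ S : Set (Fml P), IsHenkin T S ∧ ∀ A ∈ Γ, A ∈ S := by
  have : Nonempty (Fml P) := ⟨eq (var 0) (var 0)⟩
  obtain ⟨e, he⟩ := exists_surjective_nat (Fml P)
  choose! f hf1 hf2 hf3 hf4 using exists_henkin_step hT
  -- Stage `n` decides the `n`-th formula of the enumeration.
  let G : ℕ → List (Fml P) := fun n => Nat.rec Γ (fun n Δ => f Δ (e n)) n
  have hG (n : ℕ) : ¬ Derivable T (G n) := by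
    induction n with
    | zero => exact h
    | succ n ih => exact hf1 _ ih _
  have mono {m n : ℕ} (hmn : m ≤ n) : G m ⊆ G n := by
    induction hmn with
    | refl => exact List.Subset.refl _
    | step _ ih => exact List.Subset.trans ih (hf2 _ (hG _) _)
  have cons (Δ : List (Fml P)) (hΔ : ∀ A ∈ Δ, ∃ n, A ∈ G n) : ∃ n, Δ ⊆ G n := by
    induction Δ with
    | nil => exact ⟨0, by simp⟩
    | cons A Δ ih =>
      obtain ⟨m, hm⟩ := hΔ A (by simp)
      obtain ⟨n, hn⟩ := ih fun B hB => hΔ B (by simp [hB])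
      refine ⟨max m n, List.cons_subset.2 ⟨mono (le_max_left _ _) hm, ?_⟩⟩
      exact List.Subset.trans hn (mono (le_max_right _ _))
  have consistent (Δ : List (Fml P)) (hΔ : ∀ A ∈ Δ, ∃ n, A ∈ G n) : ¬ Derivable T Δ := by
    obtain ⟨n, hn⟩ := cons Δ hΔ
    exact fun hd => hG n (hd.weaken hn)
  refine ⟨{A | ∃ n, A ∈ G n}, ⟨consistent, fun A => ?_, fun A hA => ?_⟩, fun A hA => ⟨0, hA⟩⟩
  · obtain ⟨n, rfl⟩ := he A
    exact (hf3 _ (hG n) (e n)).imp (fun h => ⟨n + 1, h⟩) fun h => ⟨n + 1, h⟩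
  · obtain ⟨n, hn⟩ := he (all A)
    -- The formula was decided at its own stage. A decision for its negation would contradict
    -- consistency of the union, and the decision for the formula also provided the witness.
    have hmem : all A ∈ G (n + 1) := by
      rcases hf3 _ (hG n) (e n) with h' | h'
      · exact hn ▸ h'
      · refine (consistent [all A, (all A).neg] ?_
          (.excludedMiddle (all A) (by simp) (by simp))).elim
        simp only [List.mem_cons, List.not_mem_nil, or_false, forall_eq_or_imp, forall_eq]
        exact ⟨hA, n + 1, hn ▸ h'⟩
    obtain ⟨t, ht⟩ := hf4 _ (hG n) (e n) A hn (hn.symm ▸ hmem : e n ∈ G (n + 1))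
    exact ⟨t, n + 1, ht⟩

namespace IsHenkin

variable {S : Set (Fml P)} (hS : IsHenkin T S)
include hS

theorem neg_mem_iff (A : Fml P) : A.neg ∈ S ↔ A ∉ S := by
  refine ⟨fun h h' => ?_, fun h => (hS.complete A).resolve_left h⟩
  refine hS.consistent [A, A.neg] ?_ (.excludedMiddle A (by simp) (by simp))
  simp [h, h']

theorem eq_refl (t : Term) : eq t t ∉ S := fun h =>
  hS.consistent [eq t t] (by simpa using h) (.eqRefl (List.mem_singleton_self _))

/-- This is the rule `eqSubst` read contrapositively: formulas outside `S` are the true ones. -/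
theorem literal_congr {L : Fml P} (hL : L.IsLiteral) {t u : Term} (h : eq t u ∉ S)
    (ht : L.subst (inst t) ∉ S) : L.subst (inst u) ∉ S := by
  intro hu
  refine hS.consistent [ne t u, (L.subst (inst t)).neg, L.subst (inst u)] ?_
    (.eqSubst (s := u) (t := t) hL ?_ ?_ ?_)
  · have hn : ne t u ∈ S := (hS.neg_mem_iff (eq t u)).2 h
    simp [hu, (hS.neg_mem_iff _).2 ht, hn]
  all_goals simp

theorem eq_symm {t u : Term} (h : eq t u ∉ S) : eq u t ∉ S := by
  have := hS.literal_congr (L := eq (var 0) (t.lift 1)) trivial h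
  simp only [Fml.subst, Term.lift_subst_inst] at this
  exact this (hS.eq_refl t)

theorem eq_trans {t u w : Term} (h : eq t u ∉ S) (h' : eq u w ∉ S) : eq t w ∉ S := by
  have := hS.literal_congr (L := eq (t.lift 1) (var 0)) trivial h'
  simp only [Fml.subst, Term.lift_subst_inst] at this
  exact this h

theorem func_congr {n : ℕ} (f : EF n) {ts us : Fin n → Term} (h : ∀ j, eq (ts j) (us j) ∉ S) :
    eq (func f ts) (func f us) ∉ S := by
  -- The equality rule replaces one designated variable in a literal, so the arguments are exchanged
  -- one at a time; `m` counts those already exchanged.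
  have key (m : ℕ) : eq (func f ts) (func f fun j => if j.1 < m then us j else ts j) ∉ S := by
    induction m with
    | zero => simpa using hS.eq_refl _
    | succ m ih =>
      by_cases hm : m < n
      · let L : Fml P := eq ((func f ts).lift 1) (func f fun j =>
          if j.1 < m then (us j).lift 1 else if j.1 = m then var 0 else (ts j).lift 1)
        have e (w : Term) : L.subst (inst w) = eq (func f ts) (func f fun j =>
            if j.1 < m then us j else if j.1 = m then w else ts j) := by
          simp only [L, Fml.subst, Term.lift_subst_inst, Term.subst, Fml.eq.injEq, true_and,
            Term.func.injEq, heq_eq_eq]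
          funext j
          split_ifs <;> first | exact Term.lift_subst_inst _ _ | rfl
        have := hS.literal_congr (L := L) trivial (h ⟨m, hm⟩)
        rw [e, e] at this
        have e1 : (fun j : Fin n => if j.1 < m then us j else if j.1 = m then ts ⟨m, hm⟩ else ts j) =
            fun j => if j.1 < m then us j else ts j := by
          funext j
          split_ifs with h1 h2
          · rfl
          · rw [show j = ⟨m, hm⟩ from Fin.ext h2]
          · rfl
        have e2 : (fun j : Fin n => if j.1 < m then us j else if j.1 = m then us ⟨m, hm⟩ else ts j) =
            fun j => if j.1 < m + 1 then us j else ts j := by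
          funext j
          split_ifs with h1 h2 h3 h4 h5
          · rfl
          · omega
          · rw [show j = ⟨m, hm⟩ from Fin.ext h3]
          · omega
          · omega
          · rfl
        rw [e1, e2] at this
        exact this ih
      · have e : (fun j : Fin n => if j.1 < m + 1 then us j else ts j) =
            fun j => if j.1 < m then us j else ts j := by
          funext j
          have := j.2
          rw [if_pos (by omega), if_pos (by omega)]
        rwa [e]
  simpa using key n

def setoid : Setoid Term where
  r t u := eq t u ∉ S
  iseqv := ⟨hS.eq_refl, hS.eq_symm, hS.eq_trans⟩

/-- The term model. -/
abbrev Carrier : Type := Quotient hS.setoid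

def cls (t : Term) : hS.Carrier := Quotient.mk hS.setoid t

omit hS in
theorem cls_eq (hS : IsHenkin T S) {t u : Term} : hS.cls t = hS.cls u ↔ eq t u ∉ S :=
  Quotient.eq (r := hS.setoid)

theorem cls_out (x : hS.Carrier) : hS.cls x.out = x := Quotient.out_eq x

theorem eq_out_cls (t : Term) : eq (hS.cls t).out t ∉ S := hS.cls_eq.1 (hS.cls_out _)

noncomputable instance : AStr hS.Carrier where
  fn f v := hS.cls (func f fun j => (v j).out)
  lt x y := lt x.out y.out ∉ S

def interp (p : P) (x : hS.Carrier) : Prop := pr p x.out ∉ S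

theorem val_cls (s : ℕ → Term) (t : Term) :
    t.val (fun i => hS.cls (s i)) = hS.cls (t.subst s) := by
  induction t with
  | var i => rfl
  | func f ts ih =>
    simp only [Term.val, Term.subst, ih]
    exact hS.cls_eq.2 (hS.func_congr f fun j => hS.eq_out_cls _)

theorem lt_cls (t u : Term) : AStr.lt (hS.cls t) (hS.cls u) ↔ lt t u ∉ S := by
  have h (t t' u u' : Term) (h1 : eq t t' ∉ S) (h2 : eq u u' ∉ S) (h3 : lt t u ∉ S) :
      lt t' u' ∉ S := by
    have e1 := hS.literal_congr (L := lt (var 0) (u.lift 1)) trivial h1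
    have e2 := hS.literal_congr (L := lt (t'.lift 1) (var 0)) trivial h2
    simp only [Fml.subst, Term.lift_subst_inst] at e1 e2
    exact e2 (e1 h3)
  exact ⟨h _ _ _ _ (hS.eq_out_cls t) (hS.eq_out_cls u),
    h _ _ _ _ (hS.eq_symm (hS.eq_out_cls t)) (hS.eq_symm (hS.eq_out_cls u))⟩

theorem interp_cls (p : P) (t : Term) : hS.interp p (hS.cls t) ↔ pr p t ∉ S := by
  have h (t t' : Term) (h1 : eq t t' ∉ S) : pr p t ∉ S → pr p t' ∉ S :=
    hS.literal_congr (L := pr p (var 0)) trivial h1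
  exact ⟨h _ _ (hS.eq_out_cls t), h _ _ (hS.eq_symm (hS.eq_out_cls t))⟩

theorem and_mem_iff (A B : Fml P) : and A B ∈ S ↔ A ∈ S ∨ B ∈ S := by
  refine ⟨fun h => ?_, fun h => ?_⟩
  · by_contra! hn
    refine hS.consistent [and A B, A.neg, B.neg] ?_ (.and List.mem_cons_self (.excludedMiddle A ?_ ?_)
      (.excludedMiddle B ?_ ?_))
    · simp [h, (hS.neg_mem_iff _).2 hn.1, (hS.neg_mem_iff _).2 hn.2]
    all_goals simp
  · by_contra hn
    have hn' : or A.neg B.neg ∈ S := (hS.neg_mem_iff (and A B)).2 hn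
    rcases h with h | h
    · refine hS.consistent [or A.neg B.neg, A] (by simp [h, hn']) (.or List.mem_cons_self
        (.excludedMiddle A ?_ ?_)) <;> simp
    · refine hS.consistent [or A.neg B.neg, B] (by simp [h, hn']) (.or List.mem_cons_self
        (.excludedMiddle B ?_ ?_)) <;> simp

theorem or_mem_iff (A B : Fml P) : or A B ∈ S ↔ A ∈ S ∧ B ∈ S := by
  have h := hS.and_mem_iff A.neg B.neg
  have h' := hS.neg_mem_iff (or A B)
  rw [Fml.neg, h, hS.neg_mem_iff, hS.neg_mem_iff] at h'
  tauto

theorem ex_mem_iff (A : Fml P) : ex A ∈ S ↔ ∀ t, A.subst (inst t) ∈ S := by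
  refine ⟨fun h t => ?_, fun h => ?_⟩
  · by_contra hn
    refine hS.consistent [ex A, (A.subst (inst t)).neg] ?_
      (.ex t List.mem_cons_self (.excludedMiddle (A.subst (inst t)) ?_ ?_))
    · simp [h, (hS.neg_mem_iff _).2 hn]
    all_goals simp
  · by_contra hn
    obtain ⟨t, ht⟩ := hS.witness A.neg ((hS.neg_mem_iff (ex A)).2 hn)
    rw [← neg_subst, hS.neg_mem_iff] at ht
    exact ht (h t)

theorem all_mem_iff (A : Fml P) : all A ∈ S ↔ ∃ t, A.subst (inst t) ∈ S := by
  have h := hS.ex_mem_iff A.neg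
  have h' := hS.neg_mem_iff (all A)
  rw [Fml.neg, h] at h'
  simp only [← neg_subst, hS.neg_mem_iff] at h'
  rw [← not_iff_not, ← h', not_exists]

theorem vcons_cls (t : Term) (s : ℕ → Term) :
    vcons (hS.cls t) (fun i => hS.cls (s i)) = fun i => hS.cls (vcons t s i) := by
  funext i; cases i <;> rfl

/-- The truth lemma for the term model. It is stated for all substitutions `s` because assignments
into the model are classes of terms, and quantifiers extend `s`. -/
theorem sat_cls (A : Fml P) (s : ℕ → Term) :
    A.Sat hS.interp (fun i => hS.cls (s i)) ↔ A.subst s ∉ S := by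
  induction A generalizing s with
  | eq t u => simp only [Fml.Sat, Fml.subst, hS.val_cls, hS.cls_eq]
  | ne t u =>
    simp only [Fml.Sat, Fml.subst, hS.val_cls, ne_eq, hS.cls_eq]
    rw [not_iff_not]
    exact (hS.neg_mem_iff (eq _ _)).symm
  | lt t u => simp only [Fml.Sat, Fml.subst, hS.val_cls, hS.lt_cls]
  | nlt t u =>
    simp only [Fml.Sat, Fml.subst, hS.val_cls, hS.lt_cls]
    rw [not_iff_not]
    exact (hS.neg_mem_iff (lt _ _)).symm
  | pr p t => simp only [Fml.Sat, Fml.subst, hS.val_cls, hS.interp_cls]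
  | npr p t =>
    simp only [Fml.Sat, Fml.subst, hS.val_cls, hS.interp_cls]
    rw [not_iff_not]
    exact (hS.neg_mem_iff (pr _ _)).symm
  | and A B ha hb => simp only [Fml.Sat, Fml.subst, ha, hb, hS.and_mem_iff]; tauto
  | or A B ha hb => simp only [Fml.Sat, Fml.subst, ha, hb, hS.or_mem_iff]; tauto
  | all A ih =>
    simp only [Fml.Sat, Fml.subst, hS.all_mem_iff, subst_up_inst, not_exists]
    refine ⟨fun h t => (ih _).1 ((hS.vcons_cls t s) ▸ h (hS.cls t)), fun h x => ?_⟩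
    rw [← hS.cls_out x, hS.vcons_cls]
    exact (ih _).2 (h _)
  | ex A ih =>
    simp only [Fml.Sat, Fml.subst, hS.ex_mem_iff, subst_up_inst, not_forall]
    refine ⟨fun ⟨x, hx⟩ => ⟨x.out, ?_⟩, fun ⟨t, ht⟩ => ⟨hS.cls t, ?_⟩⟩
    · rw [← hS.cls_out x, hS.vcons_cls] at hx
      exact (ih _).1 hx
    · rw [hS.vcons_cls]
      exact (ih _).2 ht

end IsHenkin

/-- Completeness of the calculus: what holds in all models of `T` is provable from `T`. -/
theorem provable_of_models [Countable P] {A : Fml P}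
    (h : ∀ (M : Type) [AStr M] (R : P → M → Prop), (∀ B ∈ T, ∀ v, B.Sat R v) →
      ∀ v, A.Sat R v) : Provable T A := by
  -- Passing to the closures makes the axioms sentences, as the choice of fresh witnesses requires.
  refine Derivable.of_univClosures (by_contra fun hn => ?_)
  obtain ⟨S, hS, hA⟩ := exists_isHenkin univClosures_closedAt hn
  have hsat (B : Fml P) : B.Sat hS.interp (fun i => hS.cls (var i)) ↔ B ∉ S := by
    rw [hS.sat_cls, Fml.subst_var]
  refine (hsat A).1 (h hS.Carrier hS.interp (fun B hB v => ?_) _) (hA A (by simp))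
  obtain ⟨n, hn⟩ := B.exists_closedAt
  have hmem : allN n B ∈ univClosures T := ⟨B, hB, n, hn, rfl⟩
  refine sat_of_allN (n := n) (fun w => ?_) v
  -- A sentence has the same truth value under every assignment, in particular under the one sending
  -- each variable to its own class.
  rw [(allN_closedAt hn).sat_congr (w := fun i => hS.cls (var i)) (by simp), hsat]
  exact fun h' => hS.consistent [allN n B] (by simpa using h') (.axm hmem (by simp))

end WeakID

/-! ### Formula classes, models, and definable predicates. -/

namespace WeakID

open Term (var func)
open Fml

/-! ### Syntactic classes -/

namespace Fml

variable {P : Type}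

theorem IsBounded.subst {A : Fml P} (h : A.IsBounded) (s : ℕ → Term) : (A.subst s).IsBounded := by
  induction h generalizing s with
  | literal h => exact .literal (h.subst s)
  | and _ _ h1 h2 => exact .and (h1 s) (h2 s)
  | or _ _ h1 h2 => exact .or (h1 s) (h2 s)
  | @ball A t _ ih =>
    have e : (Fml.ball t A).subst s = Fml.ball (t.subst s) (A.subst (up s)) := by
      simp only [Fml.ball, Fml.subst, Term.lift_subst_up]; rfl
    exact e ▸ .ball _ (ih _)
  | @bex A t _ ih =>
    have e : (Fml.bex t A).subst s = Fml.bex (t.subst s) (A.subst (up s)) := by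
      simp only [Fml.bex, Fml.subst, Term.lift_subst_up]; rfl
    exact e ▸ .bex _ (ih _)

theorem InClass.subst {c : Side} {n : ℕ} {A : Fml P} (h : InClass c n A) (s : ℕ → Term) :
    InClass c n (A.subst s) := by
  induction h generalizing s with
  | bounded h => exact .bounded (h.subst s)
  | up _ ih => exact .up (ih s)
  | and _ _ h1 h2 => exact .and (h1 s) (h2 s)
  | or _ _ h1 h2 => exact .or (h1 s) (h2 s)
  | @ball c n A t _ ih =>
    have e : (Fml.ball t A).subst s = Fml.ball (t.subst s) (A.subst (WeakID.up s)) := by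
      simp only [Fml.ball, Fml.subst, Term.lift_subst_up]; rfl
    exact e ▸ .ball _ (ih _)
  | @bex c n A t _ ih =>
    have e : (Fml.bex t A).subst s = Fml.bex (t.subst s) (A.subst (WeakID.up s)) := by
      simp only [Fml.bex, Fml.subst, Term.lift_subst_up]; rfl
    exact e ▸ .bex _ (ih _)
  | all _ ih => exact .all (ih _)
  | ex _ ih => exact .ex (ih _)

def Side.swap : Side → Side
  | .pi => .sigma
  | .sigma => .pi

theorem InClass.neg {c : Side} {n : ℕ} {A : Fml P} (h : InClass c n A) :
    InClass c.swap n A.neg := by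
  induction h with
  | bounded h => exact .bounded h.neg
  | up _ ih => exact .up ih
  | and _ _ h1 h2 => exact .or h1 h2
  | or _ _ h1 h2 => exact .and h1 h2
  | ball t _ ih => exact .bex t ih
  | bex t _ ih => exact .ball t ih
  | all _ ih => exact .ex ih
  | ex _ ih => exact .all ih

theorem InClass.mono {c : Side} {m n : ℕ} {A : Fml P} (h : InClass c m A) (hmn : m ≤ n) :
    InClass c n A := by
  induction hmn with
  | refl => exact h
  | step _ ih => exact .up ih

end Fml

/-! ### Models of the theories -/

/-- A model of `Π⁰ₖ(Ω)-ID(Π⁰₁)` for some `k ≥ 1`. -/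
class WModel (M : Type) extends AStr M where
  R : PosPi1 → M → Prop
  k : ℕ
  one_le_k : 1 ≤ k
  ax : ∀ A ∈ PiID k, ∀ v, A.Sat R v

section model

variable {M : Type} [WModel M]

instance : Zero M := ⟨AStr.fn .zero ![]⟩
instance : Add M := ⟨fun x y => AStr.fn .add ![x, y]⟩
instance : Mul M := ⟨fun x y => AStr.fn .mul ![x, y]⟩
instance : LT M := ⟨AStr.lt⟩
instance : LE M := ⟨fun x y => x < y ∨ x = y⟩

def sc (x : M) : M := AStr.fn .succ ![x]

instance : One M := ⟨sc 0⟩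

/-- `2 ^ x`. -/
def pow2 (x : M) : M :=
  AStr.fn (.bprod (.comp .succ ![.comp .succ ![.comp .zero ![]]])) ![x]

theorem val_vec0 (v : ℕ → M) (ts : Fin 0 → Term) (a : Fin 0 → M) :
    (fun j => (ts j).val v) = a := by
  funext j; exact j.elim0

theorem val_vec1 (v : ℕ → M) (t : Term) : (fun j => (![t] j).val v) = ![t.val v] := by
  funext j; fin_cases j; rfl

theorem val_vec2 (v : ℕ → M) (s t : Term) :
    (fun j => (![s, t] j).val v) = ![s.val v, t.val v] := by
  funext j; fin_cases j <;> rfl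

theorem val_zero (v : ℕ → M) : Term.zero.val v = 0 := by
  rw [Term.zero, Term.val, val_vec0]; rfl

theorem val_sc (v : ℕ → M) (t : Term) : t.succ.val v = sc (t.val v) := by
  rw [Term.succ, Term.val, val_vec1]; rfl

theorem val_add (v : ℕ → M) (s t : Term) : (s.add t).val v = s.val v + t.val v := by
  rw [Term.add, Term.val, val_vec2]; rfl

theorem val_mul (v : ℕ → M) (s t : Term) : (s.mul t).val v = s.val v * t.val v := by
  rw [Term.mul, Term.val, val_vec2]; rfl

theorem val_pow2 (v : ℕ → M) (t : Term) : t.pow2.val v = pow2 (t.val v) := by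
  rw [Term.pow2, Term.val, val_vec1]; rfl

/-! ### Definable predicates -/

/-- The value of a term, as a function of the variables. -/
class TF (f : (ℕ → M) → M) : Prop where
  out : ∃ t : Term, ∀ v, t.val v = f v

/-- A predicate defined by a bounded formula. -/
class D0 (p : (ℕ → M) → Prop) : Prop where
  out : ∃ A : Fml PosPi1, A.IsBounded ∧ ∀ v, A.Sat WModel.R v ↔ p v

/-- A predicate defined by a formula of the class. -/
def Def (c : Side) (n : ℕ) (p : (ℕ → M) → Prop) : Prop :=
  ∃ A : Fml PosPi1, InClass c n A ∧ ∀ v, A.Sat WModel.R v ↔ p v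

section closure

variable {f g h : (ℕ → M) → M}

/-- The closure properties of `TF` and `D0` are instances so that the defining term or bounded
formula is assembled from the shape of the predicate. -/
instance TF.var (i : ℕ) : TF (fun v : ℕ → M => v i) := ⟨.var i, fun _ => rfl⟩

instance TF.zero : TF (fun _ : ℕ → M => 0) := ⟨.zero, fun v => val_zero v⟩

instance TF.sc [hf : TF f] : TF (fun v => sc (f v)) := by
  obtain ⟨t, ht⟩ := hf
  exact ⟨t.succ, fun v => by rw [val_sc, ht]⟩

instance TF.one : TF (fun _ : ℕ → M => 1) := TF.sc

instance TF.add [hf : TF f] [hg : TF g] : TF (fun v => f v + g v) := by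
  obtain ⟨t, ht⟩ := hf
  obtain ⟨u, hu⟩ := hg
  exact ⟨t.add u, fun v => by rw [val_add, ht, hu]⟩

instance TF.mul [hf : TF f] [hg : TF g] : TF (fun v => f v * g v) := by
  obtain ⟨t, ht⟩ := hf
  obtain ⟨u, hu⟩ := hg
  exact ⟨t.mul u, fun v => by rw [val_mul, ht, hu]⟩

instance TF.pow2 [hf : TF f] : TF (fun v => pow2 (f v)) := by
  obtain ⟨t, ht⟩ := hf
  exact ⟨t.pow2, fun v => by rw [val_pow2, ht]⟩

variable {p q : (ℕ → M) → Prop}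

instance D0.eq [hf : TF f] [hg : TF g] : D0 (fun v => f v = g v) := by
  obtain ⟨t, ht⟩ := hf
  obtain ⟨u, hu⟩ := hg
  exact ⟨.eq t u, .literal trivial, fun v => by simp only [Fml.Sat, ht, hu]⟩

instance D0.lt [hf : TF f] [hg : TF g] : D0 (fun v => f v < g v) := by
  obtain ⟨t, ht⟩ := hf
  obtain ⟨u, hu⟩ := hg
  exact ⟨.lt t u, .literal trivial, fun v => by simp only [Fml.Sat, ht, hu]; rfl⟩

theorem D0.pr (r : PosPi1) [hf : TF f] : D0 (fun v => WModel.R r (f v)) := by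
  obtain ⟨t, ht⟩ := hf
  exact ⟨.pr r t, .literal trivial, fun v => by simp only [Fml.Sat, ht]⟩

instance D0.and [hp : D0 p] [hq : D0 q] : D0 (fun v => p v ∧ q v) := by
  obtain ⟨A, hA, hA'⟩ := hp
  obtain ⟨B, hB, hB'⟩ := hq
  exact ⟨.and A B, .and hA hB, fun v => by simp only [Fml.Sat, hA', hB']⟩

instance D0.or [hp : D0 p] [hq : D0 q] : D0 (fun v => p v ∨ q v) := by
  obtain ⟨A, hA, hA'⟩ := hp
  obtain ⟨B, hB, hB'⟩ := hq
  exact ⟨.or A B, .or hA hB, fun v => by simp only [Fml.Sat, hA', hB']⟩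

instance D0.not [hp : D0 p] : D0 (fun v => ¬ p v) := by
  obtain ⟨A, hA, hA'⟩ := hp
  exact ⟨A.neg, hA.neg, fun v => by rw [sat_neg, hA']⟩

instance D0.imp [hp : D0 p] [hq : D0 q] : D0 (fun v => p v → q v) := by
  obtain ⟨A, hA, hA'⟩ := hp
  obtain ⟨B, hB, hB'⟩ := hq
  exact ⟨.or A.neg B, .or hA.neg hB, fun v => by simp only [Fml.Sat, sat_neg, hA', hB']; tauto⟩

instance D0.iff [D0 p] [D0 q] : D0 (fun v => p v ↔ q v) := by
  simp only [iff_iff_implies_and_implies]; infer_instance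

instance D0.le [TF f] [TF g] : D0 (fun v => f v ≤ g v) :=
  inferInstanceAs (D0 (fun v => f v < g v ∨ f v = g v))

theorem sat_ball {P : Type} {R : P → M → Prop} (t : Term) (A : Fml P) (v : ℕ → M) :
    (ball t A).Sat R v ↔ ∀ x, x < t.val v → A.Sat R (vcons x v) := by
  simp only [ball, Fml.Sat, val_lift]
  exact forall_congr' fun x => (imp_iff_not_or (a := x < t.val v)).symm

theorem sat_bex {P : Type} {R : P → M → Prop} (t : Term) (A : Fml P) (v : ℕ → M) :
    (bex t A).Sat R v ↔ ∃ x, x < t.val v ∧ A.Sat R (vcons x v) := by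
  simp only [bex, Fml.Sat, val_lift]; rfl

variable {r : (ℕ → M) → M → Prop}

/-- In `r` the bound variable comes first in the assignment and the parameters are shifted by one,
as for de Bruijn indices. -/
instance D0.ball [hf : TF f] [hr : D0 (fun v => r (fun i => v (i + 1)) (v 0))] :
    D0 (fun v => ∀ x, x < f v → r v x) := by
  obtain ⟨t, ht⟩ := hf
  obtain ⟨A, hA, hA'⟩ := hr
  exact ⟨.ball t A, .ball t hA, fun v => by simp only [sat_ball, hA', ht]; rfl⟩

instance D0.bex [hf : TF f] [hr : D0 (fun v => r (fun i => v (i + 1)) (v 0))] :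
    D0 (fun v => ∃ x, x < f v ∧ r v x) := by
  obtain ⟨t, ht⟩ := hf
  obtain ⟨A, hA, hA'⟩ := hr
  exact ⟨.bex t A, .bex t hA, fun v => by simp only [sat_bex, hA', ht]; rfl⟩

theorem TF.exists_terms {s : ℕ → (ℕ → M) → M} (hs : ∀ i, TF (s i)) :
    ∃ σ : ℕ → Term, ∀ v, (fun i => (σ i).val v) = fun i => s i v := by
  choose σ hσ using fun i => (hs i).out
  exact ⟨σ, fun v => funext fun i => hσ i v⟩

theorem D0.comp (hp : D0 p) {s : ℕ → (ℕ → M) → M} (hs : ∀ i, TF (s i)) :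
    D0 (fun v => p (fun i => s i v)) := by
  obtain ⟨A, hA, hA'⟩ := hp
  obtain ⟨σ, hσ⟩ := TF.exists_terms hs
  exact ⟨A.subst σ, hA.subst σ, fun v => by rw [sat_subst, hσ, hA']⟩

theorem TF.vcons {s : ℕ → (ℕ → M) → M} (hf : TF f) (hs : ∀ i, TF (s i)) (i : ℕ) :
    TF (fun v => vcons (f v) (fun i => s i v) i) := by
  cases i
  · exact hf
  · exact hs _

theorem D0.comp1 {p : M → Prop} (hp : D0 (fun v => p (v 0))) (hf : TF f) :
    D0 (fun v => p (f v)) :=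
  hp.comp (s := fun _ => f) fun _ => hf

theorem D0.comp2 {p : M → M → Prop} (hp : D0 (fun v => p (v 0) (v 1))) (hf : TF f) (hg : TF g) :
    D0 (fun v => p (f v) (g v)) :=
  hp.comp (TF.vcons hf (s := fun _ => g) fun _ => hg)

theorem Def.comp {c : Side} {n : ℕ} (hp : Def c n p) {s : ℕ → (ℕ → M) → M} (hs : ∀ i, TF (s i)) :
    Def c n (fun v => p (fun i => s i v)) := by
  obtain ⟨A, hA, hA'⟩ := hp
  obtain ⟨σ, hσ⟩ := TF.exists_terms hs
  exact ⟨A.subst σ, hA.subst σ, fun v => by rw [sat_subst, hσ, hA']⟩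

theorem Def.of_D0 (hp : D0 p) (c : Side) (n : ℕ) : Def c n p := by
  obtain ⟨A, hA, hA'⟩ := hp
  exact ⟨A, (InClass.bounded hA).mono (Nat.zero_le n), hA'⟩

theorem Def.up {c : Side} {n : ℕ} (hp : Def c n p) (d : Side) : Def d (n + 1) p := by
  obtain ⟨A, hA, hA'⟩ := hp
  exact ⟨A, .up hA, hA'⟩

theorem Def.imp {n : ℕ} (hp : Def .sigma n p) (hq : Def .pi n q) :
    Def .pi n (fun v => p v → q v) := by
  obtain ⟨A, hA, hA'⟩ := hp
  obtain ⟨B, hB, hB'⟩ := hq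
  exact ⟨.or A.neg B, .or hA.neg hB, fun v => by simp only [Fml.Sat, sat_neg, hA', hB']; tauto⟩

theorem Def.all {n : ℕ} (hr : Def .pi (n + 1) (fun v => r (fun i => v (i + 1)) (v 0))) :
    Def .pi (n + 1) (fun v => ∀ x, r v x) := by
  obtain ⟨A, hA, hA'⟩ := hr
  exact ⟨.all A, .all hA, fun v => by simp only [Fml.Sat, hA']; rfl⟩

end closure

/-! ### Induction -/

theorem WModel.basic {A : Fml PosPi1} (h : BasicAx PosPi1 A) (v : ℕ → M) : A.Sat WModel.R v :=
  WModel.ax A (.inl (.inl (.inl (.inl h)))) v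

theorem Def.ind {p : (ℕ → M) → Prop} {n : ℕ} (hp : Def .pi n p) (hn : n ≤ WModel.k M)
    (v : ℕ → M) (h0 : p (vcons 0 v)) (hs : ∀ x, p (vcons x v) → p (vcons (sc x) v)) (x : M) :
    p (vcons x v) := by
  obtain ⟨A, hA, hA'⟩ := hp
  have h := WModel.ax (M := M) (indAx A) (.inl (.inl (.inr ⟨A, hA.mono hn, rfl⟩))) v
  have e (x : M) : (fun i => (vcons (var 0).succ (fun j => var (j + 1)) i).val (vcons x v)) =
      vcons (sc x) v := by
    funext i
    cases i with
    | zero => exact val_sc _ _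
    | succ i => rfl
  simp only [indAx, sat_imp, Fml.Sat, sat_subst, val_inst, val_zero, e, hA'] at h
  exact h ⟨h0, hs⟩ x

/-- Bounded formulas may mention the predicates `R_φ`, so this rests on the induction schema for
`Π⁰ₖ(Ω)` and not on the one contained in `EA`. -/
theorem D0.ind {p : (ℕ → M) → Prop} (hp : D0 p) (v : ℕ → M) (h0 : p (vcons 0 v))
    (hs : ∀ x, p (vcons x v) → p (vcons (sc x) v)) (x : M) : p (vcons x v) :=
  (Def.of_D0 hp .pi 0).ind (Nat.zero_le _) v h0 hs x

end model

end WeakID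

/-! ### The ordered semiring of a model. -/

namespace WeakID

open Term (var func)
open Fml

/-! ### Arithmetic in a model -/

section arith

variable {M : Type} [WModel M]

theorem sc_ne_zero (x : M) : sc x ≠ 0 := by
  have h := WModel.basic .succ_ne_zero (fun _ => x)
  simpa only [Fml.Sat, val_sc, val_zero, Term.val] using h

theorem not_lt_zero' (x : M) : ¬ x < 0 := by
  have h := WModel.basic .not_lt_zero (fun _ => x)
  simp only [Fml.Sat, val_zero, Term.val] at h
  exact h

theorem lt_sc {x y : M} : x < sc y ↔ x < y ∨ x = y := by
  have h := WModel.basic .lt_succ (vcons x fun _ => y)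
  simp only [sat_iff, Fml.Sat, val_sc, Term.val, vcons] at h
  exact h

theorem add_zero' (x : M) : x + 0 = x := by
  have h := WModel.basic .add_zero (fun _ => x)
  simpa only [Fml.Sat, val_add, val_zero, Term.val] using h

theorem add_sc (x y : M) : x + sc y = sc (x + y) := by
  have h := WModel.basic .add_succ (vcons x fun _ => y)
  simpa only [Fml.Sat, val_add, val_sc, Term.val, vcons] using h

theorem mul_zero' (x : M) : x * 0 = 0 := by
  have h := WModel.basic .mul_zero (fun _ => x)
  simpa only [Fml.Sat, val_mul, val_zero, Term.val] using h

theorem mul_sc (x y : M) : x * sc y = x * y + x := by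
  have h := WModel.basic .mul_succ (vcons x fun _ => y)
  simpa only [Fml.Sat, val_mul, val_add, val_sc, Term.val, vcons] using h

theorem sc_eq (x : M) : sc x = x + 1 := by
  rw [show (1 : M) = sc 0 from rfl, add_sc, add_zero']

/-- Induction for predicates defined by bounded formulas, with parameters `v`. -/
theorem D0.induction {p : (ℕ → M) → Prop} (hp : D0 p) (v : ℕ → M) (h0 : p (vcons 0 v))
    (hs : ∀ x, p (vcons x v) → p (vcons (x + 1) v)) (x : M) : p (vcons x v) :=
  hp.ind v h0 (fun x hx => sc_eq x ▸ hs x hx) x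

theorem fn_comp {m n : ℕ} (f : EF m) (g : Fin m → EF n) (a : Fin n → M) :
    AStr.fn (.comp f g) a = AStr.fn f (fun j => AStr.fn (g j) a) := by
  have h := WModel.basic (.comp f g) (fun i => if hi : i < n then a ⟨i, hi⟩ else 0)
  simpa only [Fml.Sat, Term.val, Fin.is_lt, dite_true, Fin.eta] using h

theorem pow2_zero : pow2 (0 : M) = 1 := by
  let f : EF 1 := .comp .succ ![.comp .succ ![.comp .zero ![]]]
  have h := WModel.basic (.bprod_zero (n := 0) f) (fun _ => (0 : M))
  have e : (fun j => Term.val (fun _ => (0 : M))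
      ((Fin.cons Term.zero (fun j : Fin 0 => var (j + 1)) : Fin 1 → Term) j)) = ![0] := by
    funext j
    fin_cases j
    exact val_zero _
  rw [Fml.Sat, Term.val, e, val_sc, val_zero] at h
  exact h

/-- The factor of the bounded product is the constant function `2`, evaluated through the defining
axioms of composition. -/
theorem pow2_succ (x : M) : pow2 (x + 1) = pow2 x * (1 + 1) := by
  let f : EF 1 := .comp .succ ![.comp .succ ![.comp .zero ![]]]
  have h := WModel.basic (.bprod_succ (n := 0) f) (fun _ => x)
  have e (t : Term) : (fun j => Term.val (fun _ => x)
      ((Fin.cons t (fun j : Fin 0 => var (j + 1)) : Fin 1 → Term) j)) =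
        ![t.val (fun _ => x)] := by
    funext j
    fin_cases j
    rfl
  have e1 (n : ℕ) (a : Fin n → M) (g : EF n) :
      (fun j => AStr.fn ((![g] : Fin 1 → EF n) j) a) = ![AStr.fn g a] := by
    funext j
    fin_cases j
    rfl
  have e0 (n : ℕ) (a : Fin n → M) : AStr.fn (.comp .zero ![]) a = 0 := by
    rw [fn_comp]
    exact congrArg (AStr.fn EF.zero) (funext fun j => j.elim0)
  have hf : AStr.fn f ![x] = 1 + 1 := by
    rw [fn_comp, e1, fn_comp, e1, e0, ← sc_eq]
    rfl
  rw [Fml.Sat, val_mul, Term.val, Term.val, Term.val, e, e, val_sc] at h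
  rw [← sc_eq, ← hf]
  exact h

theorem add_one_add (x y : M) : x + 1 + y = x + y + 1 := by
  refine D0.induction (p := fun v => v 1 + 1 + v 0 = v 1 + v 0 + 1) inferInstance
    (fun _ => x) ?_ (fun y hy => ?_) y
  · simp only [vcons, add_zero']
  · simp only [vcons] at hy ⊢
    rw [← sc_eq y, add_sc, add_sc, hy, sc_eq, sc_eq]

instance : CommSemiring M :=
  have zero_add (x : M) : 0 + x = x := by
    refine D0.induction (p := fun v => 0 + v 0 = v 0) inferInstance (fun _ => x) ?_
      (fun y hy => ?_) x
    · exact add_zero' _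
    · simp only [vcons] at hy ⊢
      rw [← sc_eq, add_sc, hy]
  have add_comm (x y : M) : x + y = y + x := by
    refine D0.induction (p := fun v => v 1 + v 0 = v 0 + v 1) inferInstance (fun _ => x) ?_
      (fun y hy => ?_) y
    · simp only [vcons, add_zero', zero_add]
    · simp only [vcons] at hy ⊢
      rw [← sc_eq, add_sc, hy, sc_eq, sc_eq, add_one_add]
  have add_assoc (x y z : M) : x + y + z = x + (y + z) := by
    refine D0.induction (p := fun v => v 1 + v 2 + v 0 = v 1 + (v 2 + v 0)) inferInstance
      (vcons x fun _ => y) ?_ (fun z hz => ?_) z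
    · simp only [vcons, add_zero']
    · simp only [vcons] at hz ⊢
      rw [← sc_eq, add_sc, add_sc, add_sc, hz]
  have zero_mul (x : M) : 0 * x = 0 := by
    refine D0.induction (p := fun v => 0 * v 0 = 0) inferInstance (fun _ => x) ?_
      (fun y hy => ?_) x
    · exact mul_zero' _
    · simp only [vcons] at hy ⊢
      rw [← sc_eq, mul_sc, hy, add_zero']
  have succ_mul (x y : M) : (x + 1) * y = x * y + y := by
    refine D0.induction (p := fun v => (v 1 + 1) * v 0 = v 1 * v 0 + v 0) inferInstance
      (fun _ => x) ?_ (fun y hy => ?_) y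
    · simp only [vcons, mul_zero', add_zero']
    · simp only [vcons] at hy ⊢
      rw [← sc_eq y, mul_sc, mul_sc, hy, sc_eq, ← add_assoc, ← add_assoc, add_assoc (x * y) y x,
        add_comm y x, add_assoc (x * y) x y]
  have mul_comm (x y : M) : x * y = y * x := by
    refine D0.induction (p := fun v => v 1 * v 0 = v 0 * v 1) inferInstance (fun _ => x) ?_
      (fun y hy => ?_) y
    · simp only [vcons, mul_zero', zero_mul]
    · simp only [vcons] at hy ⊢
      rw [succ_mul, ← sc_eq, mul_sc, hy]
  have mul_add (x y z : M) : x * (y + z) = x * y + x * z := by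
    refine D0.induction (p := fun v => v 1 * (v 2 + v 0) = v 1 * v 2 + v 1 * v 0) inferInstance
      (vcons x fun _ => y) ?_ (fun z hz => ?_) z
    · simp only [vcons, mul_zero', add_zero']
    · simp only [vcons] at hz ⊢
      rw [← sc_eq, add_sc, mul_sc, mul_sc, hz, add_assoc]
  have mul_assoc (x y z : M) : x * y * z = x * (y * z) := by
    refine D0.induction (p := fun v => v 1 * v 2 * v 0 = v 1 * (v 2 * v 0)) inferInstance
      (vcons x fun _ => y) ?_ (fun z hz => ?_) z
    · simp only [vcons, mul_zero']
    · simp only [vcons] at hz ⊢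
      rw [← sc_eq, mul_sc, mul_sc, hz, mul_add]
  have mul_one (x : M) : x * 1 = x := by
    rw [show (1 : M) = sc 0 from rfl, mul_sc, mul_zero', zero_add]
  { add_assoc := add_assoc
    zero_add := zero_add
    add_zero := add_zero'
    add_comm := add_comm
    nsmul := nsmulRec
    mul_assoc := mul_assoc
    mul_comm := mul_comm
    one_mul := fun x => (mul_comm _ _).trans (mul_one x)
    mul_one := mul_one
    left_distrib := mul_add
    right_distrib := fun x y z => by rw [mul_comm, mul_add, mul_comm z x, mul_comm z y]
    zero_mul := zero_mul
    mul_zero := mul_zero' }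

theorem lt_add_one_iff' {x y : M} : x < y + 1 ↔ x ≤ y := by
  rw [← sc_eq]; exact lt_sc

theorem lt_trans' {x y z : M} (h : x < y) (h' : y < z) : x < z := by
  refine D0.induction (p := fun v => v 2 < v 0 → v 1 < v 0) inferInstance (vcons x fun _ => y)
    (fun h => (not_lt_zero' _ h).elim) (fun z ih hz => ?_) z h'
  simp only [vcons] at ih hz ⊢
  rw [lt_add_one_iff'] at hz ⊢
  rcases hz with hz | hz
  · exact .inl (ih hz)
  · exact .inl (hz ▸ h)

theorem lt_irrefl' (x : M) : ¬ x < x := by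
  refine D0.induction (p := fun v => ¬ v 0 < v 0) inferInstance (fun _ => x) (not_lt_zero' _)
    (fun x ih hx => ih ?_) x
  simp only [vcons] at hx ⊢
  have h1 : x < x + 1 := lt_add_one_iff'.2 (.inr rfl)
  rcases lt_add_one_iff'.1 hx with h | h
  · exact lt_trans' h1 h
  · rwa [h] at h1

theorem zero_le' (x : M) : 0 ≤ x := by
  refine D0.induction (p := fun v => 0 ≤ v 0) inferInstance (fun _ => x) (Or.inr rfl)
    (fun x ih => Or.inl (lt_add_one_iff'.2 ih)) x

theorem add_one_le_iff' {x y : M} : x + 1 ≤ y ↔ x < y := by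
  constructor
  · have h1 : x < x + 1 := lt_add_one_iff'.2 (.inr rfl)
    rintro (h | rfl)
    · exact lt_trans' h1 h
    · exact h1
  · refine D0.induction (p := fun v => v 1 < v 0 → v 1 + 1 ≤ v 0) inferInstance (fun _ => x)
      (fun h => (not_lt_zero' _ h).elim) (fun y ih h => ?_) y
    simp only [vcons] at ih h ⊢
    rcases lt_add_one_iff'.1 h with h | h
    · exact .inl (lt_add_one_iff'.2 (ih h))
    · exact .inr (by rw [h])

theorem le_total' (x y : M) : x ≤ y ∨ y ≤ x := by
  refine D0.induction (p := fun v => v 1 ≤ v 0 ∨ v 0 ≤ v 1) inferInstance (fun _ => x)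
    (.inr (zero_le' x)) (fun y ih => ?_) y
  simp only [vcons] at ih ⊢
  have h1 : y < y + 1 := lt_add_one_iff'.2 (.inr rfl)
  rcases ih with (h | rfl) | h | rfl
  · exact .inl (.inl (lt_trans' h h1))
  · exact .inl (.inl h1)
  · exact .inr (add_one_le_iff'.2 h)
  · exact .inl (.inl h1)

open Classical in
noncomputable instance : LinearOrder M where
  le_refl _ := .inr rfl
  le_trans := by
    rintro x y z (h | rfl) (h' | rfl)
    · exact .inl (lt_trans' h h')
    · exact .inl h
    · exact .inl h'
    · exact .inr rfl
  lt_iff_le_not_ge x y := by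
    constructor
    · refine fun h => ⟨.inl h, ?_⟩
      rintro (h' | rfl)
      · exact lt_irrefl' _ (lt_trans' h h')
      · exact lt_irrefl' _ h
    · rintro ⟨h | rfl, h'⟩
      · exact h
      · exact (h' (.inr rfl)).elim
  le_antisymm := by
    rintro x y (h | rfl) (h' | h')
    · exact (lt_irrefl' _ (lt_trans' h h')).elim
    · exact h'.symm
    · rfl
    · rfl
  le_total := le_total'
  toDecidableLE := Classical.decRel _

theorem add_lt_add_right' {x y : M} (h : x < y) (z : M) : x + z < y + z := by
  refine D0.induction (p := fun v => v 1 + v 0 < v 2 + v 0) inferInstance (vcons x fun _ => y)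
    ?_ (fun z ih => ?_) z
  · simpa only [vcons, add_zero] using h
  · simp only [vcons] at ih ⊢
    rw [← add_assoc, ← add_assoc, lt_add_one_iff', add_one_le_iff']
    exact ih

theorem mul_lt_mul_right' {x y z : M} (h : x < y) (hz : 0 < z) : x * z < y * z := by
  -- The strict inequality fails at `z = 0`. This stronger form of it for positive `z` holds for
  -- every `z` and can be proved by induction.
  have key : x * z + z ≤ y * z := by
    refine D0.induction (p := fun v => v 1 * v 0 + v 0 ≤ v 2 * v 0) inferInstance
      (vcons x fun _ => y) ?_ (fun z ih => ?_) z
    · simp only [vcons, mul_zero, add_zero, le_refl]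
    · simp only [vcons] at ih ⊢
      rcases add_one_le_iff'.2 h with h1 | h1
      · have h2 := add_lt_add_right' h1 (x * z + z)
        rw [add_comm y] at h2
        rcases ih with ih | ih
        · refine .inl (lt_of_eq_of_lt ?_ (lt_of_lt_of_eq (lt_trans' h2
            (add_lt_add_right' ih y)) ?_)) <;> ring
        · rw [ih] at h2
          refine .inl (lt_of_eq_of_lt ?_ (lt_of_lt_of_eq (add_lt_add_right' h1 (x * z + z)) ?_))
          · ring
          · rw [ih]; ring
      · rw [← h1] at ih ⊢
        exact .inr (by ring)
  refine lt_of_lt_of_le ?_ key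
  have := add_lt_add_right' hz (x * z)
  rwa [zero_add, add_comm] at this

instance : IsStrictOrderedRing M where
  add_le_add_left := by
    rintro x y (h | rfl) z
    · exact .inl (add_lt_add_right' h z)
    · exact .inr rfl
  le_of_add_le_add_left x y z h := by
    by_contra! hn
    have := add_lt_add_right' hn x
    rw [add_comm z, add_comm y] at this
    exact absurd h (not_le.2 this)
  exists_pair_ne := ⟨1, 0, sc_ne_zero 0⟩
  zero_le_one := zero_le' 1
  mul_lt_mul_of_pos_left := by
    intro x hx y z h
    simp only [mul_comm x]
    exact mul_lt_mul_right' h hx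
  mul_lt_mul_of_pos_right _ hx _ _ h := mul_lt_mul_right' h hx

theorem exists_add_of_le' {x y : M} (h : x ≤ y) : ∃ z, y = x + z := by
  -- The bound on the difference keeps the induction formula bounded.
  have key : ∃ z, z < y + 1 ∧ (x ≤ y → y = x + z) := by
    refine D0.induction (p := fun v => ∃ z, z < v 0 + 1 ∧ (v 1 ≤ v 0 → v 0 = v 1 + z))
      inferInstance (fun _ => x) ⟨0, ?_, fun h => ?_⟩ (fun y ih => ?_) y
    · exact lt_add_one_iff'.2 (le_refl _)
    · simp only [vcons] at h ⊢
      rw [add_zero]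
      exact le_antisymm (zero_le' _) h
    · simp only [vcons] at ih ⊢
      obtain ⟨z, hz, h⟩ := ih
      by_cases hx : x ≤ y
      · refine ⟨z + 1, add_lt_add_right' hz 1, fun _ => ?_⟩
        rw [← add_assoc, ← h hx]
      · refine ⟨0, lt_add_one_iff'.2 (zero_le' _), fun h' => ?_⟩
        rw [add_zero]
        exact le_antisymm (add_one_le_iff'.2 (not_le.1 hx)) h'
  obtain ⟨z, -, hz⟩ := key
  exact ⟨z, hz h⟩

instance : CanonicallyOrderedAdd M where
  exists_add_of_le := exists_add_of_le'
  le_add_self x y := by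
    have := add_le_add_left (zero_le' y) x
    rwa [zero_add] at this
  le_self_add x y := by
    have := add_le_add_left (zero_le' y) x
    rwa [zero_add, add_comm] at this

end arith

end WeakID

/-! ### Pairing, binary digits and recursion. -/

namespace WeakID

open Term (var func)
open Fml

section bits

variable {M : Type} [WModel M]

theorem le_of_eq_add {x y : M} (z : M) (h : y = x + z) : x ≤ y := h ▸ le_self_add

theorem lt_of_eq_add {x y : M} (z : M) (h : y = x + z + 1) : x < y :=
  h ▸ lt_add_one_iff'.2 le_self_add

theorem exists_add_of_lt' {x y : M} (h : x < y) : ∃ z, y = x + z + 1 := by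
  obtain ⟨z, hz⟩ := exists_add_of_le' (add_one_le_iff'.2 h)
  exact ⟨z, hz.trans (by ring)⟩

/-! ### Strong induction -/

theorem D0.strongInduction {p : (ℕ → M) → Prop} (hp : D0 p) (v : ℕ → M)
    (hs : ∀ x, (∀ y, y < x → p (vcons y v)) → p (vcons x v)) (x : M) : p (vcons x v) := by
  have hq : D0 (fun v => ∀ y, y < v 0 → p (vcons y fun i => v (i + 1))) := by
    refine @D0.ball _ _ _ (fun v y => p (vcons y fun i => v (i + 1))) _ ?_
    exact hp.comp (TF.vcons (s := fun i v => v (i + 2)) (TF.var 0) fun i => TF.var (i + 2))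
  refine hs x ?_
  refine hq.induction v (fun y hy => (not_lt_zero' _ hy).elim) (fun x ih y hy => ?_) x
  rcases lt_add_one_iff'.1 hy with h | h
  · exact ih y h
  · rw [show y = x from h]
    exact hs x ih

/-- Strong induction for `Π⁰₁(Ω)`-predicates. -/
theorem Def.strongInduction {p : (ℕ → M) → Prop} (hp : Def .pi 1 p) (v : ℕ → M)
    (hs : ∀ x, (∀ y, y < x → p (vcons y v)) → p (vcons x v)) (x : M) : p (vcons x v) := by
  -- The universal quantifier on `y` does not leave `Π⁰₁(Ω)`, and induction for this class is
  -- available because `k ≥ 1`.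
  have hq : Def .pi 1 (fun v => ∀ y, y < v 0 → p (vcons y fun i => v (i + 1))) := by
    refine Def.all (r := fun v y => y < v 0 → p (vcons y fun i => v (i + 1)))
      (Def.imp (Def.of_D0 inferInstance _ _) ?_)
    exact hp.comp (TF.vcons (s := fun i v => v (i + 2)) (TF.var 0) fun i => TF.var (i + 2))
  refine hs x ?_
  refine hq.ind WModel.one_le_k v (fun y hy => (not_lt_zero' _ hy).elim) (fun x ih y hy => ?_) x
  rw [vcons_zero, sc_eq] at hy
  rcases lt_add_one_iff'.1 hy with h | h
  · exact ih y h
  · rw [show y = x from h]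
    exact hs x ih

instance D0.ball_le {f : (ℕ → M) → M} {r : (ℕ → M) → M → Prop} [TF f]
    [D0 (fun v => r (fun i => v (i + 1)) (v 0))] : D0 (fun v => ∀ x, x ≤ f v → r v x) := by
  simp only [← lt_add_one_iff']; infer_instance

instance D0.bex_le {f : (ℕ → M) → M} {r : (ℕ → M) → M → Prop} [TF f]
    [D0 (fun v => r (fun i => v (i + 1)) (v 0))] : D0 (fun v => ∃ x, x ≤ f v ∧ r v x) := by
  simp only [← lt_add_one_iff']; infer_instance

/-! ### Pairs and codes -/

def pr2 (x y : M) : M := (x + y) * (x + y) + x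

def cs (a b r : M) : M := pr2 a (pr2 b r) + 1

instance TF.pr2 {f g : (ℕ → M) → M} [TF f] [TF g] : TF (fun v => pr2 (f v) (g v)) :=
  inferInstanceAs (TF (fun v => (f v + g v) * (f v + g v) + f v))

instance TF.cs {f g h : (ℕ → M) → M} [TF f] [TF g] [TF h] : TF (fun v => cs (f v) (g v) (h v)) :=
  inferInstanceAs (TF (fun v => WeakID.pr2 (f v) (WeakID.pr2 (g v) (h v)) + 1))

theorem le_sq (x : M) : x ≤ x * x := by
  rcases eq_or_lt_of_le (zero_le' x) with rfl | h
  · rw [mul_zero]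
  · obtain ⟨z, rfl⟩ := exists_add_of_lt' h
    exact le_of_eq_add (z * (0 + z + 1)) (by ring)

theorem le_pr2_left (x y : M) : x ≤ pr2 x y := le_add_self

theorem le_pr2_right (x y : M) : y ≤ pr2 x y :=
  (le_add_self.trans (le_sq (x + y))).trans le_self_add

theorem pr2_mono {x y x' y' : M} (hx : x ≤ x') (hy : y ≤ y') : pr2 x y ≤ pr2 x' y' := by
  obtain ⟨a, rfl⟩ := exists_add_of_le' hx
  obtain ⟨b, rfl⟩ := exists_add_of_le' hy
  exact le_of_eq_add ((a + b) * (x + y + x + y) + (a + b) * (a + b) + a) (by unfold pr2; ring)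

/-- A pair with sum `s` has its code in the interval `[s², (s + 1)²)`, and these intervals are
disjoint and increasing in `s`. Recursion on codes of pairs may therefore refer to any pair with a
smaller sum. -/
theorem pr2_lt_of_add_lt {x y x' y' : M} (h : x + y < x' + y') : pr2 x y < pr2 x' y' := by
  obtain ⟨z, hz⟩ := exists_add_of_lt' h
  refine lt_of_eq_add (x + y + y + (z + z) * (x + y) + z * z + z + z + x') ?_
  unfold pr2
  rw [hz]
  ring

theorem pr2_inj {x y x' y' : M} (h : pr2 x y = pr2 x' y') : x = x' ∧ y = y' := by
  have hs : x + y = x' + y' := by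
    rcases lt_trichotomy (x + y) (x' + y') with h1 | h1 | h1
    · exact absurd h (pr2_lt_of_add_lt h1).ne
    · exact h1
    · exact absurd h (pr2_lt_of_add_lt h1).ne'
  have hx : x = x' := by
    unfold pr2 at h
    rw [hs] at h
    exact add_left_cancel h
  exact ⟨hx, by rw [hx] at hs; exact add_left_cancel hs⟩

theorem cs_inj {a b r a' b' r' : M} (h : cs a b r = cs a' b' r') : a = a' ∧ b = b' ∧ r = r' := by
  obtain ⟨h1, h2⟩ := pr2_inj (add_right_cancel h)
  exact ⟨h1, pr2_inj h2⟩

theorem cs_ne_zero (a b r : M) : cs a b r ≠ 0 := by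
  rw [cs, ← sc_eq]; exact sc_ne_zero _

theorem cs_mono {a b r a' b' r' : M} (ha : a ≤ a') (hb : b ≤ b') (hr : r ≤ r') :
    cs a b r ≤ cs a' b' r' :=
  add_le_add_left (pr2_mono ha (pr2_mono hb hr)) 1

theorem lt_cs_a (a b r : M) : a < cs a b r := lt_add_one_iff'.2 (le_pr2_left _ _)

theorem lt_cs_b (a b r : M) : b < cs a b r :=
  lt_add_one_iff'.2 ((le_pr2_left _ _).trans (le_pr2_right _ _))

theorem lt_cs_r (a b r : M) : r < cs a b r :=
  lt_add_one_iff'.2 ((le_pr2_right _ _).trans (le_pr2_right _ _))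

/-- The components of a code are smaller than the code, so decomposing a code needs only bounded
quantifiers. -/
theorem eq_cs_iff {u : M} {q : M → M → M → Prop} : (∃ a, a < u ∧ ∃ b, b < u ∧ ∃ r, r < u ∧
    u = cs a b r ∧ q a b r) ↔ ∃ a b r, u = cs a b r ∧ q a b r := by
  constructor
  · rintro ⟨a, -, b, -, r, -, h⟩
    exact ⟨a, b, r, h⟩
  · rintro ⟨a, b, r, rfl, h⟩
    exact ⟨a, lt_cs_a _ _ _, b, lt_cs_b _ _ _, r, lt_cs_r _ _ _, rfl, h⟩

instance D0.ex_cs {f : (ℕ → M) → M} {q : (ℕ → M) → M → M → M → Prop} [TF f]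
    [D0 (fun v => q (fun i => v (i + 3)) (v 2) (v 1) (v 0))] :
    D0 (fun v => ∃ a b r, f v = cs a b r ∧ q v a b r) := by
  have (v : ℕ → M) := @eq_cs_iff _ _ (f v) (q v)
  simp only [← this]
  have h3 : D0 (fun v : ℕ → M => f (fun i => v (i + 3)) = WeakID.cs (v 2) (v 1) (v 0) ∧
      q (fun i => v (i + 3)) (v 2) (v 1) (v 0)) := by
    have : TF (fun v : ℕ → M => f (fun i => v (i + 3))) := by
      obtain ⟨t, ht⟩ := (inferInstance : TF f)
      exact ⟨t.lift 3, fun v => by rw [val_lift, ht]⟩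
    infer_instance
  have hf (k : ℕ) : TF (fun v : ℕ → M => f (fun i => v (i + k))) := by
    obtain ⟨t, ht⟩ := (inferInstance : TF f)
    exact ⟨t.lift k, fun v => by rw [val_lift, ht]⟩
  have := hf 1
  have := hf 2
  refine @D0.bex _ _ _ (fun v a => ∃ b, b < f v ∧ ∃ r, r < f v ∧ f v = WeakID.cs a b r ∧ q v a b r) _ ?_
  refine @D0.bex _ _ _ (fun v b => ∃ r, r < f (fun i => v (i + 1)) ∧
    f (fun i => v (i + 1)) = WeakID.cs (v 0) b r ∧ q (fun i => v (i + 1)) (v 0) b r) (hf 1) ?_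
  exact @D0.bex _ _ _ (fun v r => f (fun i => v (i + 2)) = WeakID.cs (v 1) (v 0) r ∧
    q (fun i => v (i + 2)) (v 1) (v 0) r) (hf 2) h3

/-! ### Binary digits -/

theorem pow2_add (x y : M) : pow2 (x + y) = pow2 x * pow2 y := by
  refine D0.induction (p := fun v => pow2 (v 1 + v 0) = pow2 (v 1) * pow2 (v 0)) inferInstance
    (fun _ => x) ?_ (fun y ih => ?_) y
  · simp only [vcons, add_zero, pow2_zero, mul_one]
  · simp only [vcons] at ih ⊢
    rw [← add_assoc, pow2_succ, ih, pow2_succ, mul_assoc]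

theorem pow2_pos (x : M) : 0 < pow2 x := by
  refine D0.induction (p := fun v => 0 < pow2 (v 0)) inferInstance (fun _ => 0) ?_
    (fun y ih => ?_) x
  · simp only [vcons, pow2_zero]
    exact zero_lt_one
  · simp only [vcons] at ih ⊢
    rw [pow2_succ]
    exact mul_pos ih (by rw [← sc_eq]; exact lt_of_le_of_ne (zero_le' _) (sc_ne_zero _).symm)

theorem exists_div (T : M) {d : M} (hd : 0 < d) : ∃ q r, r < d ∧ T = q * d + r := by
  have : ∃ q, q < T + 1 ∧ ∃ r, r < d ∧ T = q * d + r := by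
    -- Induction on the dividend: the remainder grows by one until it reaches the divisor, and then
    -- the quotient grows.
    refine D0.induction (p := fun v => ∃ q, q < v 0 + 1 ∧ ∃ r, r < v 1 ∧ v 0 = q * v 1 + r)
      inferInstance (fun _ => d) ⟨0, lt_add_one_iff'.2 le_rfl, 0, hd, ?_⟩ (fun T ih => ?_) T
    · simp only [vcons, zero_mul, add_zero]
    · simp only [vcons] at ih ⊢
      obtain ⟨q, hq, r, hr, h⟩ := ih
      rcases add_one_le_iff'.2 hr with h1 | h1
      · exact ⟨q, hq.trans (lt_add_one_iff'.2 le_rfl), r + 1, h1, by rw [← add_assoc, ← h]⟩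
      · exact ⟨q + 1, add_lt_add_right' hq 1, 0, hd, by rw [h, add_assoc, h1]; ring⟩
  obtain ⟨q, -, r, hr, h⟩ := this
  exact ⟨q, r, hr, h⟩

theorem div_le_of_eq {d q r q' r' : M} (hr : r < d) (h : q' * d + r' = q * d + r) : q' ≤ q := by
  by_contra! hlt
  obtain ⟨z, rfl⟩ := exists_add_of_lt' hlt
  have : r = d + (z * d + r') := by
    refine add_left_cancel (a := q * d) ?_
    rw [← h]; ring
  exact absurd hr (not_lt.2 (le_of_eq_add _ this))

theorem even_or_odd' (x : M) : ∃ y, x = y + y ∨ x = y + y + 1 := by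
  obtain ⟨q, r, hr, h⟩ := exists_div x (d := 1 + 1) (by
    rw [← sc_eq]; exact lt_of_le_of_ne (zero_le' _) (sc_ne_zero _).symm)
  refine ⟨q, ?_⟩
  rcases lt_add_one_iff'.1 hr with h1 | h1
  · rw [← zero_add (1 : M)] at h1
    have h2 : r = 0 := le_antisymm (lt_add_one_iff'.1 h1) (zero_le' _)
    exact .inl (by rw [h, h2]; ring)
  · exact .inr (by rw [h, h1]; ring)

theorem even_ne_odd {x y : M} : x + x ≠ y + y + 1 := by
  intro h
  rcases lt_or_ge y x with h1 | h1
  · obtain ⟨z, rfl⟩ := exists_add_of_lt' h1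
    refine absurd h (ne_of_gt (lt_of_eq_add (z + z) ?_))
    ring
  · obtain ⟨z, rfl⟩ := exists_add_of_le' h1
    refine absurd h (ne_of_lt (lt_of_eq_add (z + z) ?_))
    ring

/-- The binary digit of `T` at `2 ^ p` is `1`. -/
def bit (p T : M) : Prop := ∃ q, q < T + 1 ∧ ∃ r, r < pow2 p ∧ T = (q + q + 1) * pow2 p + r

instance D0.bit {f g : (ℕ → M) → M} [hf : TF f] [hg : TF g] : D0 (fun v => bit (f v) (g v)) := by
  refine D0.comp2 (p := fun p T => WeakID.bit p T) ?_ hf hg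
  unfold WeakID.bit
  infer_instance

theorem bit_iff {p T : M} : bit p T ↔ ∃ q r, r < pow2 p ∧ T = (q + q + 1) * pow2 p + r := by
  constructor
  · rintro ⟨q, -, r, hr, h⟩
    exact ⟨q, r, hr, h⟩
  · rintro ⟨q, r, hr, h⟩
    refine ⟨q, lt_add_one_iff'.2 ?_, r, hr, h⟩
    obtain ⟨w, hw⟩ := exists_add_of_lt' (pow2_pos p)
    refine le_of_eq_add ((q + q + 1) * w + q + 1 + r) ?_
    rw [h, hw]
    ring

theorem not_bit_of_lt {n T : M} (h : T < pow2 n) : ¬ bit n T := by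
  rw [bit_iff]
  rintro ⟨q, r, hr, rfl⟩
  refine absurd h (not_lt.2 (le_of_eq_add ((q + q) * pow2 n + r) (by ring)))

theorem bit_add_self {n T : M} (h : T < pow2 n) : bit n (T + pow2 n) :=
  bit_iff.2 ⟨0, T, h, by ring⟩

/-- For `i < n` the number `2 ^ n` is an even multiple of `2 ^ i`, so adding it preserves the parity
of the quotient by `2 ^ i`. -/
theorem bit_add_pow2 {n T i : M} (hi : i < n) : bit i (T + pow2 n) ↔ bit i T := by
  obtain ⟨m, rfl⟩ := exists_add_of_lt' hi
  have hp : pow2 (i + m + 1) = (pow2 m + pow2 m) * pow2 i := by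
    rw [pow2_succ, pow2_add]; ring
  rw [bit_iff, bit_iff, hp]
  constructor
  · rintro ⟨q, r, hr, h⟩
    -- An even quotient for `T` would give `T + 2 ^ n` an even and an odd quotient at once, against
    -- uniqueness of division.
    obtain ⟨Q, s, hs, hQ⟩ := exists_div T (pow2_pos i)
    obtain ⟨y, rfl | rfl⟩ := even_or_odd' Q
    · have e : ((y + pow2 m) + (y + pow2 m)) * pow2 i + s = (q + q + 1) * pow2 i + r := by
        rw [← h, hQ]; ring
      exact (even_ne_odd (le_antisymm (div_le_of_eq hr e) (div_le_of_eq hs e.symm))).elim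
    · exact ⟨y, s, hs, hQ⟩
  · rintro ⟨q, r, hr, h⟩
    exact ⟨q + pow2 m, r, hr, by rw [h]; ring⟩

/-! ### Sets defined by recursion -/

/-- Three finite sets, as binary expansions, whose elements are determined recursively. -/
theorem exists_sets {F : Fin 3 → (ℕ → M) → Prop} (hF : ∀ j, D0 (F j)) (w : ℕ → M)
    (hloc : ∀ j A B C A' B' C' x, (∀ i, i < x → (bit i A ↔ bit i A') ∧ (bit i B ↔ bit i B') ∧
      (bit i C ↔ bit i C')) → F j (vcons A (vcons B (vcons C (vcons x w)))) →
        F j (vcons A' (vcons B' (vcons C' (vcons x w))))) (n : M) :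
    ∃ A, A < pow2 n ∧ ∃ B, B < pow2 n ∧ ∃ C, C < pow2 n ∧ ∀ x, x < n →
      (bit x A ↔ F 0 (vcons A (vcons B (vcons C (vcons x w))))) ∧
      (bit x B ↔ F 1 (vcons A (vcons B (vcons C (vcons x w))))) ∧
      (bit x C ↔ F 2 (vcons A (vcons B (vcons C (vcons x w))))) := by
  have hD (j : Fin 3) : D0 (fun v : ℕ → M =>
      F j (vcons (v 3) (vcons (v 2) (vcons (v 1) (vcons (v 0) fun i => v (i + 5)))))) :=
    (hF j).comp (TF.vcons (TF.var 3) (TF.vcons (TF.var 2) (TF.vcons (TF.var 1)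
      (TF.vcons (s := fun i v => v (i + 5)) (TF.var 0) fun i => TF.var (i + 5)))))
  have := hD 0
  have := hD 1
  have := hD 2
  -- The sets are built digit by digit. The bounds `2 ^ n` make this a bounded induction, and by
  -- `hloc` the clause at `x` depends only on the digits below `x`, which later extensions do not
  -- change.
  refine D0.induction (p := fun v => ∃ A, A < pow2 (v 0) ∧ ∃ B, B < pow2 (v 0) ∧
    ∃ C, C < pow2 (v 0) ∧ ∀ x, x < v 0 →
      (bit x A ↔ F 0 (vcons A (vcons B (vcons C (vcons x fun i => v (i + 1)))))) ∧
      (bit x B ↔ F 1 (vcons A (vcons B (vcons C (vcons x fun i => v (i + 1)))))) ∧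
      (bit x C ↔ F 2 (vcons A (vcons B (vcons C (vcons x fun i => v (i + 1)))))))
    ?_ w ?_ (fun n ih => ?_) n
  · refine D0.bex (hr := ?_)
    refine D0.bex (hr := ?_)
    refine D0.bex (hr := ?_)
    exact D0.ball
  · exact ⟨0, pow2_pos _, 0, pow2_pos _, 0, pow2_pos _, fun x hx => (not_lt_zero' _ hx).elim⟩
  · obtain ⟨A, hA, B, hB, C, hC, h⟩ := ih
    simp only [vcons_zero, vcons_succ] at hA hB hC h ⊢
    -- Adding `2 ^ n` or not decides the membership of `n` and leaves the smaller elements alone.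
    have ext (q : Prop) (A : M) (hA : A < pow2 n) : ∃ A', A' < pow2 (n + 1) ∧
        (∀ i, i < n → (bit i A' ↔ bit i A)) ∧ (bit n A' ↔ q) := by
      rw [pow2_succ]
      by_cases hq : q
      · refine ⟨A + pow2 n, ?_, fun i hi => bit_add_pow2 hi, iff_of_true (bit_add_self hA) hq⟩
        refine lt_of_lt_of_eq (add_lt_add_right' hA _) ?_
        ring
      · refine ⟨A, ?_, fun i hi => Iff.rfl, iff_of_false (not_bit_of_lt hA) hq⟩
        exact hA.trans_le (le_of_eq_add (pow2 n) (by ring))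
    obtain ⟨A', hA', hA1, hA2⟩ := ext (F 0 (vcons A (vcons B (vcons C (vcons n w))))) A hA
    obtain ⟨B', hB', hB1, hB2⟩ := ext (F 1 (vcons A (vcons B (vcons C (vcons n w))))) B hB
    obtain ⟨C', hC', hC1, hC2⟩ := ext (F 2 (vcons A (vcons B (vcons C (vcons n w))))) C hC
    refine ⟨A', hA', B', hB', C', hC', fun x hx => ?_⟩
    have agree {x : M} (hx : x ≤ n) (j : Fin 3) :
        F j (vcons A (vcons B (vcons C (vcons x w)))) ↔
          F j (vcons A' (vcons B' (vcons C' (vcons x w)))) := by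
      constructor <;> refine hloc j _ _ _ _ _ _ x fun i hi => ?_
      · have hi := lt_of_lt_of_le hi hx
        exact ⟨(hA1 i hi).symm, (hB1 i hi).symm, (hC1 i hi).symm⟩
      · have hi := lt_of_lt_of_le hi hx
        exact ⟨hA1 i hi, hB1 i hi, hC1 i hi⟩
    rcases lt_add_one_iff'.1 hx with hx | hx
    · obtain ⟨h1, h2, h3⟩ := h x hx
      rw [hA1 x hx, hB1 x hx, hC1 x hx, ← agree hx.le, ← agree hx.le, ← agree hx.le]
      exact ⟨h1, h2, h3⟩
    · rw [hx, hA2, hB2, hC2]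
      exact ⟨agree le_rfl 0, agree le_rfl 1, agree le_rfl 2⟩

end bits

end WeakID

/-! ### The order of the notation system and its normal forms on all codes of a model. -/

namespace WeakID

open Term (var func)
open Fml

section order

variable {M : Type} [WModel M]

/-! ### Truth of the formulas about codes -/

theorem val_pairT (v : ℕ → M) (s t : Term) : (pairT s t).val v = pr2 (s.val v) (t.val v) := by
  simp only [pairT, val_add, val_mul, pr2]

theorem val_addT (v : ℕ → M) (a b r : Term) :
    (addT a b r).val v = cs (a.val v) (b.val v) (r.val v) := by
  simp only [addT, val_sc, sc_eq, val_pairT, cs]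

section sat

variable {P : Type} {R : P → M → Prop}

theorem sat_memF (v : ℕ → M) (p T : Term) :
    (memF p T).Sat R v ↔ bit (p.val v) (T.val v) := by
  simp only [memF, sat_bex, Fml.Sat, val_lift, val_sc, val_pow2, val_add, val_mul, Term.val, vcons,
    sc_eq, bit]

/-- `(u, v) ∈ T`. -/
def rl (T u v : M) : Prop := bit (pr2 u v) T

theorem sat_relF (v : ℕ → M) (T s t : Term) :
    (relF T s t).Sat R v ↔ rl (T.val v) (s.val v) (t.val v) := by
  simp only [relF, sat_memF, val_pairT, rl]

theorem sat_exAdd (v : ℕ → M) (u : Term) (A : Fml P) : (exAdd u A).Sat R v ↔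
    ∃ a b r, u.val v = cs a b r ∧ A.Sat R (vcons r (vcons b (vcons a v))) := by
  rw [← eq_cs_iff]
  simp only [exAdd, sat_bex, Fml.Sat, val_lift, val_addT, Term.val, vcons]

end sat

instance D0.rl {f g h : (ℕ → M) → M} [TF f] [TF g] [TF h] :
    D0 (fun v => rl (f v) (g v) (h v)) :=
  inferInstanceAs (D0 (fun v => WeakID.bit (WeakID.pr2 (g v) (h v)) (f v)))

section clauses

variable (L K N L' K' N' : M → M → Prop)

/-- `ϑ(u) < ϑ(v)`. -/
def thetaRel (u v : M) : Prop := (L u v ∧ K u v) ∨ N u v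

/-- The clauses transcribe `stepL`, `stepM` and `stepN` literally; the idle `0 = 0` is the body of
the existential formula in `stepL`. -/
def clauseL (u v : M) : Prop :=
  (u = 0 ∧ ∃ a b r, v = cs a b r ∧ (0 : M) = 0) ∨
    ∃ a b r, u = cs a b r ∧ ∃ a' b' r', v = cs a' b' r' ∧
      (L a a' ∨ (a = a' ∧ (thetaRel L K N b b' ∨ (b = b' ∧ L r r'))))

def clauseK (u v : M) : Prop :=
  u = 0 ∨ ∃ a b r, u = cs a b r ∧ (K a v ∧ (thetaRel L K N b v ∧ K r v))

def clauseN (u v : M) : Prop :=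
  ∃ a b r, v = cs a b r ∧ (N u a ∨ ((u = b ∨ thetaRel L K N u b) ∨ N u r))

variable {L K N L' K' N'}

theorem thetaRel_congr {M : Type} {L K N L' K' N' : M → M → Prop} {u v : M} (hL : L u v ↔ L' u v) (hK : K u v ↔ K' u v)
    (hN : N u v ↔ N' u v) : thetaRel L K N u v ↔ thetaRel L' K' N' u v := by
  rw [thetaRel, thetaRel, hL, hK, hN]

/-- Each clause passes from `(u, v)` to components of `u` or of `v`, hence only to pairs with a
smaller sum. -/
theorem clause_congr {u v : M} (h : ∀ u' v', u' ≤ u → v' ≤ v → u' + v' < u + v →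
    (L u' v' ↔ L' u' v') ∧ (K u' v' ↔ K' u' v') ∧ (N u' v' ↔ N' u' v')) :
    (clauseL L K N u v ↔ clauseL L' K' N' u v) ∧ (clauseK L K N u v ↔ clauseK L' K' N' u v) ∧
      (clauseN L K N u v ↔ clauseN L' K' N' u v) := by
  have hθ {u' v' : M} (hu : u' ≤ u) (hv : v' ≤ v) (hlt : u' + v' < u + v) :
      thetaRel L K N u' v' ↔ thetaRel L' K' N' u' v' :=
    thetaRel_congr (h _ _ hu hv hlt).1 (h _ _ hu hv hlt).2.1 (h _ _ hu hv hlt).2.2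
  refine ⟨or_congr Iff.rfl ?_, or_congr Iff.rfl ?_, ?_⟩
  · refine exists_congr fun a => exists_congr fun b => exists_congr fun r =>
      and_congr_right ?_
    rintro rfl
    refine exists_congr fun a' => exists_congr fun b' => exists_congr fun r' =>
      and_congr_right ?_
    rintro rfl
    rw [(h a a' (lt_cs_a _ _ _).le (lt_cs_a _ _ _).le
        (add_lt_add (lt_cs_a _ _ _) (lt_cs_a _ _ _))).1,
      hθ (lt_cs_b a b r).le (lt_cs_b a' b' r').le (add_lt_add (lt_cs_b a b r) (lt_cs_b a' b' r')),
      (h r r' (lt_cs_r _ _ _).le (lt_cs_r _ _ _).le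
        (add_lt_add (lt_cs_r _ _ _) (lt_cs_r _ _ _))).1]
  · refine exists_congr fun a => exists_congr fun b => exists_congr fun r =>
      and_congr_right ?_
    rintro rfl
    rw [(h a v (lt_cs_a _ _ _).le le_rfl (add_lt_add_right' (lt_cs_a _ _ _) _)).2.1,
      hθ (lt_cs_b a b r).le le_rfl (add_lt_add_right' (lt_cs_b a b r) v),
      (h r v (lt_cs_r _ _ _).le le_rfl (add_lt_add_right' (lt_cs_r _ _ _) _)).2.1]
  · have add_left {x y : M} (h : x < y) : u + x < u + y := by
      rw [add_comm u, add_comm u]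
      exact add_lt_add_right' h u
    refine exists_congr fun a => exists_congr fun b => exists_congr fun r =>
      and_congr_right ?_
    rintro rfl
    rw [(h u a le_rfl (lt_cs_a _ _ _).le (add_left (lt_cs_a _ _ _))).2.2,
      hθ le_rfl (lt_cs_b a b r).le (add_left (lt_cs_b a b r)),
      (h u r le_rfl (lt_cs_r _ _ _).le (add_left (lt_cs_r _ _ _))).2.2]

end clauses

/-- `A, B, C` satisfy the recursive clauses for all arguments up to `n`. -/
def IsTable (n A B C : M) : Prop :=
  ∀ u, u < n + 1 → ∀ v, v < n + 1 →
    (rl A u v ↔ clauseL (rl A) (rl B) (rl C) u v) ∧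
    (rl B u v ↔ clauseK (rl A) (rl B) (rl C) u v) ∧
    (rl C u v ↔ clauseN (rl A) (rl B) (rl C) u v)

theorem sat_tableF {P : Type} {R : P → M → Prop} (v : ℕ → M) (n A B C : Term) :
    (tableF n A B C).Sat R v ↔ IsTable (n.val v) (A.val v) (B.val v) (C.val v) := by
  simp only [tableF, sat_ball, val_sc, sc_eq, Fml.Sat, sat_iff, sat_relF, stepL, stepM, stepN,
    thetaF, sat_exAdd, val_lift, Term.val, vcons, val_zero, IsTable, clauseL, clauseK, clauseN,
    thetaRel]

instance D0.clauseL {f g A B C : (ℕ → M) → M} [TF f] [TF g] [TF A] [TF B] [TF C] :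
    D0 (fun v => clauseL (WeakID.rl (A v)) (WeakID.rl (B v)) (WeakID.rl (C v)) (f v) (g v)) := by
  refine D0.comp (p := fun v => WeakID.clauseL (WeakID.rl (v 0)) (WeakID.rl (v 1)) (WeakID.rl (v 2)) (v 3) (v 4))
    ?_ (TF.vcons (f := A) inferInstance (TF.vcons (f := B) inferInstance
      (TF.vcons (f := C) inferInstance (TF.vcons (f := f) inferInstance
        (s := fun _ => g) fun _ => inferInstance))))
  unfold WeakID.clauseL thetaRel
  infer_instance

instance D0.clauseK {f g A B C : (ℕ → M) → M} [TF f] [TF g] [TF A] [TF B] [TF C] :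
    D0 (fun v => clauseK (WeakID.rl (A v)) (WeakID.rl (B v)) (WeakID.rl (C v)) (f v) (g v)) := by
  refine D0.comp (p := fun v => WeakID.clauseK (WeakID.rl (v 0)) (WeakID.rl (v 1)) (WeakID.rl (v 2)) (v 3) (v 4))
    ?_ (TF.vcons (f := A) inferInstance (TF.vcons (f := B) inferInstance
      (TF.vcons (f := C) inferInstance (TF.vcons (f := f) inferInstance
        (s := fun _ => g) fun _ => inferInstance))))
  unfold WeakID.clauseK thetaRel
  infer_instance

instance D0.clauseN {f g A B C : (ℕ → M) → M} [TF f] [TF g] [TF A] [TF B] [TF C] :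
    D0 (fun v => clauseN (WeakID.rl (A v)) (WeakID.rl (B v)) (WeakID.rl (C v)) (f v) (g v)) := by
  refine D0.comp (p := fun v => WeakID.clauseN (WeakID.rl (v 0)) (WeakID.rl (v 1)) (WeakID.rl (v 2)) (v 3) (v 4))
    ?_ (TF.vcons (f := A) inferInstance (TF.vcons (f := B) inferInstance
      (TF.vcons (f := C) inferInstance (TF.vcons (f := f) inferInstance
        (s := fun _ => g) fun _ => inferInstance))))
  unfold WeakID.clauseN thetaRel
  infer_instance

instance D0.isTable {n A B C : (ℕ → M) → M} [TF n] [TF A] [TF B] [TF C] :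
    D0 (fun v => IsTable (n v) (A v) (B v) (C v)) := by
  refine D0.comp (p := fun v => IsTable (v 0) (v 1) (v 2) (v 3))
    ?_ (TF.vcons (f := n) inferInstance (TF.vcons (f := A) inferInstance
      (TF.vcons (f := B) inferInstance (s := fun _ => C) fun _ => inferInstance)))
  unfold IsTable
  infer_instance

def tbound (n : M) : M := pow2 ((n + n + 1) * (n + n + 1))

instance TF.tbound {f : (ℕ → M) → M} [TF f] : TF (fun v => tbound (f v)) :=
  inferInstanceAs (TF (fun v => WeakID.pow2 ((f v + f v + 1) * (f v + f v + 1))))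

/-- The three relations are sets of coded pairs defined by simultaneous recursion on the code. The
recursion is admissible because a smaller sum means a smaller code. -/
theorem exists_isTable (n : M) : ∃ A, A < tbound n ∧ ∃ B, B < tbound n ∧ ∃ C, C < tbound n ∧
    IsTable n A B C := by
  let F : Fin 3 → (ℕ → M) → Prop := ![
    fun v => ∃ x, x ≤ v 3 ∧ ∃ y, y ≤ v 3 ∧ v 3 = pr2 x y ∧
      clauseL (rl (v 0)) (rl (v 1)) (rl (v 2)) x y,
    fun v => ∃ x, x ≤ v 3 ∧ ∃ y, y ≤ v 3 ∧ v 3 = pr2 x y ∧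
      clauseK (rl (v 0)) (rl (v 1)) (rl (v 2)) x y,
    fun v => ∃ x, x ≤ v 3 ∧ ∃ y, y ≤ v 3 ∧ v 3 = pr2 x y ∧
      clauseN (rl (v 0)) (rl (v 1)) (rl (v 2)) x y]
  have pair_iff {q : M → M → Prop} {x y : M} : (∃ x', x' ≤ pr2 x y ∧ ∃ y', y' ≤ pr2 x y ∧
      pr2 x y = pr2 x' y' ∧ q x' y') ↔ q x y := by
    constructor
    · rintro ⟨x', -, y', -, h, hq⟩
      obtain ⟨rfl, rfl⟩ := pr2_inj h
      exact hq
    · exact fun h => ⟨x, le_pr2_left _ _, y, le_pr2_right _ _, rfl, h⟩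
  have hF (j : Fin 3) : D0 (F j) := by
    fin_cases j
    · exact D0.bex_le (f := fun v => v 3)
    · exact D0.bex_le (f := fun v => v 3)
    · exact D0.bex_le (f := fun v => v 3)
  obtain ⟨A, hA, B, hB, C, hC, h⟩ := exists_sets hF (fun _ => 0) (by
    intro j A B C A' B' C' x h
    have key {x' y' : M} (hx : x = pr2 x' y') := clause_congr (L := rl A) (K := rl B) (N := rl C)
      (L' := rl A') (K' := rl B') (N' := rl C') (u := x') (v := y')
      (fun u v _ _ huv => h _ (hx ▸ pr2_lt_of_add_lt huv))
    fin_cases j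
    · rintro ⟨x', h1, y', h2, h3, h4⟩
      exact ⟨x', h1, y', h2, h3, (key h3).1.1 h4⟩
    · rintro ⟨x', h1, y', h2, h3, h4⟩
      exact ⟨x', h1, y', h2, h3, (key h3).2.1.1 h4⟩
    · rintro ⟨x', h1, y', h2, h3, h4⟩
      exact ⟨x', h1, y', h2, h3, (key h3).2.2.1 h4⟩) ((n + n + 1) * (n + n + 1))
  refine ⟨A, hA, B, hB, C, hC, fun u hu v hv => ?_⟩
  -- For arguments up to `n` the code is at most `4n² + n`, which is smaller than `(2n + 1)²` by `3n
  -- + 1`.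
  have hlt : pr2 u v < (n + n + 1) * (n + n + 1) := by
    have h1 := pr2_mono (lt_add_one_iff'.1 hu) (lt_add_one_iff'.1 hv)
    refine lt_of_le_of_lt h1 (lt_of_eq_add (n + n + n) ?_)
    unfold pr2
    ring
  have h' := h _ hlt
  simp only [F, Matrix.cons_val_zero, Matrix.cons_val_one, Matrix.cons_val_two, Matrix.tail_cons,
    Matrix.head_cons, vcons] at h'
  rw [pair_iff, pair_iff, pair_iff] at h'
  exact h'

/-- Induction on `u + v`: both tables obey the same clauses, and the clauses refer only to smaller
sums. The tables may have different sizes. -/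
theorem IsTable.unique {n A B C n' A' B' C' : M} (h : IsTable n A B C) (h' : IsTable n' A' B' C')
    {u v : M} (hu : u ≤ n) (hv : v ≤ n) (hu' : u ≤ n') (hv' : v ≤ n') :
    (rl A u v ↔ rl A' u v) ∧ (rl B u v ↔ rl B' u v) ∧ (rl C u v ↔ rl C' u v) := by
  refine D0.strongInduction (p := fun w => ∀ u, u ≤ w 0 → ∀ v, v ≤ w 0 → u + v = w 0 →
    u ≤ w 4 → v ≤ w 4 → u ≤ w 8 → v ≤ w 8 →
      (rl (w 1) u v ↔ rl (w 5) u v) ∧ (rl (w 2) u v ↔ rl (w 6) u v) ∧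
        (rl (w 3) u v ↔ rl (w 7) u v)) ?_
    (vcons A (vcons B (vcons C (vcons n (vcons A' (vcons B' (vcons C' fun _ => n'))))))) ?_ (u + v)
    u le_self_add v le_add_self rfl hu hv hu' hv'
  · exact D0.ball_le
  · simp only [vcons]
    intro s ih u _ v _ hs hu hv hu' hv'
    have e := h u (lt_add_one_iff'.2 hu) v (lt_add_one_iff'.2 hv)
    have e' := h' u (lt_add_one_iff'.2 hu') v (lt_add_one_iff'.2 hv')
    obtain ⟨h1, h2, h3⟩ := clause_congr (L := rl A) (K := rl B) (N := rl C) (L' := rl A')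
      (K' := rl B') (N' := rl C') (u := u) (v := v) fun u' v' hu1 hv1 hlt =>
        ih _ (hs ▸ hlt) u' le_self_add v' le_add_self rfl (hu1.trans hu) (hv1.trans hv)
          (hu1.trans hu') (hv1.trans hv')
    exact ⟨e.1.trans (h1.trans e'.1.symm), e.2.1.trans (h2.trans e'.2.1.symm),
      e.2.2.trans (h3.trans e'.2.2.symm)⟩

/-! ### The order on codes in a model -/

/-- `u < v` for arbitrary codes. -/
def LL (u v : M) : Prop := ∃ A, A < tbound (u + v) ∧ ∃ B, B < tbound (u + v) ∧
  ∃ C, C < tbound (u + v) ∧ IsTable (u + v) A B C ∧ rl A u v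

/-- `∀ γ ∈ K(u), γ < ϑ(v)`. -/
def KK (u v : M) : Prop := ∃ A, A < tbound (u + v) ∧ ∃ B, B < tbound (u + v) ∧
  ∃ C, C < tbound (u + v) ∧ IsTable (u + v) A B C ∧ rl B u v

/-- `∃ δ ∈ K(v), ϑ(u) ≤ δ`. -/
def NN (u v : M) : Prop := ∃ A, A < tbound (u + v) ∧ ∃ B, B < tbound (u + v) ∧
  ∃ C, C < tbound (u + v) ∧ IsTable (u + v) A B C ∧ rl C u v

/-- `ϑ(u) < ϑ(v)`. -/
def TT (u v : M) : Prop := thetaRel LL KK NN u v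

instance D0.LL {f g : (ℕ → M) → M} [hf : TF f] [hg : TF g] : D0 (fun v => LL (f v) (g v)) := by
  refine D0.comp2 (p := fun x y => WeakID.LL x y) ?_ hf hg
  unfold WeakID.LL
  infer_instance

instance D0.KK {f g : (ℕ → M) → M} [hf : TF f] [hg : TF g] : D0 (fun v => KK (f v) (g v)) := by
  refine D0.comp2 (p := fun x y => WeakID.KK x y) ?_ hf hg
  unfold WeakID.KK
  infer_instance

instance D0.NN {f g : (ℕ → M) → M} [hf : TF f] [hg : TF g] : D0 (fun v => NN (f v) (g v)) := by
  refine D0.comp2 (p := fun x y => WeakID.NN x y) ?_ hf hg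
  unfold WeakID.NN
  infer_instance

instance D0.TT {f g : (ℕ → M) → M} [TF f] [TF g] : D0 (fun v => TT (f v) (g v)) :=
  inferInstanceAs (D0 (fun v => (WeakID.LL (f v) (g v) ∧ WeakID.KK (f v) (g v)) ∨
    WeakID.NN (f v) (g v)))

/-- By uniqueness the choice of the table does not matter; the relations were defined with the
smallest table that covers both arguments. -/
theorem IsTable.iff {n A B C u v : M} (h : IsTable n A B C) (hu : u ≤ n) (hv : v ≤ n) :
    (rl A u v ↔ LL u v) ∧ (rl B u v ↔ KK u v) ∧ (rl C u v ↔ NN u v) := by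
  obtain ⟨A', hA', B', hB', C', hC', h'⟩ := exists_isTable (u + v)
  have hu' : u ≤ u + v := le_self_add
  have hv' : v ≤ u + v := le_add_self
  have e := h.unique h' hu hv hu' hv'
  refine ⟨⟨fun h1 => ?_, ?_⟩, ⟨fun h1 => ?_, ?_⟩, fun h1 => ?_, ?_⟩
  · exact ⟨A', hA', B', hB', C', hC', h', e.1.1 h1⟩
  · rintro ⟨A, -, B, -, C, -, h2, h3⟩
    exact (h2.unique h hu' hv' hu hv).1.1 h3
  · exact ⟨A', hA', B', hB', C', hC', h', e.2.1.1 h1⟩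
  · rintro ⟨A, -, B, -, C, -, h2, h3⟩
    exact (h2.unique h hu' hv' hu hv).2.1.1 h3
  · exact ⟨A', hA', B', hB', C', hC', h', e.2.2.1 h1⟩
  · rintro ⟨A, -, B, -, C, -, h2, h3⟩
    exact (h2.unique h hu' hv' hu hv).2.2.1 h3

/-- Once `nfF` and `ltF` have been translated, these recursive equivalences replace the tables in
all reasoning about the order. -/
theorem order_clauses (u v : M) : (LL u v ↔ clauseL LL KK NN u v) ∧
    (KK u v ↔ clauseK LL KK NN u v) ∧ (NN u v ↔ clauseN LL KK NN u v) := by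
  obtain ⟨A, -, B, -, C, -, h⟩ := exists_isTable (u + v)
  have hu : u ≤ u + v := le_self_add
  have hv : v ≤ u + v := le_add_self
  obtain ⟨e1, e2, e3⟩ := h.iff hu hv
  obtain ⟨h1, h2, h3⟩ := h u (lt_add_one_iff'.2 hu) v (lt_add_one_iff'.2 hv)
  obtain ⟨c1, c2, c3⟩ := clause_congr (L := rl A) (K := rl B) (N := rl C) (L' := LL)
    (K' := KK) (N' := NN) (u := u) (v := v) fun u' v' hu1 hv1 _ =>
      h.iff (hu1.trans hu) (hv1.trans hv)
  exact ⟨e1.symm.trans (h1.trans c1), e2.symm.trans (h2.trans c2), e3.symm.trans (h3.trans c3)⟩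

theorem not_LL_zero (u : M) : ¬ LL u 0 := by
  rw [(order_clauses u 0).1]
  rintro (⟨-, a, b, r, h, -⟩ | ⟨a, b, r, -, a', b', r', h, -⟩)
  · exact (cs_ne_zero _ _ _ h.symm).elim
  · exact (cs_ne_zero _ _ _ h.symm).elim

theorem zero_LL (a b r : M) : LL 0 (cs a b r) :=
  (order_clauses _ _).1.2 (.inl ⟨rfl, a, b, r, rfl, rfl⟩)

theorem LL_cs_iff {a b r a' b' r' : M} : LL (cs a b r) (cs a' b' r') ↔
    LL a a' ∨ (a = a' ∧ (TT b b' ∨ (b = b' ∧ LL r r'))) := by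
  rw [(order_clauses _ _).1]
  constructor
  · rintro (⟨h, -⟩ | ⟨_, _, _, h, _, _, _, h', hc⟩)
    · exact (cs_ne_zero _ _ _ h).elim
    · obtain ⟨rfl, rfl, rfl⟩ := cs_inj h
      obtain ⟨rfl, rfl, rfl⟩ := cs_inj h'
      exact hc
  · exact fun h => .inr ⟨_, _, _, rfl, _, _, _, rfl, h⟩

theorem KK_cs_iff {a b r v : M} : KK (cs a b r) v ↔ KK a v ∧ TT b v ∧ KK r v := by
  rw [(order_clauses _ _).2.1]
  constructor
  · rintro (h | ⟨_, _, _, h, hc⟩)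
    · exact (cs_ne_zero _ _ _ h).elim
    · obtain ⟨rfl, rfl, rfl⟩ := cs_inj h
      exact hc
  · exact fun h => .inr ⟨_, _, _, rfl, h⟩

theorem not_NN_zero (u : M) : ¬ NN u 0 := by
  rw [(order_clauses _ _).2.2]
  rintro ⟨a, b, r, h, -⟩
  exact cs_ne_zero _ _ _ h.symm

theorem NN_cs_iff {a b r u : M} : NN u (cs a b r) ↔ NN u a ∨ (u = b ∨ TT u b) ∨ NN u r := by
  rw [(order_clauses _ _).2.2]
  constructor
  · rintro ⟨_, _, _, h, hc⟩
    obtain ⟨rfl, rfl, rfl⟩ := cs_inj h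
    exact hc
  · exact fun h => ⟨_, _, _, rfl, h⟩

theorem not_TT_zero (u : M) : ¬ TT u 0 := by
  rintro (⟨h, -⟩ | h)
  · exact not_LL_zero _ h
  · exact not_NN_zero _ h

/-! ### Predicates with a monotone recursive clause -/

/-- `x` lies in a finite set all of whose elements satisfy the clause. -/
def ClMem (cl : (M → Prop) → M → Prop) (x : M) : Prop :=
  ∃ S, S < pow2 (x + 1) ∧ bit x S ∧ ∀ z, z < x + 1 → bit z S → cl (fun i => bit i S) z

/-- Recursion gives, up to any bound, a set in which the clause is an equivalence. By monotonicity
and strong induction it contains every set witnessing `ClMem`, and it is such a witness itself; so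
`ClMem` agrees with it below the bound and inherits the equivalence. -/
theorem clMem_iff {cl : (M → Prop) → M → Prop} {F : (ℕ → M) → Prop} (hF : D0 F) (w : ℕ → M)
    (hcl : ∀ S z, F (vcons S (vcons z w)) ↔ cl (fun i => bit i S) z)
    (hloc : ∀ Y Y' z, (∀ i, i < z → Y i → Y' i) → cl Y z → cl Y' z) (x : M) :
    ClMem cl x ↔ cl (ClMem cl) x := by
  have hset (n : M) : ∃ S, S < pow2 n ∧ ∀ z, z < n → (bit z S ↔ cl (fun i => bit i S) z) := by
    -- Only the first of the three sets is needed, so all three get the same clause.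
    let G : Fin 3 → (ℕ → M) → Prop := fun _ v => F (vcons (v 0) fun i => v (i + 3))
    have hG (j : Fin 3) : D0 (G j) :=
      hF.comp (TF.vcons (s := fun i v => v (i + 3)) (TF.var 0) fun i => TF.var (i + 3))
    obtain ⟨A, hA, B, -, C, -, h⟩ := exists_sets hG w (by
      intro j A B C A' B' C' z h h1
      exact (hcl _ _).2 (hloc _ _ z (fun i hi => (h i hi).1.1) ((hcl _ _).1 h1))) n
    exact ⟨A, hA, fun z hz => (h z hz).1.trans (hcl A z)⟩
  have hsub {n S x S' : M} (hS : ∀ z, z < n → (bit z S ↔ cl (fun i => bit i S) z)) (hx : x < n)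
      (hS' : ∀ z, z < x + 1 → bit z S' → cl (fun i => bit i S') z) (h : bit x S') : bit x S := by
    have key : ∀ z, z < x + 1 → bit z S' → bit z S := by
      intro z
      refine D0.strongInduction (p := fun v => v 0 < v 1 + 1 → bit (v 0) (v 2) → bit (v 0) (v 3))
        inferInstance (vcons x (vcons S' fun _ => S)) (fun z ih hz h => ?_) z
      simp only [vcons] at ih hz h ⊢
      rw [hS z (lt_of_le_of_lt (lt_add_one_iff'.1 hz) hx)]
      exact hloc _ _ z (fun i hi => ih i hi (hi.trans hz)) (hS' z hz h)
    exact key x (lt_add_one_iff'.2 le_rfl) h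
  have hmem {n S x : M} (hS : ∀ z, z < n → (bit z S ↔ cl (fun i => bit i S) z)) (hx : x < n) :
      ClMem cl x ↔ bit x S := by
    constructor
    · rintro ⟨S', -, h, h'⟩
      exact hsub hS hx h' h
    · intro h
      obtain ⟨S', hS', h'⟩ := hset (x + 1)
      refine ⟨S', hS', hsub h' (lt_add_one_iff'.2 le_rfl) (fun z hz hz' => ?_) h,
        fun z hz => (h' z hz).1⟩
      exact (hS z (lt_of_le_of_lt (lt_add_one_iff'.1 hz) hx)).1 hz'
  obtain ⟨S, -, hS⟩ := hset (x + 1)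
  have hx : x < x + 1 := lt_add_one_iff'.2 le_rfl
  rw [hmem hS hx, hS x hx]
  constructor
  · exact hloc _ _ x fun i hi h => (hmem hS (hi.trans hx)).2 h
  · exact hloc _ _ x fun i hi h => (hmem hS (hi.trans hx)).1 h

/-! ### Normal forms -/

def clauseNF (L K N : M → M → Prop) (Y : M → Prop) (z : M) : Prop :=
  z = 0 ∨ ∃ a b r, z = cs a b r ∧ ((Y a ∧ (Y b ∧ Y r)) ∧ (r = 0 ∨ ∃ a' b' r', r = cs a' b' r' ∧
    (L a' a ∨ (a' = a ∧ (b' = b ∨ thetaRel L K N b' b)))))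

/-- `x` codes a normal form. -/
def NFm (x : M) : Prop := ClMem (clauseNF LL KK NN) x

instance D0.clauseNF {f g : (ℕ → M) → M} [hf : TF f] [hg : TF g] :
    D0 (fun v => clauseNF WeakID.LL WeakID.KK WeakID.NN (fun i => WeakID.bit i (f v)) (g v)) := by
  refine D0.comp2 (p := fun x y => WeakID.clauseNF WeakID.LL WeakID.KK WeakID.NN (fun i => WeakID.bit i x) y) ?_ hf hg
  have h : thetaRel (M := M) WeakID.LL WeakID.KK WeakID.NN = WeakID.TT := rfl
  unfold WeakID.clauseNF
  rw [h]
  infer_instance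

instance D0.NFm {f : (ℕ → M) → M} [hf : TF f] : D0 (fun v => NFm (f v)) := by
  refine D0.comp1 (p := fun x => WeakID.NFm x) ?_ hf
  unfold WeakID.NFm ClMem
  infer_instance

theorem NFm_clause (x : M) : NFm x ↔ clauseNF LL KK NN NFm x := by
  refine clMem_iff (F := fun v => clauseNF LL KK NN (fun i => bit i (v 0)) (v 1)) inferInstance
    (fun _ => 0) (fun _ _ => Iff.rfl) ?_ x
  rintro Y Y' z h (rfl | ⟨a, b, r, rfl, ⟨h1, h2, h3⟩, h4⟩)
  · exact .inl rfl
  · exact .inr ⟨a, b, r, rfl, ⟨h _ (lt_cs_a _ _ _) h1, h _ (lt_cs_b _ _ _) h2,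
      h _ (lt_cs_r _ _ _) h3⟩, h4⟩

theorem NFm_zero : NFm (0 : M) := (NFm_clause 0).2 (.inl rfl)

theorem NFm_cases {x : M} (h : NFm x) : x = 0 ∨ ∃ a b r, x = cs a b r :=
  ((NFm_clause x).1 h).imp id fun ⟨a, b, r, h, _⟩ => ⟨a, b, r, h⟩

/-- The summand `Ω ^ a · ϑ(b)` may precede `r`. -/
def Heads (a b r : M) : Prop :=
  r = 0 ∨ ∃ a' b' r', r = cs a' b' r' ∧ (LL a' a ∨ (a' = a ∧ (b' = b ∨ TT b' b)))

theorem NFm_cs_iff {a b r : M} : NFm (cs a b r) ↔ NFm a ∧ NFm b ∧ NFm r ∧ Heads a b r := by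
  rw [NFm_clause]
  constructor
  · rintro (h | ⟨_, _, _, h, ⟨h1, h2, h3⟩, h4⟩)
    · exact (cs_ne_zero _ _ _ h).elim
    · obtain ⟨rfl, rfl, rfl⟩ := cs_inj h
      exact ⟨h1, h2, h3, h4⟩
  · exact fun ⟨h1, h2, h3, h4⟩ => .inr ⟨_, _, _, rfl, ⟨h1, h2, h3⟩, h4⟩

/-- All comparisons made by the formula are between components of codes below `n`, where any table
up to `n` computes the order. -/
theorem sat_nfF {P : Type} {R : P → M → Prop} (v : ℕ → M) (A B C x : Term) {n : M}
    (h : IsTable n (A.val v) (B.val v) (C.val v)) (hx : x.val v ≤ n) :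
    (nfF A B C x).Sat R v ↔ NFm (x.val v) := by
  simp only [nfF, sat_bex, sat_ball, val_sc, sc_eq, val_pow2, Fml.Sat, sat_imp, sat_relF, sat_memF,
    thetaF, sat_exAdd, val_lift, Term.val, vcons, val_zero]
  refine exists_congr fun S => and_congr_right fun _ => and_congr_right fun _ =>
    forall_congr' fun z => imp_congr_right fun hz => imp_congr_right fun _ => or_congr Iff.rfl ?_
  refine exists_congr fun a => exists_congr fun b => exists_congr fun r => and_congr_right ?_
  rintro rfl
  refine and_congr_right fun _ => or_congr Iff.rfl ?_
  refine exists_congr fun a' => exists_congr fun b' => exists_congr fun r' => and_congr_right ?_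
  rintro rfl
  have hz := (lt_add_one_iff'.1 hz).trans hx
  have ha := (lt_cs_a a b (cs a' b' r')).le.trans hz
  have hb := (lt_cs_b a b (cs a' b' r')).le.trans hz
  have hr := (lt_cs_r a b (cs a' b' r')).le.trans hz
  have ha' := (lt_cs_a a' b' r').le.trans hr
  have hb' := (lt_cs_b a' b' r').le.trans hr
  rw [(h.iff ha' ha).1, (h.iff hb' hb).1, (h.iff hb' hb).2.1, (h.iff hb' hb).2.2]
  rfl

/-- `x < y` in `OT'(ϑ)`. -/
def Olt (x y : M) : Prop := NFm x ∧ NFm y ∧ LL x y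

instance D0.Olt {f g : (ℕ → M) → M} [TF f] [TF g] : D0 (fun v => Olt (f v) (g v)) :=
  inferInstanceAs (D0 (fun v => WeakID.NFm (f v) ∧ WeakID.NFm (g v) ∧ WeakID.LL (f v) (g v)))

theorem sat_ltF {P : Type} {R : P → M → Prop} (v : ℕ → M) (s t : Term) :
    (ltF s t).Sat R v ↔ Olt (s.val v) (t.val v) := by
  have nf (A B C : M) (u : Term) (hu : u.val v ≤ s.val v + t.val v)
      (h : IsTable (s.val v + t.val v) A B C) :
      (nfF (var 2) (var 1) (var 0) (u.lift 3)).Sat R (vcons C (vcons B (vcons A v))) ↔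
        NFm (u.val v) := by
    have e : (u.lift 3).val (vcons C (vcons B (vcons A v))) = u.val v := val_lift _ _ _
    rw [← e] at hu ⊢
    exact sat_nfF _ (var 2) (var 1) (var 0) _ h hu
  simp only [ltF, sat_bex, tableBound, val_pow2, val_mul, val_sc, sc_eq, val_add, val_lift,
    Fml.Sat, sat_tableF, sat_relF, Term.val, vcons]
  have hs : s.val v ≤ s.val v + t.val v := le_self_add
  have ht : t.val v ≤ s.val v + t.val v := le_add_self
  constructor
  · rintro ⟨A, -, B, -, C, -, h, ⟨h1, h2⟩, h3⟩
    exact ⟨(nf A B C s hs h).1 h1, (nf A B C t ht h).1 h2, (h.iff hs ht).1.1 h3⟩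
  · rintro ⟨h1, h2, h3⟩
    obtain ⟨A, hA, B, hB, C, hC, h⟩ := exists_isTable (s.val v + t.val v)
    exact ⟨A, hA, B, hB, C, hC, h, ⟨(nf A B C s hs h).2 h1, (nf A B C t ht h).2 h2⟩,
      (h.iff hs ht).1.2 h3⟩

end order

end WeakID

/-! ### Accessibility of the theta terms. -/

namespace WeakID

open Term (var func)
open Fml

section accessible

variable {M : Type} [WModel M]

/-! ### The accessible part -/

def Wm (x : M) : Prop := WModel.R W x

instance D0.Wm {f : (ℕ → M) → M} [TF f] : D0 (fun v => Wm (f v)) := D0.pr W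

theorem sat_closedUnder_acc (σ : Fml PosPi1) (v : ℕ → M) :
    (closedUnder accForm σ).Sat WModel.R v ↔ ∀ x, (∀ y, Olt y x → σ.Sat WModel.R (vcons y v)) →
      σ.Sat WModel.R (vcons x v) := by
  have h (x y : M) : (σ.subst (up (fun i => var (i + 1)))).Sat WModel.R (vcons y (vcons x v)) ↔
      σ.Sat WModel.R (vcons y v) := by
    rw [sat_subst, val_up]; rfl
  simp only [closedUnder, accForm, Fml.Sat, sat_imp, sat_substPred, sat_ltF, Term.val, vcons, h]

theorem Wm_intro {x : M} (h : ∀ y, Olt y x → Wm y) : Wm x := by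
  have h' := WModel.ax (M := M) (fixAx W) (.inl (.inr ⟨W, rfl⟩)) (fun _ => 0)
  rw [fixAx, show W.1 = accForm from rfl, sat_closedUnder_acc] at h'
  exact h' x h

/-- Induction along the accessible part, with parameters `v`. -/
theorem Def.accInduction {p : (ℕ → M) → Prop} {n : ℕ} (hp : Def .pi n p) (hn : n ≤ WModel.k M)
    (v : ℕ → M) (hs : ∀ x, (∀ y, Olt y x → p (vcons y v)) → p (vcons x v)) {x : M}
    (hx : Wm x) : p (vcons x v) := by
  obtain ⟨A, hA, hA'⟩ := hp
  have h := WModel.ax (M := M) (leastAx W A) (.inr ⟨W, A, hA.mono hn, rfl⟩) v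
  simp only [leastAx, show W.1 = accForm from rfl, Fml.Sat, sat_imp, sat_shift,
    sat_closedUnder_acc, hA'] at h
  exact h x hx hs

/-- Minimality of `W`, applied to the `Π⁰₁(Ω)` set of those `x` all of whose predecessors lie in
`W`; this uses `k ≥ 1`. -/
theorem Wm_down {x y : M} (hx : Wm x) (hy : Olt y x) : Wm y := by
  have hd : Def .pi 1 (fun v : ℕ → M => ∀ y, Olt y (v 0) → Wm y) :=
    Def.all (r := fun v y => Olt y (v 0) → Wm y) (Def.of_D0 inferInstance _ _)
  exact hd.accInduction WModel.one_le_k (fun _ => 0)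
    (fun x ih y hy => Wm_intro fun z hz => ih y hy z hz) hx y hy

theorem not_Olt_zero (x : M) : ¬ Olt x 0 := fun h => not_LL_zero _ h.2.2

theorem Wm_zero : Wm (0 : M) := Wm_intro fun y hy => (not_Olt_zero y hy).elim

theorem NFm_theta {b : M} (h : NFm b) : NFm (cs 0 b 0) :=
  NFm_cs_iff.2 ⟨NFm_zero, h, NFm_zero, .inl rfl⟩

/-- Closure of the accessible part under addition, on the left by an additive principal number. -/
theorem Wm_add {b r : M} (hb : Wm (cs 0 b 0)) (hr : Wm r) (hN : NFm (cs 0 b r)) :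
    Wm (cs 0 b r) := by
  have hd : Def .pi 0 (fun v : ℕ → M => NFm (cs 0 (v 1) (v 0)) → Wm (cs 0 (v 1) (v 0))) :=
    Def.of_D0 inferInstance _ _
  refine hd.accInduction (Nat.zero_le _) (fun _ => b) (fun r ih hN => ?_) hr hN
  simp only [vcons] at ih hN ⊢
  refine Wm_intro fun x hx => ?_
  obtain ⟨hx1, -, hx2⟩ := hx
  rcases NFm_cases hx1 with rfl | ⟨a', b', r', rfl⟩
  · exact Wm_zero
  rw [LL_cs_iff] at hx2
  rcases hx2 with h | ⟨rfl, h | ⟨rfl, h⟩⟩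
  · exact (not_LL_zero _ h).elim
  -- A smaller leading summand already puts the whole sum `x` below `ϑ(b)`, by the lexicographic
  -- comparison.
  · exact Wm_down hb ⟨hx1, NFm_theta (NFm_cs_iff.1 hN).2.1, LL_cs_iff.2 (.inr ⟨rfl, .inl h⟩)⟩
  · exact ih r' ⟨(NFm_cs_iff.1 hx1).2.2.1, (NFm_cs_iff.1 hN).2.2.1, h⟩ hx1

/-! ### Terms all of whose coefficients are accessible -/

/-- The clause does not descend into `b`, because `K` stops at `ϑ(b)`. -/
def clauseC (Y : M → Prop) (z : M) : Prop :=
  z = 0 ∨ ∃ a b r, z = cs a b r ∧ (Y a ∧ Wm (cs 0 b 0) ∧ Y r)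

/-- All elements of `K(x)` are accessible. -/
def CC (x : M) : Prop := ClMem clauseC x

instance D0.CC {f : (ℕ → M) → M} [hf : TF f] : D0 (fun v => CC (f v)) := by
  refine D0.comp1 (p := fun x => WeakID.CC x) ?_ hf
  unfold WeakID.CC ClMem clauseC
  infer_instance

theorem CC_clause (x : M) : CC x ↔ clauseC CC x := by
  refine clMem_iff (F := fun v => clauseC (fun i => bit i (v 0)) (v 1)) ?_
    (fun _ => 0) (fun _ _ => Iff.rfl) ?_ x
  · unfold clauseC
    infer_instance
  · rintro Y Y' z h (rfl | ⟨a, b, r, rfl, h1, h2, h3⟩)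
    · exact .inl rfl
    · exact .inr ⟨a, b, r, rfl, h _ (lt_cs_a _ _ _) h1, h2, h _ (lt_cs_r _ _ _) h3⟩

theorem CC_zero : CC (0 : M) := (CC_clause 0).2 (.inl rfl)

theorem CC_cs_iff {a b r : M} : CC (cs a b r) ↔ CC a ∧ Wm (cs 0 b 0) ∧ CC r := by
  rw [CC_clause]
  constructor
  · rintro (h | ⟨_, _, _, h, h'⟩)
    · exact (cs_ne_zero _ _ _ h).elim
    · obtain ⟨rfl, rfl, rfl⟩ := cs_inj h
      exact h'
  · exact fun h => .inr ⟨_, _, _, rfl, h⟩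

def Ok (x : M) : Prop := NFm x ∧ CC x

instance D0.Ok {f : (ℕ → M) → M} [TF f] : D0 (fun v => Ok (f v)) :=
  inferInstanceAs (D0 (fun v => WeakID.NFm (f v) ∧ WeakID.CC (f v)))

/-- `X` is progressive along the order restricted to `CC`. -/
def Prog (X : M → Prop) : Prop := ∀ x, Ok x → (∀ y, Olt y x → CC y → X y) → X x

/-- Here `ϑ(b)` is at most some element of `K(x)`, which is accessible, and `W` is closed downwards.
The element is found by recursion on the code of `x`. -/
theorem Wm_of_NN {b x : M} (hb : NFm b) (hx : Ok x) (h : NN b x) : Wm (cs 0 b 0) := by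
  refine D0.strongInduction (p := fun v => Ok (v 0) → NN (v 1) (v 0) → Wm (cs 0 (v 1) 0))
    inferInstance (fun _ => b) (fun x ih hx h => ?_) x hx h
  simp only [vcons] at ih hx h ⊢
  rcases NFm_cases hx.1 with rfl | ⟨a', b', r', rfl⟩
  · exact (not_NN_zero _ h).elim
  obtain ⟨hN, hC⟩ := hx
  rw [NFm_cs_iff] at hN
  rw [CC_cs_iff] at hC
  rcases NN_cs_iff.1 h with h | (rfl | h) | h
  · exact ih a' (lt_cs_a _ _ _) ⟨hN.1, hC.1⟩ h
  · exact hC.2.1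
  · exact Wm_down hC.2.1 ⟨NFm_theta hb, NFm_theta hN.2.1, LL_cs_iff.2 (.inr ⟨rfl, .inl h⟩)⟩
  · exact ih r' (lt_cs_r _ _ _) ⟨hN.2.2.1, hC.2.2⟩ h

/-- The elements of `K(z)` lie below `ϑ(α)` and have codes below `x`, so the side induction on codes
in `prog_theta`, whose hypothesis is assumed here, already puts them into `W`. -/
theorem CC_of_KK {x α z : M} (hα : NFm α) (hx : ∀ y, y < x → Olt y (cs 0 α 0) → Wm y)
    (hz : z < x) (hN : NFm z) (hK : KK z α) : CC z := by
  refine D0.strongInduction (p := fun v => v 0 < v 1 → NFm (v 0) → KK (v 0) (v 2) →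
    (∀ y, y < v 1 → Olt y (cs 0 (v 2) 0) → Wm y) → CC (v 0))
    inferInstance (vcons x fun _ => α) (fun z ih hz hN hK hx => ?_) z hz hN hK hx
  simp only [vcons] at ih hz hN hK hx ⊢
  rcases NFm_cases hN with rfl | ⟨a, b, r, rfl⟩
  · exact CC_zero
  rw [NFm_cs_iff] at hN
  rw [KK_cs_iff] at hK
  refine CC_cs_iff.2 ⟨ih a (lt_cs_a _ _ _) ((lt_cs_a _ _ _).trans hz) hN.1 hK.1 hx, ?_,
    ih r (lt_cs_r _ _ _) ((lt_cs_r _ _ _).trans hz) hN.2.2.1 hK.2.2 hx⟩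
  -- The code of `ϑ(b)` does not exceed that of `Ω^a · ϑ(b) + r`, by monotonicity of the coding.
  exact hx _ (lt_of_le_of_lt (cs_mono (zero_le' _) le_rfl (zero_le' _)) hz)
    ⟨NFm_theta hN.2.1, NFm_theta hα, LL_cs_iff.2 (.inr ⟨rfl, .inl hK.2.1⟩)⟩

/-- Progressiveness of `ϑ(x) ∈ W`. -/
theorem prog_theta : Prog (fun x : M => Wm (cs 0 x 0)) := by
  intro α hα hprog
  suffices h : ∀ x, Olt x (cs 0 α 0) → Wm x from Wm_intro h
  intro x
  -- Side induction on the code of `x`; the predecessors of `ϑ(α)` are treated in the order of their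
  -- codes.
  refine D0.strongInduction (p := fun v => Olt (v 0) (cs 0 (v 1) 0) → Wm (v 0))
    inferInstance (fun _ => α) (fun x ih hx => ?_) x
  simp only [vcons] at ih hx ⊢
  rcases NFm_cases hx.1 with rfl | ⟨a, b, r, rfl⟩
  · exact Wm_zero
  have hN := NFm_cs_iff.1 hx.1
  rcases LL_cs_iff.1 hx.2.2 with h | ⟨rfl, h | ⟨rfl, h⟩⟩
  · exact (not_LL_zero _ h).elim
  · have hb : Wm (cs 0 b 0) := by
      -- Either `b < α` and `K(b)` lies below `ϑ(α)`, where progressiveness applies once `K(b)` is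
      -- known to be accessible, or an element of `K(α)` bounds `ϑ(b)`.
      rcases h with ⟨h1, h2⟩ | h
      · exact hprog b ⟨hN.2.1, hα.1, h1⟩ (CC_of_KK hα.1 ih (lt_cs_b _ _ _) hN.2.1 h2)
      · exact Wm_of_NN hN.2.1 hα h
    refine Wm_add hb ?_ hx.1
    -- If the rest starts with `ϑ(b)` again, it is still below `ϑ(α)` and has a smaller code; if it
    -- starts with something smaller, it is below `ϑ(b)`.
    rcases hN.2.2.2 with rfl | ⟨a', b', r', rfl, h' | ⟨rfl, rfl | h'⟩⟩
    · exact Wm_zero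
    · exact (not_LL_zero _ h').elim
    · exact ih _ (lt_cs_r _ _ _) ⟨hN.2.2.1, hx.2.1, LL_cs_iff.2 (.inr ⟨rfl, .inl h⟩)⟩
    · exact Wm_down hb ⟨hN.2.2.1, NFm_theta hN.2.1, LL_cs_iff.2 (.inr ⟨rfl, .inl h'⟩)⟩
  · exact (not_LL_zero _ h).elim

/-! ### Concatenation -/

theorem D0.comp5 {p : M → M → M → M → M → Prop}
    (hp : D0 (fun v => p (v 0) (v 1) (v 2) (v 3) (v 4))) {f₀ f₁ f₂ f₃ f₄ : (ℕ → M) → M}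
    (h₀ : TF f₀) (h₁ : TF f₁) (h₂ : TF f₂) (h₃ : TF f₃) (h₄ : TF f₄) :
    D0 (fun v => p (f₀ v) (f₁ v) (f₂ v) (f₃ v) (f₄ v)) :=
  hp.comp (TF.vcons h₀ (TF.vcons h₁ (TF.vcons h₂ (TF.vcons h₃ (s := fun _ => f₄) fun _ => h₄))))

/-- Triples `(β, η, γ)` are coded as nested pairs, with `a` and `ρ` fixed. The summands of `β` are
stripped from `γ`, then those of `η` with exponent `a` in place of `0`, until `ρ` remains. -/
def clauseQ (a ρ : M) (Y : M → Prop) (z : M) : Prop :=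
  ∃ β, β ≤ z ∧ ∃ η, η ≤ z ∧ ∃ γ, γ ≤ z ∧ z = pr2 β (pr2 η γ) ∧
    ((∃ a₁ b₁ β', β = cs a₁ b₁ β' ∧ ∃ a₂ b₂ γ', γ = cs a₂ b₂ γ' ∧
      (a₂ = a₁ ∧ b₂ = b₁ ∧ Y (pr2 β' (pr2 η γ')))) ∨
    (β = 0 ∧ ∃ a₁ b₁ η', η = cs a₁ b₁ η' ∧ ∃ a₂ b₂ γ', γ = cs a₂ b₂ γ' ∧
      (a₁ = 0 ∧ a₂ = a ∧ b₂ = b₁ ∧ Y (pr2 0 (pr2 η' γ')))) ∨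
    (β = 0 ∧ η = 0 ∧ γ = ρ))

/-- `γ` is the concatenation of `β`, `Ω ^ a · η` and `ρ`. -/
def Cat (a β η ρ γ : M) : Prop := ClMem (clauseQ a ρ) (pr2 β (pr2 η γ))

instance D0.Cat {a β η ρ γ : (ℕ → M) → M} [ha : TF a] [hβ : TF β] [hη : TF η] [hρ : TF ρ]
    [hγ : TF γ] : D0 (fun v => Cat (a v) (β v) (η v) (ρ v) (γ v)) := by
  refine D0.comp5 (p := fun a β η ρ γ => WeakID.Cat a β η ρ γ) ?_ ha hβ hη hρ hγ
  unfold WeakID.Cat ClMem clauseQ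
  infer_instance

theorem Cat_iff {a β η ρ γ : M} : Cat a β η ρ γ ↔
    (∃ a₁ b₁ β' γ', β = cs a₁ b₁ β' ∧ γ = cs a₁ b₁ γ' ∧ Cat a β' η ρ γ') ∨
    (β = 0 ∧ ∃ b₁ η' γ', η = cs 0 b₁ η' ∧ γ = cs a b₁ γ' ∧ Cat a 0 η' ρ γ') ∨
    (β = 0 ∧ η = 0 ∧ γ = ρ) := by
  have hcl : ClMem (clauseQ a ρ) (pr2 β (pr2 η γ)) ↔
      clauseQ a ρ (ClMem (clauseQ a ρ)) (pr2 β (pr2 η γ)) := by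
    refine clMem_iff (F := fun v => clauseQ (v 2) (v 3) (fun i => bit i (v 0)) (v 1)) ?_
      (vcons a fun _ => ρ) (fun _ _ => Iff.rfl) ?_ _
    · unfold clauseQ
      infer_instance
    · rintro Y Y' z h ⟨β, hβ, η, hη, γ, hγ, rfl, hc⟩
      refine ⟨β, hβ, η, hη, γ, hγ, rfl, ?_⟩
      rcases hc with ⟨a₁, b₁, β', rfl, a₂, b₂, γ', rfl, h1, h2, h3⟩ |
        ⟨h0, a₁, b₁, η', rfl, a₂, b₂, γ', rfl, h1, h2, h3, h4⟩ | hc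
      · exact .inl ⟨a₁, b₁, β', rfl, a₂, b₂, γ', rfl, h1, h2, h _ (pr2_lt_of_add_lt
          (add_lt_add_of_lt_of_le (lt_cs_r _ _ _) (pr2_mono le_rfl (lt_cs_r _ _ _).le))) h3⟩
      · refine .inr (.inl ⟨h0, a₁, b₁, η', rfl, a₂, b₂, γ', rfl, h1, h2, h3, h _ ?_ h4⟩)
        rw [h0]
        refine pr2_lt_of_add_lt ?_
        rw [zero_add, zero_add]
        exact pr2_lt_of_add_lt (add_lt_add (lt_cs_r _ _ _) (lt_cs_r _ _ _))
      · exact .inr (.inr hc)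
  rw [Cat, hcl]
  constructor
  · rintro ⟨_, -, _, -, _, -, h, hc⟩
    obtain ⟨rfl, h'⟩ := pr2_inj h
    obtain ⟨rfl, rfl⟩ := pr2_inj h'
    rcases hc with ⟨a₁, b₁, β', rfl, a₂, b₂, γ', rfl, rfl, rfl, h3⟩ |
      ⟨h0, a₁, b₁, η', rfl, a₂, b₂, γ', rfl, rfl, rfl, rfl, h4⟩ | hc
    · exact .inl ⟨_, _, _, _, rfl, rfl, h3⟩
    · exact .inr (.inl ⟨h0, _, _, _, rfl, rfl, h4⟩)
    · exact .inr (.inr hc)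
  · intro hc
    refine ⟨β, le_pr2_left _ _, η, (le_pr2_left _ _).trans (le_pr2_right _ _), γ,
      (le_pr2_right _ _).trans (le_pr2_right _ _), rfl, ?_⟩
    rcases hc with ⟨a₁, b₁, β', γ', rfl, rfl, h3⟩ | ⟨h0, b₁, η', γ', rfl, rfl, h4⟩ | hc
    · exact .inl ⟨_, _, _, rfl, _, _, _, rfl, rfl, rfl, h3⟩
    · exact .inr (.inl ⟨h0, _, _, _, rfl, _, _, _, rfl, rfl, rfl, rfl, h4⟩)
    · exact .inr (.inr hc)

theorem Cat_zero (a ρ : M) : Cat a 0 0 ρ ρ := Cat_iff.2 (.inr (.inr ⟨rfl, rfl, rfl⟩))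

theorem Cat.cons {a β η ρ γ : M} (h : Cat a β η ρ γ) (a₁ b₁ : M) :
    Cat a (cs a₁ b₁ β) η ρ (cs a₁ b₁ γ) :=
  Cat_iff.2 (.inl ⟨_, _, _, _, rfl, rfl, h⟩)

theorem Cat.coeff {a η ρ γ : M} (h : Cat a 0 η ρ γ) (b₁ : M) :
    Cat a 0 (cs 0 b₁ η) ρ (cs a b₁ γ) :=
  Cat_iff.2 (.inr (.inl ⟨rfl, _, _, _, rfl, rfl, h⟩))

/-- Induction on the last argument of `Cat`, with parameters `w`. -/
theorem Cat.induction {p : (ℕ → M) → Prop} (hp : Def .pi 1 p) {a ρ : M} (w : ℕ → M)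
    (hcons : ∀ a₁ b₁ β η γ, Cat a β η ρ γ →
      p (vcons γ (vcons β (vcons η (vcons a (vcons ρ w))))) →
      p (vcons (cs a₁ b₁ γ) (vcons (cs a₁ b₁ β) (vcons η (vcons a (vcons ρ w))))))
    (hcoeff : ∀ b₁ η γ, Cat a 0 η ρ γ → p (vcons γ (vcons 0 (vcons η (vcons a (vcons ρ w))))) →
      p (vcons (cs a b₁ γ) (vcons 0 (vcons (cs 0 b₁ η) (vcons a (vcons ρ w))))))
    (hzero : p (vcons ρ (vcons 0 (vcons 0 (vcons a (vcons ρ w))))))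
    {β η γ : M} (h : Cat a β η ρ γ) : p (vcons γ (vcons β (vcons η (vcons a (vcons ρ w))))) := by
  have hc : Def .pi 1 (fun v : ℕ → M => p (vcons (v 2) (vcons (v 1) (vcons (v 0)
      fun i => v (i + 3))))) :=
    hp.comp (TF.vcons (TF.var 2) (TF.vcons (TF.var 1) (TF.vcons (s := fun i v => v (i + 3))
      (TF.var 0) fun i => TF.var (i + 3))))
  -- The parts `β` and `η` shrink together with `γ`, so they have to be quantified; this is why
  -- strong induction for `Π⁰₁(Ω)` is used.
  have hd : Def .pi 1 (fun v : ℕ → M => ∀ β η, Cat (v 1) β η (v 2) (v 0) →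
      p (vcons (v 0) (vcons β (vcons η fun i => v (i + 1))))) := by
    refine Def.all (r := fun v β => ∀ η, Cat (v 1) β η (v 2) (v 0) →
      p (vcons (v 0) (vcons β (vcons η fun i => v (i + 1)))))
      (Def.all (r := fun v η => Cat (v 2) (v 0) η (v 3) (v 1) →
      p (vcons (v 1) (vcons (v 0) (vcons η fun i => v (i + 2)))))
      (Def.imp (Def.of_D0 inferInstance _ _) hc))
  refine hd.strongInduction (vcons a (vcons ρ w)) (fun γ ih β η h => ?_) γ β η h
  rcases Cat_iff.1 (show Cat a β η ρ γ from h) with ⟨a₁, b₁, β', γ', rfl, rfl, h1⟩ |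
    ⟨rfl, b₁, η', γ', rfl, rfl, h1⟩ | ⟨rfl, rfl, rfl⟩
  · exact hcons _ _ _ _ _ h1 (ih γ' (lt_cs_r _ _ _) β' η h1)
  · exact hcoeff _ _ _ h1 (ih γ' (lt_cs_r _ _ _) 0 η' h1)
  · exact hzero

theorem Cat.eq_of_zero {a β γ : M} (h : Cat a β 0 0 γ) : γ = β := by
  refine Cat.induction (p := fun v => v 2 = 0 → v 4 = 0 → v 0 = v 1)
    (Def.of_D0 inferInstance _ _) (fun _ => 0) ?_ ?_ ?_ h rfl rfl
  · intro a₁ b₁ β η γ _ ih h h'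
    simp only [vcons] at ih h h' ⊢
    rw [ih h h']
  · exact fun b₁ η γ _ _ h => (cs_ne_zero _ _ _ h).elim
  · exact fun _ h => h

theorem Cat.ok_right {a β η ρ γ : M} (h : Cat a β η ρ γ) (hγ : Ok γ) : Ok ρ := by
  refine Cat.induction (p := fun v => Ok (v 0) → Ok (v 4))
    (Def.of_D0 inferInstance _ _) (fun _ => 0) ?_ ?_ ?_ h hγ
  · exact fun a₁ b₁ β η γ _ ih h => ih ⟨(NFm_cs_iff.1 h.1).2.2.1, (CC_cs_iff.1 h.2).2.2⟩
  · exact fun b₁ η γ _ ih h => ih ⟨(NFm_cs_iff.1 h.1).2.2.1, (CC_cs_iff.1 h.2).2.2⟩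
  · exact fun h => h

/-- The summands of `η` occur as coefficients in `γ`, so they are accessible, and `W` is closed
under the normal form sums. -/
theorem Cat.coeff_mem {a β η ρ γ : M} (h : Cat a β η ρ γ) (hγ : CC γ) (hη : NFm η) : Wm η := by
  refine Cat.induction (p := fun v => CC (v 0) → NFm (v 2) → Wm (v 2))
    (Def.of_D0 inferInstance _ _) (fun _ => 0) ?_ ?_ ?_ h hγ hη
  · exact fun a₁ b₁ β η γ _ ih hC hN => ih (CC_cs_iff.1 hC).2.2 hN
  · exact fun b₁ η γ _ ih hC hN => Wm_add (CC_cs_iff.1 hC).2.1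
      (ih (CC_cs_iff.1 hC).2.2 (NFm_cs_iff.1 hN).2.2.1) hN
  · exact fun _ _ => Wm_zero

/-- Concatenation with a decomposed last part. -/
theorem Cat.comp {a β ρ γ a' η ρ' : M} (h : Cat a β 0 ρ γ) (h' : Cat a' 0 η ρ' ρ) :
    Cat a' β η ρ' γ := by
  refine Cat.induction (p := fun v => v 2 = 0 → Cat (v 5) 0 (v 6) (v 7) (v 4) →
    Cat (v 5) (v 1) (v 6) (v 7) (v 0)) (Def.of_D0 inferInstance _ _)
    (vcons a' (vcons η fun _ => ρ')) ?_ ?_ ?_ h rfl h'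
  · exact fun a₁ b₁ β η γ _ ih h h' => (ih h h').cons a₁ b₁
  · exact fun b₁ η γ _ _ h => (cs_ne_zero _ _ _ h).elim
  · exact fun _ h => h

/-- Whether a summand may precede `r` depends on the leading summand of `r` alone. -/
theorem Heads.of_head {a b r r' : M} (h : Heads a b r') (hr : r = 0 ∨ ∃ a₁ b₁ r₁, r = cs a₁ b₁ r₁ ∧
    ∃ a₂ b₂ r₂, r' = cs a₂ b₂ r₂ ∧ (a₂ = a₁ ∧ b₂ = b₁)) : Heads a b r := by
  rcases hr with rfl | ⟨a₁, b₁, r₁, rfl, a₂, b₂, r₂, rfl, rfl, rfl⟩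
  · exact .inl rfl
  · rcases h with h | ⟨a', b', r', h, h'⟩
    · exact (cs_ne_zero _ _ _ h).elim
    · obtain ⟨rfl, rfl, rfl⟩ := cs_inj h
      exact .inr ⟨_, _, _, rfl, h'⟩

/-- Concatenation with the first two parts joined. -/
theorem Cat.exists_prefix {a β η ρ γ : M} (h : Cat a β η ρ γ) (hγ : Ok γ) :
    ∃ δ, Ok δ ∧ Cat a β η 0 δ ∧ Cat a δ 0 ρ γ := by
  -- That `δ` is zero or begins like `γ` is added to carry the normal form condition from `γ` over
  -- to `δ`. The bound `δ ≤ γ` keeps the formula bounded.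
  have key : ∃ δ, δ ≤ γ ∧ (Ok δ ∧ Cat a β η 0 δ ∧ Cat a δ 0 ρ γ ∧
      (δ = 0 ∨ ∃ a₁ b₁ r₁, δ = cs a₁ b₁ r₁ ∧
        ∃ a₂ b₂ r₂, γ = cs a₂ b₂ r₂ ∧ (a₂ = a₁ ∧ b₂ = b₁))) := by
    refine Cat.induction (p := fun v => Ok (v 0) → ∃ δ, δ ≤ v 0 ∧ (Ok δ ∧
      Cat (v 3) (v 1) (v 2) 0 δ ∧ Cat (v 3) δ 0 (v 4) (v 0) ∧
      (δ = 0 ∨ ∃ a₁ b₁ r₁, δ = cs a₁ b₁ r₁ ∧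
        ∃ a₂ b₂ r₂, v 0 = cs a₂ b₂ r₂ ∧ (a₂ = a₁ ∧ b₂ = b₁))))
      (Def.of_D0 inferInstance _ _) (fun _ => 0) ?_ ?_ ?_ h hγ
    · intro a₁ b₁ β η γ _ ih hγ
      simp only [vcons] at ih hγ ⊢
      have hN := NFm_cs_iff.1 hγ.1
      have hC := CC_cs_iff.1 hγ.2
      obtain ⟨δ, h1, h2, h3, h4, h5⟩ := ih ⟨hN.2.2.1, hC.2.2⟩
      exact ⟨cs a₁ b₁ δ, cs_mono le_rfl le_rfl h1,
        ⟨NFm_cs_iff.2 ⟨hN.1, hN.2.1, h2.1, hN.2.2.2.of_head h5⟩,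
          CC_cs_iff.2 ⟨hC.1, hC.2.1, h2.2⟩⟩, h3.cons a₁ b₁, h4.cons a₁ b₁,
        .inr ⟨_, _, _, rfl, _, _, _, rfl, rfl, rfl⟩⟩
    · intro b₁ η γ _ ih hγ
      simp only [vcons] at ih hγ ⊢
      have hN := NFm_cs_iff.1 hγ.1
      have hC := CC_cs_iff.1 hγ.2
      obtain ⟨δ, h1, h2, h3, h4, h5⟩ := ih ⟨hN.2.2.1, hC.2.2⟩
      exact ⟨cs a b₁ δ, cs_mono le_rfl le_rfl h1,
        ⟨NFm_cs_iff.2 ⟨hN.1, hN.2.1, h2.1, hN.2.2.2.of_head h5⟩,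
          CC_cs_iff.2 ⟨hC.1, hC.2.1, h2.2⟩⟩, h3.coeff b₁, h4.cons a b₁,
        .inr ⟨_, _, _, rfl, _, _, _, rfl, rfl, rfl⟩⟩
    · intro _
      simp only [vcons]
      exact ⟨0, zero_le' _, ⟨NFm_zero, CC_zero⟩, Cat_zero _ _, Cat_zero _ _, .inl rfl⟩
  obtain ⟨δ, -, h1, h2, h3, -⟩ := key
  exact ⟨δ, h1, h2, h3⟩

/-- A normal form splits into the multiple of its leading power of `Ω` and the rest. -/
theorem exists_leading_coeff {a b r : M} (h : NFm (cs a b r)) :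
    ∃ η ρ, cs 0 b η ≤ cs a b r ∧ ρ ≤ cs a b r ∧ NFm (cs 0 b η) ∧
      Cat a 0 (cs 0 b η) ρ (cs a b r) ∧ Olt ρ (cs a 0 0) := by
  have key : ∀ x : M, NFm x → x = 0 ∨ ∃ a b r, x = cs a b r ∧ ∃ η, η ≤ x ∧ ∃ ρ, ρ ≤ x ∧
      (cs 0 b η ≤ x ∧ NFm (cs 0 b η) ∧ Cat a 0 (cs 0 b η) ρ x ∧ Olt ρ (cs a 0 0)) := by
    refine D0.strongInduction (p := fun v => NFm (v 0) → v 0 = 0 ∨ ∃ a b r, v 0 = cs a b r ∧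
      ∃ η, η ≤ v 0 ∧ ∃ ρ, ρ ≤ v 0 ∧
        (cs 0 b η ≤ v 0 ∧ NFm (cs 0 b η) ∧ Cat a 0 (cs 0 b η) ρ (v 0) ∧ Olt ρ (cs a 0 0)))
      inferInstance (fun _ => 0) (fun x ih hx => ?_)
    simp only [vcons] at ih hx ⊢
    rcases NFm_cases hx with rfl | ⟨a, b, r, rfl⟩
    · exact .inl rfl
    obtain ⟨ha, hb, hr, hh⟩ := NFm_cs_iff.1 hx
    have hΩ : NFm (cs a 0 0) := NFm_cs_iff.2 ⟨ha, NFm_zero, NFm_zero, .inl rfl⟩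
    -- If the rest is already below `Ω^a`, the leading coefficient is the single summand `ϑ(b)`.
    have leaf (h : Olt r (cs a 0 0)) : ∃ η, η ≤ cs a b r ∧ ∃ ρ, ρ ≤ cs a b r ∧
        (cs 0 b η ≤ cs a b r ∧ NFm (cs 0 b η) ∧ Cat a 0 (cs 0 b η) ρ (cs a b r) ∧
          Olt ρ (cs a 0 0)) :=
      ⟨0, zero_le' _, r, (lt_cs_r _ _ _).le, cs_mono (zero_le' _) le_rfl (zero_le' _),
        NFm_theta hb, (Cat_zero _ _).coeff b, h⟩
    refine .inr ⟨a, b, r, rfl, ?_⟩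
    rcases hh with rfl | ⟨a', b', r', rfl, h1 | ⟨rfl, h1⟩⟩
    · exact leaf ⟨NFm_zero, hΩ, zero_LL _ _ _⟩
    · exact leaf ⟨hr, hΩ, LL_cs_iff.2 (.inl h1)⟩
    · rcases ih _ (lt_cs_r _ _ _) hr with h2 | ⟨a₁, b₁, r₁, h2, η, -, ρ, hρ, h3, h4, h5, h6⟩
      · exact (cs_ne_zero _ _ _ h2).elim
      obtain ⟨rfl, rfl, rfl⟩ := cs_inj h2
      have hle : cs 0 b (cs 0 b' η) ≤ cs a' b (cs a' b' r') := cs_mono (zero_le' _) le_rfl h3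
      exact ⟨cs 0 b' η, (lt_cs_r _ _ _).le.trans hle, ρ, hρ.trans (lt_cs_r _ _ _).le, hle,
        NFm_cs_iff.2 ⟨NFm_zero, hb, h4, .inr ⟨_, _, _, rfl, .inr ⟨rfl, h1⟩⟩⟩, h5.coeff b, h6⟩
  rcases key _ h with h | ⟨_, _, _, h, η, -, ρ, hρ, h1, h2, h3, h4⟩
  · exact (cs_ne_zero _ _ _ h).elim
  · obtain ⟨rfl, rfl, rfl⟩ := cs_inj h
    exact ⟨η, ρ, h1, hρ, h2, h3, h4⟩

/-- What is below `β + Ω ^ a · η` is below `β` or below `β + Ω ^ a · (η' + 1)` for an `η' < η`. -/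
theorem Cat.below {a β η δ γ : M} (h : Cat a β η 0 δ) (ha : NFm a) (hη : NFm η) (hγ : NFm γ)
    (hlt : LL γ δ) : LL γ β ∨ ∃ η' ρ', NFm η' ∧ LL η' η ∧ Cat a β η' ρ' γ ∧ Olt ρ' (cs a 0 0) := by
  have key : LL γ β ∨ ∃ η', η' ≤ γ ∧ ∃ ρ', ρ' ≤ γ ∧
      (NFm η' ∧ LL η' η ∧ Cat a β η' ρ' γ ∧ Olt ρ' (cs a 0 0)) := by
    have hd : Def .pi 1 (fun v : ℕ → M => ∀ γ, NFm γ → NFm (v 2) → NFm (v 3) → v 4 = 0 →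
        LL γ (v 0) → LL γ (v 1) ∨ ∃ η', η' ≤ γ ∧ ∃ ρ', ρ' ≤ γ ∧
          (NFm η' ∧ LL η' (v 2) ∧ Cat (v 3) (v 1) η' ρ' γ ∧ Olt ρ' (cs (v 3) 0 0))) :=
      Def.all (r := fun v γ => NFm γ → NFm (v 2) → NFm (v 3) → v 4 = 0 →
        LL γ (v 0) → LL γ (v 1) ∨ ∃ η', η' ≤ γ ∧ ∃ ρ', ρ' ≤ γ ∧
          (NFm η' ∧ LL η' (v 2) ∧ Cat (v 3) (v 1) η' ρ' γ ∧ Olt ρ' (cs (v 3) 0 0)))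
        (Def.of_D0 inferInstance _ _)
    refine Cat.induction hd (fun _ => 0) ?_ ?_ ?_ h γ hγ hη ha rfl hlt
    · intro a₁ b₁ β η δ _ ih γ hγ hη ha h0 hlt
      simp only [vcons] at ih hη ha h0 hlt ⊢
      rcases NFm_cases hγ with rfl | ⟨a₂, b₂, r₂, rfl⟩
      · exact .inl (zero_LL _ _ _)
      rcases LL_cs_iff.1 hlt with h | ⟨rfl, h | ⟨rfl, h⟩⟩
      · exact .inl (LL_cs_iff.2 (.inl h))
      · exact .inl (LL_cs_iff.2 (.inr ⟨rfl, .inl h⟩))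
      · rcases ih r₂ (NFm_cs_iff.1 hγ).2.2.1 hη ha h0 h with h |
          ⟨η', h1, ρ', h2, h3, h4, h5, h6⟩
        · exact .inl (LL_cs_iff.2 (.inr ⟨rfl, .inr ⟨rfl, h⟩⟩))
        · exact .inr ⟨η', h1.trans (lt_cs_r _ _ _).le, ρ', h2.trans (lt_cs_r _ _ _).le, h3, h4,
            h5.cons _ _, h6⟩
    · intro b₁ η δ _ ih γ hγ hη ha h0 hlt
      simp only [vcons] at ih hη ha h0 hlt ⊢
      have hη' := NFm_cs_iff.1 hη
      have hΩ : NFm (cs a 0 0) := NFm_cs_iff.2 ⟨ha, NFm_zero, NFm_zero, .inl rfl⟩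
      refine .inr ?_
      rcases NFm_cases hγ with rfl | ⟨a₂, b₂, r₂, rfl⟩
      · exact ⟨0, le_rfl, 0, le_rfl, NFm_zero, zero_LL _ _ _, Cat_zero _ _, NFm_zero, hΩ,
          zero_LL _ _ _⟩
      have hN := NFm_cs_iff.1 hγ
      rcases LL_cs_iff.1 hlt with h | ⟨rfl, h | ⟨rfl, h⟩⟩
      -- With a smaller leading exponent all of `γ` is a remainder, and `η' = 0`.
      · exact ⟨0, zero_le' _, _, le_rfl, NFm_zero, zero_LL _ _ _, Cat_zero _ _, hγ, hΩ,
          LL_cs_iff.2 (.inl h)⟩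
      -- The exponents agree and the first coefficient summand decreases, so `η'` is the full
      -- leading coefficient of `γ`.
      · obtain ⟨η', ρ', h1, h2, h3, h4, h5⟩ := exists_leading_coeff hγ
        exact ⟨_, h1, ρ', h2, h3, LL_cs_iff.2 (.inr ⟨rfl, .inl h⟩), h4, h5⟩
      · rcases ih r₂ hN.2.2.1 hη'.2.2.1 ha h0 h with h | ⟨η', h1, ρ', h2, h3, h4, h5, h6⟩
        · exact (not_LL_zero _ h).elim
        -- Irreflexivity of the order is not available here. If prefixing `ϑ(b₂)` to `η'` fails to
        -- give a normal form, then normality of `γ` can only come from `a₂ < a₂`. In that case all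
        -- of `r₂` counts as a remainder below `Ω^{a₂}`, and `ϑ(b₂)` alone serves as `η'`.
        by_cases hh : Heads 0 b₂ η'
        · exact ⟨cs 0 b₂ η', cs_mono (zero_le' _) le_rfl h1, ρ', h2.trans (lt_cs_r _ _ _).le,
            NFm_cs_iff.2 ⟨NFm_zero, hN.2.1, h3, hh⟩,
            LL_cs_iff.2 (.inr ⟨rfl, .inr ⟨rfl, h4⟩⟩), h5.coeff _, h6⟩
        · have hr : Olt r₂ (cs a₂ 0 0) := by
            rcases Cat_iff.1 h5 with ⟨_, _, _, _, h, -⟩ | ⟨-, b₃, η₁, γ₁, rfl, rfl, -⟩ |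
              ⟨-, rfl, -⟩
            · exact (cs_ne_zero _ _ _ h.symm).elim
            · rcases hN.2.2.2 with h | ⟨_, _, _, h, h' | ⟨-, h'⟩⟩
              · exact (cs_ne_zero _ _ _ h).elim
              · obtain ⟨rfl, rfl, rfl⟩ := cs_inj h
                exact ⟨hN.2.2.1, hΩ, LL_cs_iff.2 (.inl h')⟩
              · obtain ⟨-, rfl, -⟩ := cs_inj h
                exact (hh (.inr ⟨_, _, _, rfl, .inr ⟨rfl, h'⟩⟩)).elim
            · exact (hh (.inl rfl)).elim
          refine ⟨cs 0 b₂ 0, cs_mono (zero_le' _) le_rfl (zero_le' _), r₂, (lt_cs_r _ _ _).le,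
            NFm_theta hN.2.1, LL_cs_iff.2 (.inr ⟨rfl, .inr ⟨rfl, ?_⟩⟩), (Cat_zero _ _).coeff _, hr⟩
          rcases NFm_cases hη'.2.2.1 with rfl | ⟨_, _, _, rfl⟩
          · exact (not_LL_zero _ h4).elim
          · exact zero_LL _ _ _
    · intro γ hγ hη ha h0 hlt
      simp only [vcons] at hlt
      exact (not_LL_zero _ hlt).elim
  exact key.imp id fun ⟨η', _, ρ', _, h⟩ => ⟨η', ρ', h⟩

/-! ### The jump -/

def Below (X : M → Prop) (δ : M) : Prop := ∀ γ, Olt γ δ → CC γ → X γ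

/-- `Below X β` implies `Below X (β + Ω ^ a)`. -/
def Jump (X : M → Prop) (a : M) : Prop :=
  ∀ β, Ok β → Below X β → ∀ γ ρ, Ok γ ∧ Cat a β 0 ρ γ ∧ Olt ρ (cs a 0 0) → X γ

theorem Def.below {X : M → Prop} {n : ℕ} (hX : Def .pi (n + 1) (fun v => X (v 0))) (i : ℕ) :
    Def .pi (n + 1) (fun v => Below X (v i)) :=
  Def.all (r := fun v γ => Olt γ (v i) → CC γ → X γ)
    (Def.imp (Def.of_D0 inferInstance _ _) (Def.imp (Def.of_D0 inferInstance _ _) hX))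

/-- The hypothesis on everything below `β` is a `Π` formula in an antecedent; this is what costs one
quantifier alternation. -/
theorem Def.jump {X : M → Prop} {n : ℕ} (hX : Def .pi (n + 1) (fun v => X (v 0))) :
    Def .pi (n + 2) (fun v => Jump X (v 0)) := by
  refine Def.all (r := fun v β => Ok β → Below X β → ∀ γ ρ, Ok γ ∧ Cat (v 0) β 0 ρ γ ∧
    Olt ρ (cs (v 0) 0 0) → X γ) (Def.imp (Def.of_D0 inferInstance _ _)
      (Def.imp ((hX.below 0).up _) (Def.up (c := .pi) ?_ _)))
  refine Def.all (r := fun v γ => ∀ ρ, Ok γ ∧ Cat (v 1) (v 0) 0 ρ γ ∧ Olt ρ (cs (v 1) 0 0) → X γ)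
    (Def.all (r := fun v ρ => Ok (v 0) ∧ Cat (v 2) (v 1) 0 ρ (v 0) ∧ Olt ρ (cs (v 2) 0 0) →
      X (v 0)) (Def.imp (Def.of_D0 inferInstance _ _) ?_))
  exact hX.comp (s := fun i v => v (i + 1)) fun i => TF.var (i + 1)

/-- From `β` to `β + Ω ^ a · η` for accessible `η`. -/
theorem Jump.mul {X : M → Prop} {n : ℕ} (hX : Def .pi (n + 1) (fun v => X (v 0)))
    (hn : n + 1 ≤ WModel.k M) {a β : M} (ha : NFm a) (hJ : Jump X a)
    (hβ : Ok β) (hB : Below X β) {η : M} (hη : Wm η) (hN : NFm η) {γ ρ : M}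
    (h : Ok γ ∧ Cat a β η ρ γ ∧ Olt ρ (cs a 0 0)) : X γ := by
  have hd : Def .pi (n + 1) (fun v : ℕ → M => NFm (v 0) → ∀ γ ρ, Ok γ ∧
      Cat (v 1) (v 2) (v 0) ρ γ ∧ Olt ρ (cs (v 1) 0 0) → X γ) := by
    refine Def.imp (Def.of_D0 inferInstance _ _) ?_
    refine Def.all (r := fun v γ => ∀ ρ, Ok γ ∧ Cat (v 1) (v 2) (v 0) ρ γ ∧
      Olt ρ (cs (v 1) 0 0) → X γ)
      (Def.all (r := fun v ρ => Ok (v 0) ∧ Cat (v 2) (v 3) (v 1) ρ (v 0) ∧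
        Olt ρ (cs (v 2) 0 0) → X (v 0)) (Def.imp (Def.of_D0 inferInstance _ _) ?_))
    exact hX.comp (s := fun i v => v (i + 1)) fun i => TF.var (i + 1)
  -- Induction along `W` on `η`, with `γ` and `ρ` quantified. The hypotheses on `a` and `β` stay
  -- outside, so the formula is no more complex than `X`.
  refine hd.accInduction hn (vcons a fun _ => β) (fun η ih hN γ ρ h => ?_) hη hN γ ρ h
  obtain ⟨hγ, hcat, hρ⟩ := h
  obtain ⟨δ, hδ, h1, h2⟩ := Cat.exists_prefix (show Cat a β η ρ γ from hcat) hγ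
  -- Here `δ` is `β + Ω^a · η`. What lies below it is below `β` or has the form `β + Ω^a · η' + ρ'`
  -- with `η' < η`, so the induction hypothesis applies.
  refine hJ δ hδ (fun γ' hγ' hC => ?_) γ ρ ⟨hγ, h2, hρ⟩
  rcases h1.below ha hN hγ'.1 hγ'.2.2 with h3 | ⟨η', ρ', h3, h4, h5⟩
  · exact hB γ' ⟨hγ'.1, hβ.1, h3⟩ hC
  · exact ih η' ⟨h3, hN, h4⟩ h3 γ' ρ' ⟨⟨hγ'.1, hC⟩, h5⟩

theorem Olt_omegaPow_cases {a ρ : M} (h : Olt ρ (cs a 0 0)) :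
    ρ = 0 ∨ ∃ a' b r, ρ = cs a' b r ∧ Olt a' a := by
  obtain ⟨h1, h2, h3⟩ := h
  refine (NFm_cases h1).imp id ?_
  rintro ⟨a', b, r, rfl⟩
  refine ⟨a', b, r, rfl, (NFm_cs_iff.1 h1).1, (NFm_cs_iff.1 h2).1, ?_⟩
  rcases LL_cs_iff.1 h3 with h | ⟨-, h | ⟨-, h⟩⟩
  · exact h
  · exact (not_TT_zero _ h).elim
  · exact (not_LL_zero _ h).elim

/-- If the remainder is zero, then `γ = β` and progressiveness of `X` applies. Otherwise it starts
with `Ω^{a'} · η` for some `a' < a`. Its coefficient `η` is accessible because those of `γ` are, so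
the jump at `a'` can be iterated along `η`. -/
theorem Prog.jump {X : M → Prop} {n : ℕ} (hX : Def .pi (n + 1) (fun v => X (v 0)))
    (hn : n + 1 ≤ WModel.k M) (hP : Prog X) : Prog (Jump X) := by
  intro a _ ih β hβ hB γ ρ h
  obtain ⟨hγ, hcat, hρ⟩ := h
  rcases Olt_omegaPow_cases hρ with rfl | ⟨a', b, r, rfl, ha'⟩
  · rw [hcat.eq_of_zero]
    exact hP β hβ hB
  · have hok := hcat.ok_right hγ
    obtain ⟨η, ρ', -, -, h1, h2, h3⟩ := exists_leading_coeff hok.1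
    exact Jump.mul hX hn ha'.1 (ih a' ha' (CC_cs_iff.1 hok.2).1) hβ hB (h2.coeff_mem hok.2 h1) h1
      ⟨hγ, hcat.comp h2, h3⟩

theorem Wm_one : Wm (cs 0 0 0 : M) :=
  prog_theta 0 ⟨NFm_zero, CC_zero⟩ fun y hy => (not_Olt_zero y hy).elim

theorem Ok_omegaPow {a : M} (h : Ok a) : Ok (cs a 0 0) :=
  ⟨NFm_cs_iff.2 ⟨h.1, NFm_zero, NFm_zero, .inl rfl⟩, CC_cs_iff.2 ⟨h.2, Wm_one, CC_zero⟩⟩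

/-- With `β = 0` everything below `Ω^a` is itself a remainder, so the jump puts it into `X`. -/
theorem Prog.omegaPow {X : M → Prop} (hP : Prog X) {a : M} (ha : Ok a) (hJ : Jump X a) :
    X (cs a 0 0) :=
  hP _ (Ok_omegaPow ha) fun γ hγ hC => hJ 0 ⟨NFm_zero, CC_zero⟩
    (fun _ h => (not_Olt_zero _ h).elim) γ γ ⟨⟨hγ.1, hC⟩, Cat_zero _ _, hγ⟩

/-! ### Standard terms -/

/-- The element of the model that codes a term. -/
def cd : OT → M
  | .zero => 0
  | .add a b r => cs (cd a) (cd b) (cd r)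

theorem val_numeral (v : ℕ → M) (n : ℕ) : (Term.numeral n).val v = (n : M) := by
  induction n with
  | zero => rw [Term.numeral, val_zero, Nat.cast_zero]
  | succ n ih => rw [Term.numeral, val_sc, ih, sc_eq, Nat.cast_succ]

theorem cast_code (s : OT) : (s.code : M) = cd s := by
  induction s with
  | zero => exact Nat.cast_zero
  | add a b r ha hb hr =>
    simp only [OT.code, OT.npair, cd, cs, pr2, Nat.cast_add, Nat.cast_mul, Nat.cast_one, ha, hb, hr]

/-- For a standard `ℓ` even a nonstandard model has no other predecessors, as a smaller summand
would be `ϑ` of something below `0` or have a negative exponent. -/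
theorem Olt_nat {ℓ : ℕ} {x : M} (h : Olt x (cd (OT.nat ℓ))) : ∃ j, j < ℓ ∧ x = cd (OT.nat j) := by
  induction ℓ generalizing x with
  | zero => exact (not_Olt_zero _ h).elim
  | succ ℓ ih =>
    obtain ⟨h1, h2, h3⟩ := h
    rcases NFm_cases h1 with rfl | ⟨a, b, r, rfl⟩
    · exact ⟨0, Nat.succ_pos _, rfl⟩
    have h3 : LL (cs a b r) (cs 0 0 (cd (OT.nat ℓ))) := h3
    rcases LL_cs_iff.1 h3 with h | ⟨rfl, h | ⟨rfl, h⟩⟩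
    · exact (not_LL_zero _ h).elim
    · exact (not_TT_zero _ h).elim
    · obtain ⟨j, hj, rfl⟩ := ih ⟨(NFm_cs_iff.1 h1).2.2.1, (NFm_cs_iff.1 h2).2.2.1, h⟩
      exact ⟨j + 1, Nat.succ_lt_succ hj, rfl⟩

theorem Ok_nat (ℓ : ℕ) : Ok (cd (OT.nat ℓ) : M) := by
  induction ℓ with
  | zero => exact ⟨NFm_zero, CC_zero⟩
  | succ ℓ ih =>
    refine ⟨NFm_cs_iff.2 ⟨NFm_zero, NFm_zero, ih.1, ?_⟩, CC_cs_iff.2 ⟨CC_zero, Wm_one, ih.2⟩⟩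
    cases ℓ with
    | zero => exact .inl rfl
    | succ ℓ => exact .inr ⟨_, _, _, rfl, .inr ⟨rfl, .inl rfl⟩⟩

/-- The induction on `ℓ` takes place outside the model, so `X` may exceed the complexity covered by
the schemata. This is needed for the `k`-th jump, which is only known to be `Π⁰ₖ₊₁(Ω)`. -/
theorem Prog.nat {X : M → Prop} (hP : Prog X) (ℓ : ℕ) : X (cd (OT.nat ℓ)) := by
  induction ℓ using Nat.strong_induction_on with
  | _ ℓ ih =>
    refine hP _ (Ok_nat ℓ) fun y hy _ => ?_
    obtain ⟨j, hj, rfl⟩ := Olt_nat hy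
    exact ih j hj

theorem Ok_tower (i ℓ : ℕ) : Ok (cd (OT.tower i (OT.nat ℓ)) : M) := by
  induction i with
  | zero => exact Ok_nat ℓ
  | succ i ih => exact Ok_omegaPow ih

/-- The iterated jumps of `ϑ(x) ∈ W`. -/
def JumpN : ℕ → M → Prop
  | 0 => fun x => Wm (cs 0 x 0)
  | i + 1 => Jump (JumpN i)

/-- The starting set is even bounded; it is counted as `Π⁰₁(Ω)` to fit the form of the jump. -/
theorem Def.jumpN (i : ℕ) : Def .pi (i + 1) (fun v : ℕ → M => JumpN i (v 0)) := by
  induction i with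
  | zero => exact Def.of_D0 (inferInstanceAs (D0 fun v : ℕ → M => Wm (cs 0 (v 0) 0))) _ _
  | succ i ih => exact ih.jump

/-- The step from `i` to `i + 1` uses induction along `W` for `Π⁰ᵢ₊₁(Ω)`, hence the restriction to
`i ≤ k`. -/
theorem prog_jumpN {i : ℕ} (hi : i ≤ WModel.k M) : Prog (JumpN i : M → Prop) := by
  induction i with
  | zero => exact prog_theta
  | succ i ih => exact Prog.jump (Def.jumpN i) hi (ih (Nat.le_of_succ_le hi))

/-- Each jump given up is exchanged for one more exponential, so `i + j` stays equal to `k`. -/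
theorem jumpN_tower (ℓ i j : ℕ) (h : i + j = WModel.k M) :
    JumpN j (cd (OT.tower i (OT.nat ℓ)) : M) := by
  induction i generalizing j with
  | zero => exact (prog_jumpN (by omega)).nat ℓ
  | succ i ih =>
    exact (prog_jumpN (by omega)).omegaPow (Ok_tower i ℓ) (ih (j + 1) (by omega))

theorem Wm_theta_tower (ℓ : ℕ) :
    Wm (cd (OT.theta (OT.tower (WModel.k M) (OT.nat ℓ))) : M) :=
  jumpN_tower ℓ (WModel.k M) 0 (Nat.add_zero _)

end accessible

end WeakID

theorem proposition2p2 (k : ℕ) (hk : 1 ≤ k) (ℓ : ℕ) :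
    WeakID.Provable (WeakID.PiID k)
      (WeakID.inW (WeakID.OT.theta (WeakID.OT.tower k (WeakID.OT.nat ℓ)))) := by
  -- The language is countable, as its predicate constants are formulas over a single predicate.
  refine WeakID.provable_of_models fun M _ R hax v => ?_
  let _ : WeakID.WModel M := { R := R, k := k, one_le_k := hk, ax := hax }
  have h := WeakID.Wm_theta_tower (M := M) ℓ
  rw [← WeakID.cast_code, ← WeakID.val_numeral v] at h
  exact h
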